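/- Let $m_e,k,\hbar>0$. Let $M=(\mathbb R^3\setminus\{0\})\times\mathbb R^3$ with coordinates $(q,p)$, symplectic form $\omega=\sum_{j=1}^3 dq_j\wedge dp_j$, and Hamiltonian $$H(q,p)=\frac{|p|^2}{2m_e}-\frac{k}{|q|},$$ with Hamiltonian vector field $\xi_H$ ($\iota_{\xi_H}\omega=dH$) and (incomplete) flow $\phi^t$. Let $V_n$ be the standard $2n$-dimensional symplectic vector space with symplectic basis $(v_1,\dots,v_n,w_1,\dots,w_n)$, let $\mathrm{Mp}^c(V_n)=\mathrm{Mp}(V_n)\times_{\mathbb Z_2}U(1)$ be its metaplectic-c group, with projection $\sigma:\mathrm{Mp}^c(V_n)\to\mathrm{Sp}(V_n)$ and determinant map $\eta:\mathrm{Mp}^c(V_n)\to U(1)$ (so $\ker\eta=\mathrm{Mp}(V_n)$ and $\eta(\lambda)=\lambda^2$ for $\lambda\in U(1)$). Identify $TM$ with $M\times V_3$ by $v_j\mapsto\partial/\partial q_j$, $w_j\mapsto\partial/\partial p_j$, hence the symplectic frame bundle $\mathrm{Sp}(M,\omega)$ with $M\times\mathrm{Sp}(V_3)$, and take the metaplectic-c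 prequantization $$P=M\times\mathrm{Mp}^c(V_3),\qquad \Sigma(m,a)=(m,\sigma(a)),\qquad \gamma=\frac1{i\hbar}\beta+\tfrac12\eta_*\vartheta_0,\qquad \beta=\sum_{j=1}^3\bigl(q_j\,dp_j+d(q_jp_j)\bigr),$$ where $\vartheta_0$ is the trivial connection on $P$. Let $W=\mathrm{span}\{v_1,v_2,v_3,w_1,w_2\}\subset V_3$, so that $W/W^\perp\cong V_2$, let $\mathrm{Sp}(V_3;W)\subset \mathrm{Sp}(V_3)$ be the stabilizer of $W$, $\mathrm{Mp}^c(V_3;W)=\sigma^{-1}(\mathrm{Sp}(V_3;W))$, and let $\hat\nu:\mathrm{Mp}^c(V_3;W)\to\mathrm{Mp}^c(V_2)$ be the lift, with $\eta_*\circ\hat\nu_*=\eta_*$, of the natural homomorphism $\nu:\mathrm{Sp}(V_3;W)\to\mathrm{Sp}(W/W^\perp)=\mathrm{Sp}(V_2)$. For a regular value $E$ of $H$ and $S=H^{-1}(E)$, let $P^S$ be the restriction of $P$ to the frames $b$ over $S$ with $bW=TS$, let $P_S=P^S\times_{\hat\nu}\mathrm{Mp}^c(V_2)$ be the associated bundle,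 which is a circle bundle over the symplectic frame bundle $\mathrm{Sp}(TS/TS^\perp)$, and let $\gamma_S$ be the connection one-form that $\gamma$ induces on $P_S$. The flow $\phi^t$ induces a flow $\tilde\phi^t$ on $\mathrm{Sp}(TS/TS^\perp)$ by $\tilde\phi^t(b)=\phi^t_*\circ b$. The number $E$ is called a *quantized energy level* of $(M,\omega,H)$ if it is a regular value of $H$ and $\gamma_S$ has trivial holonomy over all closed orbits of $\tilde\phi^t$ on $\mathrm{Sp}(TS/TS^\perp)$. Then: 1. If $E\ge 0$, then $\xi_H$ has no closed orbits in $H^{-1}(E)$, $\tilde\phi^t$ has no closed orbits on $\mathrm{Sp}(TS/TS^\perp)$, and (therefore) $E$ is a quantized energy level. 2. If $E<0$, then $E$ is a quantized energy level if and only if $$E=E_n=-\frac{m_ek^2}{2n^2\hbar^2}\qquad\text{for some integer } n\ge 1 .$$ -/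

import Mathlib

/-
Metaplectic-c quantized energy levels, following the bundles
  (P^S, γ^S) → Sp(M, ω; S) → S   and   (P_S, γ_S) → Sp(TS / TS^⊥) → S
over a level set S = H⁻¹(E) of a Hamiltonian H on an open subset M of the symplectic vector space
V_{n+1} = ℝ^{2n+2}, and the Hamiltonian of the hydrogen atom (Kepler problem).
-/

noncomputable section

open scoped Matrix ComplexOrder

namespace MpcQuant

/-- The model symplectic vector space `V_n`; the coordinates of `u` are `u (inl j)` along `v_j`
and `u (inr j)` along `w_j`. -/
abbrev V (n : ℕ) : Type := Fin n ⊕ Fin n → ℝ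

/-- The symplectic form `∑ v_j^* ∧ w_j^*`. -/
def Ω {n : ℕ} (u v : V n) : ℝ :=
  ∑ j, (u (.inl j) * v (.inr j) - u (.inr j) * v (.inl j))

/-- The symplectic group of `V_n`, as `2n × 2n` matrices. -/
abbrev Sp (n : ℕ) : Type := Matrix.symplecticGroup (Fin n) ℝ

/-! ### The Siegel upper half space -/

/-- Symmetric complex `n × n` matrices with positive definite imaginary part. -/
def Siegel (n : ℕ) : Type :=
  {Z : Matrix (Fin n) (Fin n) ℂ // Zᵀ = Z ∧ ((1 / (2 * Complex.I)) • (Z - Zᴴ)).PosDef}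

instance (n : ℕ) : TopologicalSpace (Siegel n) := instTopologicalSpaceSubtype

/-- The upper left block of `g`, as a complex matrix. -/
def blkA {n : ℕ} (g : Sp n) : Matrix (Fin n) (Fin n) ℂ := g.1.toBlocks₁₁.map (fun x => (x : ℂ))
/-- The upper right block of `g`, as a complex matrix. -/
def blkB {n : ℕ} (g : Sp n) : Matrix (Fin n) (Fin n) ℂ := g.1.toBlocks₁₂.map (fun x => (x : ℂ))
/-- The lower left block of `g`, as a complex matrix. -/
def blkC {n : ℕ} (g : Sp n) : Matrix (Fin n) (Fin n) ℂ := g.1.toBlocks₂₁.map (fun x => (x : ℂ))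
/-- The lower right block of `g`, as a complex matrix. -/
def blkD {n : ℕ} (g : Sp n) : Matrix (Fin n) (Fin n) ℂ := g.1.toBlocks₂₂.map (fun x => (x : ℂ))

/-- `A Z + B` for `g = (A B; C D)`. -/
def num {n : ℕ} (g : Sp n) (Z : Matrix (Fin n) (Fin n) ℂ) : Matrix (Fin n) (Fin n) ℂ :=
  blkA g * Z + blkB g

/-- `C Z + D` for `g = (A B; C D)`. -/
def den {n : ℕ} (g : Sp n) (Z : Matrix (Fin n) (Fin n) ℂ) : Matrix (Fin n) (Fin n) ℂ :=
  blkC g * Z + blkD g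

theorem map_ofReal_conjTranspose {n : ℕ} (M : Matrix (Fin n) (Fin n) ℝ) :
    (M.map (fun x => (x : ℂ)))ᴴ = (M.map (fun x => (x : ℂ)))ᵀ := by
  ext i j; simp [Matrix.conjTranspose_apply]

theorem blk_rel {n : ℕ} (g : Sp n) :
    (blkA g)ᵀ * blkC g = (blkC g)ᵀ * blkA g ∧ (blkB g)ᵀ * blkD g = (blkD g)ᵀ * blkB g ∧
      (blkA g)ᵀ * blkD g - (blkC g)ᵀ * blkB g = 1 ∧
      (blkD g)ᵀ * blkA g - (blkB g)ᵀ * blkC g = 1 := by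
  have h := g.2
  rw [← Matrix.fromBlocks_toBlocks g.1, SymplecticGroup.fromBlocks_mem_iff] at h
  obtain ⟨h1, h2, h3⟩ := h
  have e := fun (X Y : Matrix (Fin n) (Fin n) ℝ) =>
    Matrix.map_mul (f := Complex.ofRealHom) (L := X) (M := Y)
  have k1 := congrArg (fun M => M.map Complex.ofRealHom) h1
  have k2 := congrArg (fun M => M.map Complex.ofRealHom) h2
  have k3 := congrArg (fun M => M.map Complex.ofRealHom) h3
  have k4 := congrArg (fun M => Mᵀ.map Complex.ofRealHom) h3
  simp only [Matrix.map_mul, Matrix.map_sub _ (map_sub Complex.ofRealHom), Matrix.transpose_sub,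
    Matrix.transpose_mul, Matrix.transpose_transpose, Matrix.transpose_one,
    Matrix.map_one _ (map_zero Complex.ofRealHom) (map_one Complex.ofRealHom)] at k1 k2 k3 k4
  exact ⟨k1, k2, k3, k4⟩

theorem num_den_herm {n : ℕ} (g : Sp n) (Z : Matrix (Fin n) (Fin n) ℂ) :
    (num g Z)ᴴ * den g Z - (den g Z)ᴴ * num g Z = Zᴴ - Z := by
  obtain ⟨h1, h2, h3, h4⟩ := blk_rel g
  have e1 : (blkA g)ᴴ = (blkA g)ᵀ := map_ofReal_conjTranspose _
  have e2 : (blkB g)ᴴ = (blkB g)ᵀ := map_ofReal_conjTranspose _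
  have e3 : (blkC g)ᴴ = (blkC g)ᵀ := map_ofReal_conjTranspose _
  have e4 : (blkD g)ᴴ = (blkD g)ᵀ := map_ofReal_conjTranspose _
  simp only [num, den, Matrix.conjTranspose_add, Matrix.conjTranspose_mul, e1, e2, e3, e4]
  have : (Zᴴ * (blkA g)ᵀ + (blkB g)ᵀ) * (blkC g * Z + blkD g) -
      (Zᴴ * (blkC g)ᵀ + (blkD g)ᵀ) * (blkA g * Z + blkB g) =
      Zᴴ * ((blkA g)ᵀ * blkC g - (blkC g)ᵀ * blkA g) * Z +
      Zᴴ * ((blkA g)ᵀ * blkD g - (blkC g)ᵀ * blkB g) -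
      ((blkD g)ᵀ * blkA g - (blkB g)ᵀ * blkC g) * Z +
      ((blkB g)ᵀ * blkD g - (blkD g)ᵀ * blkB g) := by noncomm_ring
  rw [this, h1, h2, h3, h4]; simp

theorem num_den_symm {n : ℕ} (g : Sp n) (Z : Matrix (Fin n) (Fin n) ℂ) :
    (num g Z)ᵀ * den g Z - (den g Z)ᵀ * num g Z = Zᵀ - Z := by
  obtain ⟨h1, h2, h3, h4⟩ := blk_rel g
  simp only [num, den, Matrix.transpose_add, Matrix.transpose_mul]
  have : (Zᵀ * (blkA g)ᵀ + (blkB g)ᵀ) * (blkC g * Z + blkD g) -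
      (Zᵀ * (blkC g)ᵀ + (blkD g)ᵀ) * (blkA g * Z + blkB g) =
      Zᵀ * ((blkA g)ᵀ * blkC g - (blkC g)ᵀ * blkA g) * Z +
      Zᵀ * ((blkA g)ᵀ * blkD g - (blkC g)ᵀ * blkB g) -
      ((blkD g)ᵀ * blkA g - (blkB g)ᵀ * blkC g) * Z +
      ((blkB g)ᵀ * blkD g - (blkD g)ᵀ * blkB g) := by noncomm_ring
  rw [this, h1, h2, h3, h4]; simp

theorem isUnit_den {n : ℕ} (g : Sp n) (Z : Siegel n) : IsUnit (den g Z.1) := by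
  rw [Matrix.isUnit_iff_isUnit_det, isUnit_iff_ne_zero]
  intro h0
  obtain ⟨v, hv, hz⟩ := Matrix.exists_mulVec_eq_zero_iff.2 h0
  have hp := Z.2.2.dotProduct_mulVec_pos hv
  have hq : star v ⬝ᵥ ((Z.1ᴴ - Z.1) *ᵥ v) = 0 := by
    have e : star v ᵥ* (den g Z.1)ᴴ = 0 := by rw [← Matrix.star_mulVec, hz, star_zero]
    rw [← num_den_herm g Z.1, Matrix.sub_mulVec, dotProduct_sub, ← Matrix.mulVec_mulVec,
      ← Matrix.mulVec_mulVec, hz, Matrix.mulVec_zero, dotProduct_zero, Matrix.dotProduct_mulVec,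
      e, zero_dotProduct, sub_zero]
  rw [← neg_sub, Matrix.neg_mulVec, dotProduct_neg, neg_eq_zero] at hq
  rw [Matrix.smul_mulVec, dotProduct_smul, hq, smul_zero] at hp
  exact lt_irrefl _ hp

theorem isUnit_det_den {n : ℕ} (g : Sp n) (Z : Siegel n) : IsUnit (den g Z.1).det :=
  (Matrix.isUnit_iff_isUnit_det _).1 (isUnit_den g Z)

/-- The fractional linear action `Z ↦ (A Z + B)(C Z + D)⁻¹`. -/
def act {n : ℕ} (g : Sp n) (Z : Siegel n) : Siegel n :=
  ⟨num g Z.1 * (den g Z.1)⁻¹, by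
    have hd := isUnit_det_den g Z
    have hs := num_den_symm g Z.1
    rw [Z.2.1, sub_self, sub_eq_zero] at hs
    constructor
    · rw [Matrix.transpose_mul, Matrix.transpose_nonsing_inv]
      have hdt : IsUnit (den g Z.1)ᵀ.det := by rwa [Matrix.det_transpose]
      calc ((den g Z.1)ᵀ)⁻¹ * (num g Z.1)ᵀ
          = ((den g Z.1)ᵀ)⁻¹ * ((num g Z.1)ᵀ * den g Z.1) * (den g Z.1)⁻¹ := by
            rw [Matrix.mul_assoc, Matrix.mul_assoc, Matrix.mul_nonsing_inv _ hd, Matrix.mul_one]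
        _ = num g Z.1 * (den g Z.1)⁻¹ := by
            rw [hs, ← Matrix.mul_assoc, Matrix.nonsing_inv_mul _ hdt, Matrix.one_mul]
    · have hdt : IsUnit (den g Z.1)ᴴ.det := by
        rw [Matrix.det_conjTranspose]; exact hd.star
      have e : (1 / (2 * Complex.I)) • (num g Z.1 * (den g Z.1)⁻¹ -
          (num g Z.1 * (den g Z.1)⁻¹)ᴴ) =
          ((den g Z.1)⁻¹)ᴴ * ((1 / (2 * Complex.I)) • (Z.1 - Z.1ᴴ)) * (den g Z.1)⁻¹ := by
        rw [Matrix.mul_smul, Matrix.smul_mul, ← neg_sub Z.1ᴴ, ← num_den_herm g Z.1, neg_sub,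
          Matrix.mul_sub, Matrix.sub_mul, Matrix.conjTranspose_mul, Matrix.conjTranspose_nonsing_inv,
          ← Matrix.mul_assoc, Matrix.nonsing_inv_mul _ hdt, Matrix.one_mul, ← Matrix.mul_assoc,
          Matrix.mul_assoc _ (den g Z.1), Matrix.mul_nonsing_inv _ hd, Matrix.mul_one]
      rw [e]
      refine Z.2.2.conjTranspose_mul_mul_same ?_
      exact Matrix.mulVec_injective_of_isUnit
        ((Matrix.isUnit_nonsing_inv_iff).2 (isUnit_den g Z))⟩

theorem act_mul_den {n : ℕ} (g : Sp n) (Z : Siegel n) :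
    (act g Z).1 * den g Z.1 = num g Z.1 := by
  rw [act, Matrix.mul_assoc, Matrix.nonsing_inv_mul _ (isUnit_det_den g Z), Matrix.mul_one]

theorem blk_mul {n : ℕ} (g h : Sp n) :
    blkA (g * h) = blkA g * blkA h + blkB g * blkC h ∧
    blkB (g * h) = blkA g * blkB h + blkB g * blkD h ∧
    blkC (g * h) = blkC g * blkA h + blkD g * blkC h ∧
    blkD (g * h) = blkC g * blkB h + blkD g * blkD h := by
  refine ⟨?_, ?_, ?_, ?_⟩ <;> ext i j <;>
    simp [blkA, blkB, blkC, blkD, Matrix.mul_apply, Matrix.toBlocks₁₁, Matrix.toBlocks₁₂,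
      Matrix.toBlocks₂₁, Matrix.toBlocks₂₂]

theorem num_mul {n : ℕ} (g h : Sp n) (Z : Siegel n) :
    num (g * h) Z.1 = num g (act h Z).1 * den h Z.1 := by
  obtain ⟨h1, h2, h3, h4⟩ := blk_mul g h
  rw [num, num, Matrix.add_mul, Matrix.mul_assoc, act_mul_den, h1, h2, num, den]
  noncomm_ring

theorem den_mul {n : ℕ} (g h : Sp n) (Z : Siegel n) :
    den (g * h) Z.1 = den g (act h Z).1 * den h Z.1 := by
  obtain ⟨h1, h2, h3, h4⟩ := blk_mul g h
  rw [den, den, Matrix.add_mul, Matrix.mul_assoc, act_mul_den, h3, h4, num, den]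
  noncomm_ring

theorem act_mul {n : ℕ} (g h : Sp n) (Z : Siegel n) : act (g * h) Z = act g (act h Z) := by
  apply Subtype.ext
  change num (g * h) Z.1 * (den (g * h) Z.1)⁻¹ = num g (act h Z).1 * (den g (act h Z).1)⁻¹
  rw [num_mul, den_mul, Matrix.mul_inv_rev, Matrix.mul_assoc, ← Matrix.mul_assoc (den h Z.1),
    Matrix.mul_nonsing_inv _ (isUnit_det_den h Z), Matrix.one_mul]

theorem num_one {n : ℕ} (Z : Matrix (Fin n) (Fin n) ℂ) : num (1 : Sp n) Z = Z := by
  have h1 : blkA (1 : Sp n) = 1 := by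
    ext i j; by_cases h : i = j <;> simp [blkA, Matrix.toBlocks₁₁, Matrix.one_apply, h]
  have h2 : blkB (1 : Sp n) = 0 := by
    ext i j; simp [blkB, Matrix.toBlocks₁₂]
  rw [num, h1, h2]; simp

theorem den_one {n : ℕ} (Z : Matrix (Fin n) (Fin n) ℂ) : den (1 : Sp n) Z = 1 := by
  have h1 : blkD (1 : Sp n) = 1 := by
    ext i j; by_cases h : i = j <;> simp [blkD, Matrix.toBlocks₂₂, Matrix.one_apply, h]
  have h2 : blkC (1 : Sp n) = 0 := by
    ext i j; simp [blkC, Matrix.toBlocks₂₁]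
  rw [den, h1, h2]; simp

theorem act_one {n : ℕ} (Z : Siegel n) : act 1 Z = Z := by
  apply Subtype.ext
  change num 1 Z.1 * (den 1 Z.1)⁻¹ = Z.1
  rw [num_one, den_one, inv_one, Matrix.mul_one]

theorem continuous_den {n : ℕ} (g : Sp n) : Continuous fun Z : Siegel n => den g Z.1 :=
  (continuous_const.matrix_mul continuous_subtype_val).add continuous_const

theorem continuous_num {n : ℕ} (g : Sp n) : Continuous fun Z : Siegel n => num g Z.1 :=
  (continuous_const.matrix_mul continuous_subtype_val).add continuous_const

theorem continuous_act {n : ℕ} (g : Sp n) : Continuous (act g : Siegel n → Siegel n) := by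
  refine Continuous.subtype_mk ((continuous_num g).matrix_mul ?_) _
  have : (fun Z : Siegel n => (den g Z.1)⁻¹) =
      fun Z : Siegel n => ((den g Z.1).det)⁻¹ • (den g Z.1).adjugate := by
    funext Z; rw [Matrix.inv_def, Ring.inverse_eq_inv']
  rw [this]
  exact ((continuous_den g).matrix_det.inv₀ fun Z => (isUnit_det_den g Z).ne_zero).smul
    (continuous_den g).matrix_adjugate

/-- The base point `i · 1`. -/
def basePt (n : ℕ) : Siegel n :=
  ⟨Complex.I • (1 : Matrix (Fin n) (Fin n) ℂ), by simp, by
    have : (1 / (2 * Complex.I)) • (Complex.I • (1 : Matrix (Fin n) (Fin n) ℂ) -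
        (Complex.I • (1 : Matrix (Fin n) (Fin n) ℂ))ᴴ) = 1 := by
      have hI := Complex.I_ne_zero
      rw [Matrix.conjTranspose_smul, Matrix.conjTranspose_one, ← sub_smul, smul_smul]
      have : (1 / (2 * Complex.I)) * (Complex.I - star Complex.I) = 1 := by
        simp; field_simp; norm_num
      rw [this, one_smul]
    rw [this]; exact Matrix.PosDef.one⟩

/-! ### The metaplectic-c group -/

/-- The metaplectic-c group `Mp^c(V_n) = Mp(V_n) ×_{±1} U(1)`.  An element is a symplectic
matrix `g = (A B; C D)` with a continuous function `f` on the Siegel upper half space such that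
`f(Z)² = η · det (C Z + D)` for some `η ∈ U(1)`.  The elements with `η = 1` (a choice of square
root of the automorphy factor) form the metaplectic group `Mp(V_n)`, the connected double cover
of `Sp(V_n)`; `λ ∈ U(1)` is the element `g = 1`, `f = λ`, `η = λ²`. -/
@[ext] structure Mpc (n : ℕ) where
  /-- the projection map to the symplectic group -/
  σ : Sp n
  /-- the square root of the automorphy factor -/
  f : Siegel n → ℂ
  /-- the determinant map to `U(1)` -/
  η : Circle
  continuous_f : Continuous f
  sq_f : ∀ Z, f Z ^ 2 = η * (den σ Z.1).det

namespace Mpc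

theorem f_ne_zero {n : ℕ} (a : Mpc n) (Z : Siegel n) : a.f Z ≠ 0 := by
  intro h
  have := a.sq_f Z
  rw [h, zero_pow two_ne_zero, eq_comm, mul_eq_zero] at this
  exact this.elim (Circle.coe_ne_zero _) (isUnit_det_den _ _).ne_zero

/-- Composition: `(g₁, f₁)(g₂, f₂) = (g₁ g₂, Z ↦ f₁(g₂ Z) f₂(Z))`. -/
instance {n : ℕ} : Mul (Mpc n) where
  mul a b :=
    { σ := a.σ * b.σ
      f := fun Z => a.f (act b.σ Z) * b.f Z
      η := a.η * b.η
      continuous_f := (a.continuous_f.comp (continuous_act _)).mul b.continuous_f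
      sq_f := fun Z => by
        rw [mul_pow, a.sq_f, b.sq_f, den_mul, Matrix.det_mul, Circle.coe_mul]; ring }

instance {n : ℕ} : One (Mpc n) where
  one :=
    { σ := 1
      f := fun _ => 1
      η := 1
      continuous_f := continuous_const
      sq_f := fun Z => by rw [den_one]; simp }

instance {n : ℕ} : Inv (Mpc n) where
  inv a :=
    { σ := a.σ⁻¹
      f := fun Z => (a.f (act a.σ⁻¹ Z))⁻¹
      η := a.η⁻¹
      continuous_f := (a.continuous_f.comp (continuous_act _)).inv₀ fun _ => a.f_ne_zero _
      sq_f := fun Z => by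
        have h : (den a.σ (act a.σ⁻¹ Z).1).det * (den a.σ⁻¹ Z.1).det = 1 := by
          rw [← Matrix.det_mul, ← den_mul, mul_inv_cancel, den_one, Matrix.det_one]
        rw [inv_pow, a.sq_f, Circle.coe_inv, mul_inv, eq_inv_of_mul_eq_one_left h, inv_inv] }

theorem σ_mul {n : ℕ} (a b : Mpc n) : (a * b).σ = a.σ * b.σ := rfl
theorem f_mul {n : ℕ} (a b : Mpc n) (Z : Siegel n) :
    (a * b).f Z = a.f (act b.σ Z) * b.f Z := rfl
theorem η_mul {n : ℕ} (a b : Mpc n) : (a * b).η = a.η * b.η := rfl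
theorem σ_one {n : ℕ} : (1 : Mpc n).σ = 1 := rfl
theorem f_one {n : ℕ} (Z : Siegel n) : (1 : Mpc n).f Z = 1 := rfl
theorem η_one {n : ℕ} : (1 : Mpc n).η = 1 := rfl
theorem σ_inv {n : ℕ} (a : Mpc n) : (a⁻¹).σ = a.σ⁻¹ := rfl
theorem f_inv {n : ℕ} (a : Mpc n) (Z : Siegel n) : (a⁻¹).f Z = (a.f (act a.σ⁻¹ Z))⁻¹ := rfl
theorem η_inv {n : ℕ} (a : Mpc n) : (a⁻¹).η = a.η⁻¹ := rfl

instance {n : ℕ} : Group (Mpc n) :=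
  Group.ofLeftAxioms
    (fun a b c => by
      ext1
      · simp only [σ_mul, mul_assoc]
      · funext Z; simp only [f_mul, σ_mul, act_mul, mul_assoc]
      · simp only [η_mul, mul_assoc])
    (fun a => by
      ext1
      · simp only [σ_mul, σ_one, one_mul]
      · funext Z; simp only [f_mul, f_one, one_mul]
      · simp only [η_mul, η_one, one_mul])
    (fun a => by
      ext1
      · simp only [σ_mul, σ_inv, σ_one, inv_mul_cancel]
      · funext Z
        simp only [f_mul, f_inv, f_one]
        rw [← act_mul, inv_mul_cancel, act_one, inv_mul_cancel₀ (a.f_ne_zero _)]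
      · simp only [η_mul, η_inv, η_one, inv_mul_cancel])

end Mpc


/-! ### The hyperplane `W` and the homomorphisms `ν`, `ν̂` -/

/-- The symplectic orthogonal of a subspace. -/
def perp {n : ℕ} (U : Submodule ℝ (V n)) : Submodule ℝ (V n) where
  carrier := {z | ∀ u ∈ U, Ω z u = 0}
  zero_mem' u _ := by simp [Ω]
  add_mem' {a b} ha hb u hu := by
    have : Ω (a + b) u = Ω a u + Ω b u := by
      simp only [Ω, Pi.add_apply, ← Finset.sum_add_distrib]
      exact Finset.sum_congr rfl fun _ _ => by ring
    rw [this, ha u hu, hb u hu, add_zero]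
  smul_mem' c a ha u hu := by
    have : Ω (c • a) u = c * Ω a u := by
      simp only [Ω, Pi.smul_apply, smul_eq_mul, Finset.mul_sum]
      exact Finset.sum_congr rfl fun _ _ => by ring
    rw [this, ha u hu, mul_zero]

/-- The hyperplane `W = span {v_1, …, v_{n+1}, w_1, …, w_n}` of `V_{n+1}`. -/
def W (n : ℕ) : Submodule ℝ (V (n + 1)) where
  carrier := {u | u (.inr (Fin.last n)) = 0}
  zero_mem' := rfl
  add_mem' {a b} ha hb := by
    simp only [Set.mem_ofPred_eq, Pi.add_apply] at *; rw [ha, hb, add_zero]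
  smul_mem' c a ha := by
    simp only [Set.mem_ofPred_eq, Pi.smul_apply, smul_eq_mul] at *; rw [ha, mul_zero]

/-- The inclusion `V_n → W ⊆ V_{n+1}`, `v_j ↦ v_j`, `w_j ↦ w_j`; it induces the
identification `V_n ≅ W / W^⊥`. -/
def incl {n : ℕ} : V n →ₗ[ℝ] V (n + 1) where
  toFun x := Sum.elim (Fin.snoc (fun j => x (.inl j)) 0) (Fin.snoc (fun j => x (.inr j)) 0)
  map_add' x y := by
    ext (i | i) <;> refine Fin.lastCases ?_ (fun j => ?_) i <;> simp
  map_smul' c x := by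
    ext (i | i) <;> refine Fin.lastCases ?_ (fun j => ?_) i <;> simp

/-- The subgroup `Sp(V; W)` of symplectic maps that preserve `W`. -/
def SpW (n : ℕ) : Subgroup (Sp (n + 1)) where
  carrier := {g | (W n).map g.1.mulVecLin = W n}
  mul_mem' {g h} hg hh := by
    simp only [Set.mem_ofPred_eq] at *
    rw [Submonoid.coe_mul, Matrix.mulVecLin_mul, Submodule.map_comp, hh, hg]
  one_mem' := by
    simp only [Set.mem_ofPred_eq, Submonoid.coe_one, Matrix.mulVecLin_one, Submodule.map_id]
  inv_mem' {g} hg := by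
    simp only [Set.mem_ofPred_eq] at *
    conv_lhs => rw [← hg]
    rw [← Submodule.map_comp, ← Matrix.mulVecLin_mul, ← Submonoid.coe_mul, inv_mul_cancel,
      Submonoid.coe_one, Matrix.mulVecLin_one, Submodule.map_id]

/-- The projection `Mp^c(V_n) → Sp(V_n)` as a homomorphism. -/
def Mpc.σHom (n : ℕ) : Mpc n →* Sp n where
  toFun := Mpc.σ
  map_one' := rfl
  map_mul' _ _ := rfl

/-- The subgroup `Mp^c(V; W) = σ⁻¹(Sp(V; W))`. -/
def MpcW (n : ℕ) : Subgroup (Mpc (n + 1)) := (SpW n).comap (Mpc.σHom (n + 1))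

theorem Ω_eq {n : ℕ} (u v : V n) : Ω u v = - (u ⬝ᵥ (Matrix.J (Fin n) ℝ *ᵥ v)) := by
  simp [Ω, Matrix.J, dotProduct, Fintype.sum_sum_type, Matrix.mulVec, Matrix.fromBlocks_apply₁₁,
    Matrix.one_apply, Finset.sum_add_distrib, sub_eq_add_neg, add_comm]

theorem Ω_mulVec_eq {n : ℕ} (A : Matrix (Fin n ⊕ Fin n) (Fin n ⊕ Fin n) ℝ) (u v : V n) :
    Ω (A *ᵥ u) (A *ᵥ v) = - (u ⬝ᵥ ((Aᵀ * Matrix.J (Fin n) ℝ * A) *ᵥ v)) := by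
  rw [Ω_eq, Matrix.mul_assoc, ← Matrix.mulVec_mulVec, ← Matrix.mulVec_mulVec,
    Matrix.dotProduct_mulVec u, Matrix.vecMul_transpose]

theorem Ω_mulVec {n : ℕ} (g : Sp n) (u v : V n) : Ω (g.1 *ᵥ u) (g.1 *ᵥ v) = Ω u v := by
  rw [Ω_mulVec_eq, SymplecticGroup.mem_iff'.1 g.2, Ω_eq]

theorem Ω_inl {n : ℕ} (u : V n) (j : Fin n) : Ω u (Pi.single (.inl j) 1) = - u (.inr j) := by
  simp [Ω, Pi.single_apply]

theorem Ω_inr {n : ℕ} (u : V n) (j : Fin n) : Ω u (Pi.single (.inr j) 1) = u (.inl j) := by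
  simp [Ω, Pi.single_apply]

theorem mem_Sp_of_Ω {n : ℕ} (A : Matrix (Fin n ⊕ Fin n) (Fin n ⊕ Fin n) ℝ)
    (h : ∀ u v, Ω (A *ᵥ u) (A *ᵥ v) = Ω u v) : A ∈ Matrix.symplecticGroup (Fin n) ℝ := by
  rw [SymplecticGroup.mem_iff']
  ext i j
  have := h (Pi.single i 1) (Pi.single j 1)
  rw [Ω_mulVec_eq, Ω_eq, neg_inj] at this
  simpa using this

theorem SpW_row {n : ℕ} {g : Sp (n + 1)} (hg : g ∈ SpW n) {j : Fin (n + 1) ⊕ Fin (n + 1)}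
    (hj : j ≠ .inr (Fin.last n)) : g.1 (.inr (Fin.last n)) j = 0 := by
  have h : g.1 *ᵥ (Pi.single j 1) ∈ W n := by
    have hg' : (W n).map g.1.mulVecLin = W n := hg
    rw [← hg']
    exact ⟨Pi.single j 1, by simp [W, hj.symm], rfl⟩
  simpa [W] using h

theorem SpW_col {n : ℕ} {g : Sp (n + 1)} (hg : g ∈ SpW n) {i : Fin (n + 1) ⊕ Fin (n + 1)}
    (hi : i ≠ .inl (Fin.last n)) : g.1 i (.inl (Fin.last n)) = 0 := by
  have hg' : (W n).map g.1.mulVecLin = W n := hg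
  have key : ∀ w ∈ W n, Ω (g.1 *ᵥ Pi.single (.inl (Fin.last n)) 1) w = 0 := by
    intro w hw
    rw [← hg'] at hw
    obtain ⟨w', hw', rfl⟩ := hw
    rw [Matrix.mulVecLin_apply, Ω_mulVec]
    have : w' (.inr (Fin.last n)) = 0 := hw'
    simp [Ω, Pi.single_apply, this]
  rcases i with i | i
  · have := key (Pi.single (.inr i) 1) (by
      have : Fin.last n ≠ i := fun h => hi (by rw [h])
      simp [W, this])
    rw [Ω_inr] at this
    simpa using this
  · have := key (Pi.single (.inl i) 1) (by simp [W])
    rw [Ω_inl] at this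
    simpa using this

theorem SpW_mul_diag {n : ℕ} {g : Sp (n + 1)} (hg : g ∈ SpW n) :
    g.1 (.inl (Fin.last n)) (.inl (Fin.last n)) * g.1 (.inr (Fin.last n)) (.inr (Fin.last n)) = 1 := by
  have h := Ω_mulVec g (Pi.single (.inl (Fin.last n)) 1) (Pi.single (.inr (Fin.last n)) 1)
  rw [Ω_inr, Pi.single_eq_same] at h
  rw [← h, Ω, Finset.sum_eq_single (Fin.last n)]
  · have := SpW_col hg (i := .inr (Fin.last n)) (by simp)
    simp [this]
  · intro j _ hj
    have h1 := SpW_col hg (i := .inl j) (by simpa using hj)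
    have h2 := SpW_col hg (i := .inr j) (by simp)
    simp [h1, h2]
  · simp

/-- Restriction of coordinates `V_{n+1} → V_n`. -/
def res {n : ℕ} (u : V (n + 1)) : V n := fun i => u (Sum.map Fin.castSucc Fin.castSucc i)

theorem res_incl {n : ℕ} (x : V n) : res (incl x) = x := by
  ext (i | i) <;> simp [res, incl]

theorem Ω_res {n : ℕ} (u v : V (n + 1)) : Ω u v = Ω (res u) (res v) +
    (u (.inl (Fin.last n)) * v (.inr (Fin.last n)) -
      u (.inr (Fin.last n)) * v (.inl (Fin.last n))) := by
  simp [Ω, Fin.sum_univ_castSucc, res]; ring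

theorem incl_mem {n : ℕ} (x : V n) : incl x ∈ W n := by
  change incl x (.inr (Fin.last n)) = 0
  simp [incl]

theorem Ω_incl {n : ℕ} (x y : V n) : Ω (incl x) (incl y) = Ω x y := by
  rw [Ω_res, res_incl, res_incl]; simp [incl]

/-- An element of `W` differs from an element of `V_n` by a multiple of `v_{n+1}`. -/
theorem mem_W_eq {n : ℕ} {w : V (n + 1)} (hw : w ∈ W n) :
    w = incl (res w) + w (.inl (Fin.last n)) • Pi.single (.inl (Fin.last n)) 1 := by
  have hw' : w (.inr (Fin.last n)) = 0 := hw
  ext (i | i)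
  · refine Fin.lastCases ?_ (fun j => ?_) i
    · simp [incl]
    · simp [incl, res, (Fin.castSucc_lt_last j).ne]
  · refine Fin.lastCases ?_ (fun j => ?_) i
    · simp [incl, hw']
    · simp [incl, res]

/-- The matrix of `ν g`. -/
def nuMat {n : ℕ} (g : Sp (n + 1)) : Matrix (Fin n ⊕ Fin n) (Fin n ⊕ Fin n) ℝ :=
  g.1.submatrix (Sum.map Fin.castSucc Fin.castSucc) (Sum.map Fin.castSucc Fin.castSucc)

theorem nuMat_mulVec {n : ℕ} (g : Sp (n + 1)) (x : V n) :
    nuMat g *ᵥ x = res (g.1 *ᵥ incl x) := by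
  ext i
  simp [nuMat, res, Matrix.mulVec, dotProduct, Fintype.sum_sum_type, Fin.sum_univ_castSucc, incl]

theorem SpW_mulVec_mem {n : ℕ} {g : Sp (n + 1)} (hg : g ∈ SpW n) {w : V (n + 1)} (hw : w ∈ W n) :
    g.1 *ᵥ w ∈ W n := by
  have hg' : (W n).map g.1.mulVecLin = W n := hg
  rw [← hg']
  exact ⟨w, hw, rfl⟩

/-- The homomorphism `ν : Sp(V; W) → Sp(W / W^⊥) = Sp(V_n)`, in matrix form: delete the rows and
columns of `v_{n+1}` and `w_{n+1}`. -/
def ν {n : ℕ} (g : SpW n) : Sp n :=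
  ⟨nuMat g.1, mem_Sp_of_Ω _ fun u v => by
    have h := Ω_mulVec g.1 (incl u) (incl v)
    have h1 : (g.1.1 *ᵥ incl u) (.inr (Fin.last n)) = 0 := SpW_mulVec_mem g.2 (incl_mem u)
    have h2 : (g.1.1 *ᵥ incl v) (.inr (Fin.last n)) = 0 := SpW_mulVec_mem g.2 (incl_mem v)
    rw [Ω_res, h1, h2, Ω_incl] at h
    rw [nuMat_mulVec, nuMat_mulVec, ← h]; ring⟩

theorem ν_mulVec {n : ℕ} (g : SpW n) (x : V n) : (ν g).1 *ᵥ x = res (g.1.1 *ᵥ incl x) :=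
  nuMat_mulVec _ _

/-- `ν g` is the map induced by `g` on `W / W^⊥`: on `W`, `g ∘ incl = incl ∘ ν g` up to `W^⊥`. -/
theorem mulVec_incl {n : ℕ} (g : SpW n) (x : V n) : ∃ c : ℝ,
    g.1.1 *ᵥ incl x = incl ((ν g).1 *ᵥ x) + c • Pi.single (.inl (Fin.last n)) 1 :=
  ⟨_, by rw [ν_mulVec]; exact mem_W_eq (SpW_mulVec_mem g.2 (incl_mem x))⟩

theorem res_mulVec_single {n : ℕ} {g : Sp (n + 1)} (hg : g ∈ SpW n) :
    g.1 *ᵥ (Pi.single (.inl (Fin.last n)) 1) =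
      g.1 (.inl (Fin.last n)) (.inl (Fin.last n)) • Pi.single (.inl (Fin.last n)) 1 := by
  ext i
  by_cases hi : i = .inl (Fin.last n)
  · subst hi; simp
  · simp [SpW_col hg hi, hi]

theorem ν_mul {n : ℕ} (g h : SpW n) : ν (g * h) = ν g * ν h := by
  apply Subtype.ext
  apply Matrix.ext_of_mulVec_single
  intro i
  rw [Submonoid.coe_mul, ← Matrix.mulVec_mulVec, ν_mulVec, ν_mulVec g]
  obtain ⟨c, hc⟩ := mulVec_incl h (Pi.single i 1)
  have : ((g * h : SpW n) : Sp (n + 1)).1 = g.1.1 * h.1.1 := rfl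
  rw [this, ← Matrix.mulVec_mulVec, hc, Matrix.mulVec_add, Matrix.mulVec_smul,
    res_mulVec_single g.2]
  ext (j | j) <;> simp [res, (Fin.castSucc_lt_last j).ne]

theorem ν_one {n : ℕ} : ν (1 : SpW n) = 1 := by
  have : ν (1 : SpW n) * ν 1 = ν 1 := by rw [← ν_mul, one_mul]
  simpa using this

/-- Upper left block of a point of the Siegel upper half space. -/
def trunc {n : ℕ} (Z : Siegel (n + 1)) : Siegel n :=
  ⟨Z.1.submatrix Fin.castSucc Fin.castSucc, by
    rw [Matrix.transpose_submatrix, Z.2.1], by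
    exact Z.2.2.submatrix (Fin.castSucc_injective n)⟩

/-- The block diagonal matrix `diag(Z, i)`. -/
def extMat {n : ℕ} (Z : Matrix (Fin n) (Fin n) ℂ) : Matrix (Fin (n + 1)) (Fin (n + 1)) ℂ :=
  Matrix.of fun i j => Fin.lastCases (Fin.lastCases Complex.I (fun _ => 0) j)
    (fun i' => Fin.lastCases 0 (fun j' => Z i' j') j) i

/-- `Z ↦ diag(Z, i)` as a map of Siegel upper half spaces. -/
def extend {n : ℕ} (Z : Siegel n) : Siegel (n + 1) :=
  ⟨extMat Z.1, by
    ext i j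
    refine Fin.lastCases ?_ (fun i' => ?_) i <;> refine Fin.lastCases ?_ (fun j' => ?_) j <;>
      simp [extMat]
    exact congrFun (congrFun Z.2.1 i') j', by
    have hZ := Z.2.2
    refine Matrix.PosDef.of_dotProduct_mulVec_pos ?_ fun x hx => ?_
    · have h := hZ.1
      ext i j
      refine Fin.lastCases ?_ (fun i' => ?_) i <;> refine Fin.lastCases ?_ (fun j' => ?_) j
      · simp [extMat]; ring
      · simp [extMat]
      · simp [extMat]
      · have := congrFun (congrFun h i') j'
        simpa [extMat] using this
    · have e : star x ⬝ᵥ (((1 / (2 * Complex.I)) • (extMat Z.1 - (extMat Z.1)ᴴ)) *ᵥ x) =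
          star (fun i : Fin n => x i.castSucc) ⬝ᵥ
            (((1 / (2 * Complex.I)) • (Z.1 - Z.1ᴴ)) *ᵥ (fun i : Fin n => x i.castSucc)) +
          star (x (Fin.last n)) * x (Fin.last n) := by
        have h2 : (1 / (2 * Complex.I)) * (Complex.I + Complex.I) = 1 := by
          have := Complex.I_ne_zero
          field_simp; norm_num
        have h3 : Complex.I * 2⁻¹ * (Complex.I + Complex.I) = -1 := by
          linear_combination Complex.I_mul_I
        simp [dotProduct, Matrix.mulVec, Fin.sum_univ_castSucc, extMat, h3]
      rw [e]
      by_cases hx' : (fun i : Fin n => x i.castSucc) = 0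
      · have hl : x (Fin.last n) ≠ 0 := fun hl => hx (by
          ext i
          refine Fin.lastCases hl (fun j => congrFun hx' j) i)
        rw [hx', Matrix.mulVec_zero, dotProduct_zero, zero_add]
        exact star_mul_self_pos (IsRegular.of_ne_zero hl)
      · exact add_pos_of_pos_of_nonneg (hZ.dotProduct_mulVec_pos hx') (star_mul_self_nonneg _)⟩

theorem trunc_extend {n : ℕ} (Z : Siegel n) : trunc (extend Z) = Z := by
  apply Subtype.ext
  ext i j
  simp [trunc, extend, extMat]

theorem continuous_extend {n : ℕ} : Continuous (extend : Siegel n → Siegel (n + 1)) := by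
  have hc : Continuous fun Z : Siegel n => Z.1 := continuous_subtype_val
  refine Continuous.subtype_mk (continuous_matrix fun i j => ?_) _
  refine Fin.lastCases ?_ (fun i' => ?_) i <;> refine Fin.lastCases ?_ (fun j' => ?_) j
  · simpa [extMat] using continuous_const
  · simpa [extMat] using continuous_const
  · simpa [extMat] using continuous_const
  · simpa [extMat] using hc.matrix_elem i' j'

theorem den_block {n : ℕ} (g : SpW n) (Y : Siegel (n + 1)) :
    (den g.1 Y.1).submatrix Fin.castSucc Fin.castSucc = den (ν g) (trunc Y).1 := by
  ext i j
  have h : g.1.1 (.inr i.castSucc) (.inl (Fin.last n)) = 0 := SpW_col g.2 (by simp)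
  simp [den, blkC, blkD, Matrix.mul_apply, Fin.sum_univ_castSucc, Matrix.toBlocks₂₁,
    Matrix.toBlocks₂₂, ν, nuMat, trunc, h]

theorem num_block {n : ℕ} (g : SpW n) (Y : Siegel (n + 1)) :
    (num g.1 Y.1).submatrix Fin.castSucc Fin.castSucc = num (ν g) (trunc Y).1 := by
  ext i j
  have h : g.1.1 (.inl i.castSucc) (.inl (Fin.last n)) = 0 :=
    SpW_col g.2 (by simpa using (Fin.castSucc_lt_last i).ne)
  simp [num, blkA, blkB, Matrix.mul_apply, Fin.sum_univ_castSucc, Matrix.toBlocks₁₁,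
    Matrix.toBlocks₁₂, ν, nuMat, trunc, h]

theorem den_last {n : ℕ} (g : SpW n) (Y : Siegel (n + 1)) (j : Fin (n + 1)) :
    den g.1 Y.1 (Fin.last n) j =
      if j = Fin.last n then (g.1.1 (.inr (Fin.last n)) (.inr (Fin.last n)) : ℂ) else 0 := by
  have h : ∀ k, g.1.1 (.inr (Fin.last n)) (.inl k) = 0 := fun k => SpW_row g.2 (by simp)
  split_ifs with hj
  · subst hj
    simp [den, blkC, blkD, Matrix.mul_apply, Matrix.toBlocks₂₁, Matrix.toBlocks₂₂, h]
  · have h2 : g.1.1 (.inr (Fin.last n)) (.inr j) = 0 := SpW_row g.2 (by simpa using hj)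
    simp [den, blkC, blkD, Matrix.mul_apply, Matrix.toBlocks₂₁, Matrix.toBlocks₂₂, h, h2]

theorem det_den_SpW {n : ℕ} (g : SpW n) (Y : Siegel (n + 1)) :
    (g.1.1 (.inl (Fin.last n)) (.inl (Fin.last n)) : ℂ) * (den g.1 Y.1).det =
      (den (ν g) (trunc Y).1).det := by
  have h1 : (g.1.1 (.inl (Fin.last n)) (.inl (Fin.last n)) : ℂ) *
      (g.1.1 (.inr (Fin.last n)) (.inr (Fin.last n)) : ℂ) = 1 := by
    exact_mod_cast SpW_mul_diag g.2
  rw [Matrix.det_succ_row _ (Fin.last n), Finset.sum_eq_single (Fin.last n)]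
  · rw [den_last, if_pos rfl, ← den_block]
    have : (Fin.last n).succAbove = Fin.castSucc := by
      funext i; exact Fin.succAbove_last_apply i
    rw [this]
    have h2 : (-1 : ℂ) ^ ((Fin.last n : ℕ) + (Fin.last n : ℕ)) = 1 := by
      rw [← two_mul, pow_mul]; simp
    rw [h2, one_mul, ← mul_assoc, h1, one_mul]
  · intro j _ hj
    rw [den_last, if_neg hj]; simp
  · simp

theorem trunc_act {n : ℕ} (g : SpW n) (Y : Siegel (n + 1)) :
    trunc (act g.1 Y) = act (ν g) (trunc Y) := by
  have h : (trunc (act g.1 Y)).1 * den (ν g) (trunc Y).1 = num (ν g) (trunc Y).1 := by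
    rw [← den_block, ← num_block, ← act_mul_den]
    ext i j
    have := den_last g Y j.castSucc
    rw [if_neg (Fin.castSucc_lt_last j).ne] at this
    simp [Matrix.mul_apply, Fin.sum_univ_castSucc, trunc, this]
  apply Subtype.ext
  change _ = num (ν g) (trunc Y).1 * (den (ν g) (trunc Y).1)⁻¹
  rw [← h, Matrix.mul_assoc, Matrix.mul_nonsing_inv _ (isUnit_det_den _ _), Matrix.mul_one]

/-- Convex combinations in the Siegel upper half space. -/
def seg {n : ℕ} (Y₀ Y₁ : Siegel n) (t : Set.Icc (0 : ℝ) 1) : Siegel n :=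
  ⟨((1 - t.1 : ℝ) : ℂ) • Y₀.1 + ((t.1 : ℝ) : ℂ) • Y₁.1, by
    rw [Matrix.transpose_add, Matrix.transpose_smul, Matrix.transpose_smul, Y₀.2.1, Y₁.2.1], by
    have e : (1 / (2 * Complex.I)) • (((1 - t.1 : ℝ) : ℂ) • Y₀.1 + ((t.1 : ℝ) : ℂ) • Y₁.1 -
        (((1 - t.1 : ℝ) : ℂ) • Y₀.1 + ((t.1 : ℝ) : ℂ) • Y₁.1)ᴴ) =
        ((1 - t.1 : ℝ) : ℂ) • ((1 / (2 * Complex.I)) • (Y₀.1 - Y₀.1ᴴ)) +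
        ((t.1 : ℝ) : ℂ) • ((1 / (2 * Complex.I)) • (Y₁.1 - Y₁.1ᴴ)) := by
      rw [Matrix.conjTranspose_add, Matrix.conjTranspose_smul, Matrix.conjTranspose_smul]
      have hs : ∀ r : ℝ, star (r : ℂ) = r := fun r => Complex.conj_ofReal r
      rw [hs, hs]
      module
    rw [e]
    rcases eq_or_lt_of_le t.2.2 with h1 | h1
    · rw [h1]; simpa using Y₁.2.2
    · refine Matrix.PosDef.add_posSemidef (Y₀.2.2.smul ?_) (Y₁.2.2.posSemidef.smul ?_)
      · exact_mod_cast sub_pos.2 h1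
      · exact_mod_cast t.2.1⟩

/-- For `a ∈ Mp^c(V; W)` the function `f` only depends on the upper left block. -/
theorem f_eq_of_trunc {n : ℕ} (a : MpcW n) {Y₀ Y₁ : Siegel (n + 1)} (h : trunc Y₀ = trunc Y₁) :
    a.1.f Y₀ = a.1.f Y₁ := by
  have htr : ∀ t, trunc (seg Y₀ Y₁ t) = trunc Y₀ := by
    intro t
    apply Subtype.ext
    ext i j
    have : Y₁.1 i.castSucc j.castSucc = Y₀.1 i.castSucc j.castSucc :=
      (congrFun (congrFun (congrArg Subtype.val h) i) j).symm
    simp [trunc, seg, this]; ring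
  have hχ : (a.1.σ.1 (.inl (Fin.last n)) (.inl (Fin.last n)) : ℂ) ≠ 0 := by
    have := SpW_mul_diag (g := a.1.σ) a.2
    exact_mod_cast left_ne_zero_of_mul_eq_one this
  have hsq : ∀ Y, trunc Y = trunc Y₀ → a.1.f Y ^ 2 = a.1.f Y₀ ^ 2 := by
    intro Y hY
    rw [a.1.sq_f, a.1.sq_f]
    congr 1
    apply mul_left_cancel₀ hχ
    rw [det_den_SpW ⟨a.1.σ, a.2⟩ Y, det_den_SpW ⟨a.1.σ, a.2⟩ Y₀, hY]
  have hseg : Continuous (seg Y₀ Y₁) := by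
    refine Continuous.subtype_mk ?_ _
    fun_prop
  have h0 : seg Y₀ Y₁ ⟨0, by simp⟩ = Y₀ := by apply Subtype.ext; simp [seg]
  have h1 : seg Y₀ Y₁ ⟨1, by simp⟩ = Y₁ := by apply Subtype.ext; simp [seg]
  have := (isPreconnected_univ (α := Set.Icc (0 : ℝ) 1)).eq_of_sq_eq
    (f := fun t => a.1.f (seg Y₀ Y₁ t)) (g := fun _ => a.1.f Y₀)
    (a.1.continuous_f.comp hseg).continuousOn continuousOn_const
    (fun t _ => hsq _ (htr t)) (fun {_} _ => a.1.f_ne_zero _)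
    (y := ⟨0, by simp⟩) (Set.mem_univ _) (by simp only [h0]) 
    (Set.mem_univ (⟨1, by simp⟩ : Set.Icc (0 : ℝ) 1))
  simp only [h1] at this
  exact this.symm

/-- `χ`, where `g v_{n+1} = χ v_{n+1}`. -/
def χ {n : ℕ} (g : SpW n) : ℝ := g.1.1 (.inl (Fin.last n)) (.inl (Fin.last n))

theorem χ_ne_zero {n : ℕ} (g : SpW n) : χ g ≠ 0 :=
  left_ne_zero_of_mul_eq_one (SpW_mul_diag g.2)

theorem χ_mul {n : ℕ} (g h : SpW n) : χ (g * h) = χ g * χ h := by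
  have e := congrFun (congrArg (fun v => g.1.1 *ᵥ v) (res_mulVec_single h.2)) (.inl (Fin.last n))
  simp only [Matrix.mulVec_mulVec, Matrix.mulVec_smul, res_mulVec_single g.2] at e
  simp [χ] at e ⊢
  rw [e, mul_comm]

/-- The sign of a real number as an element of `U(1)`. -/
def sgn (x : ℝ) : Circle := if x < 0 then -1 else 1

theorem sgn_mul {x y : ℝ} (hx : x ≠ 0) (hy : y ≠ 0) : sgn (x * y) = sgn x * sgn y := by
  rcases lt_or_gt_of_ne hx with h1 | h1 <;> rcases lt_or_gt_of_ne hy with h2 | h2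
  · simp [sgn, h1, h2, not_lt.2 (mul_pos_of_neg_of_neg h1 h2).le]
  · simp [sgn, h1, not_lt.2 h2.le, mul_neg_of_neg_of_pos h1 h2]
  · simp [sgn, not_lt.2 h1.le, h2, mul_neg_of_pos_of_neg h1 h2]
  · simp [sgn, not_lt.2 h1.le, not_lt.2 h2.le, not_lt.2 (mul_pos h1 h2).le]

theorem abs_eq_sgn_mul (x : ℝ) : ((|x| : ℝ) : ℂ) = (sgn x : ℂ) * x := by
  rcases lt_or_ge x 0 with h | h
  · simp [sgn, h, abs_of_neg h]
  · simp [sgn, not_lt.2 h, abs_of_nonneg h]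

/-- The element of `Sp(V; W)` under an element of `Mp^c(V; W)`. -/
def MpcW.σ {n : ℕ} (a : MpcW n) : SpW n := ⟨a.1.σ, a.2⟩

/-- The homomorphism `ν̂ : Mp^c(V; W) → Mp^c(W / W^⊥) = Mp^c(V_n)` over `ν`. It is the identity
on `U(1)`, and `η ∘ ν̂` is `η` up to a sign, so that `η_* ∘ ν̂_* = η_*`. -/
def νhat {n : ℕ} : MpcW n →* Mpc n where
  toFun a :=
    { σ := ν (MpcW.σ a)
      f := fun Z => (Real.sqrt |χ (MpcW.σ a)| : ℂ) * a.1.f (extend Z)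
      η := sgn (χ (MpcW.σ a)) * a.1.η
      continuous_f := continuous_const.mul (a.1.continuous_f.comp continuous_extend)
      sq_f := fun Z => by
        have h1 : ((Real.sqrt |χ (MpcW.σ a)| : ℝ) : ℂ) ^ 2 = ((|χ (MpcW.σ a)| : ℝ) : ℂ) := by
          rw [← Complex.ofReal_pow, Real.sq_sqrt (abs_nonneg _)]
        have h2 := det_den_SpW (MpcW.σ a) (extend Z)
        rw [trunc_extend] at h2
        rw [mul_pow, h1, a.1.sq_f, abs_eq_sgn_mul, ← h2, Circle.coe_mul]
        simp only [χ, MpcW.σ]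
        ring }
  map_one' := by
    have hχ : χ (MpcW.σ (1 : MpcW n)) = 1 := by simp [χ, MpcW.σ, Mpc.σ_one]
    ext1
    · exact ν_one
    · funext Z; simp [hχ, Mpc.f_one]
    · simp [hχ, sgn, Mpc.η_one, not_lt.2 zero_le_one]
  map_mul' a b := by
    have hm : MpcW.σ (a * b) = MpcW.σ a * MpcW.σ b := rfl
    ext1
    · exact ν_mul (MpcW.σ a) (MpcW.σ b)
    · funext Z
      have hf : a.1.f (act b.1.σ (extend Z)) = a.1.f (extend (act (ν (MpcW.σ b)) Z)) := by
        apply f_eq_of_trunc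
        rw [trunc_extend]
        have := trunc_act (MpcW.σ b) (extend Z)
        rwa [trunc_extend] at this
      simp only [Mpc.f_mul, hm, χ_mul, abs_mul, Subgroup.coe_mul, hf,
        Real.sqrt_mul (abs_nonneg _), Complex.ofReal_mul]
      ring
    · simp only [Mpc.η_mul, hm, χ_mul, Subgroup.coe_mul, sgn_mul (χ_ne_zero _) (χ_ne_zero _)]
      exact mul_mul_mul_comm _ _ _ _

/-! ### Hamiltonian systems on open subsets of `V_n` -/

/-- The Hamiltonian vector field `ξ_H`, with the convention `ξ_H ⌟ ω = dH`. -/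
def hamVec {n : ℕ} (H : V n → ℝ) (m : V n) : V n :=
  Sum.elim (fun j => fderiv ℝ H m (Pi.single (.inr j) 1))
    (fun j => -fderiv ℝ H m (Pi.single (.inl j) 1))

theorem Ω_hamVec {n : ℕ} (H : V n → ℝ) (m v : V n) : Ω (hamVec H m) v = fderiv ℝ H m v := by
  conv_rhs => rw [pi_eq_sum_univ' v]
  simp [Ω, hamVec, Fintype.sum_sum_type, Finset.sum_add_distrib, mul_comm, add_comm]

/-- `c` is an integral curve in `M` of the vector field `X`, starting at `x` and defined on the
closed interval between `0` and `t`. -/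
def IsIntegralFrom {n : ℕ} (X : V n → V n) (M : Set (V n)) (t : ℝ) (x : V n) (c : ℝ → V n) : Prop :=
  c 0 = x ∧ ∀ s ∈ Set.uIcc 0 t, c s ∈ M ∧ HasDerivWithinAt c (X (c s)) (Set.uIcc 0 t) s

/-- The point `x` is in the domain of the time `t` flow of `X` on `M`. -/
def FlowDefined {n : ℕ} (X : V n → V n) (M : Set (V n)) (t : ℝ) (x : V n) : Prop :=
  ∃ c, IsIntegralFrom X M t x c

open Classical in
/-- The (maximal, possibly incomplete) flow of `X` on `M`; the value is arbitrary outside of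
its domain. -/
def flow {n : ℕ} (X : V n → V n) (M : Set (V n)) (t : ℝ) (x : V n) : V n :=
  if h : FlowDefined X M t x then h.choose t else x

/-- The level set `S = H⁻¹(E)`. -/
def level {n : ℕ} (M : Set (V n)) (H : V n → ℝ) (E : ℝ) : Set (V n) := {s | s ∈ M ∧ H s = E}

/-- The tangent space `T_s S = ker dH_s` of the level set through `s`. -/
def tangent {n : ℕ} (H : V n → ℝ) (s : V n) : Submodule ℝ (V n) :=
  LinearMap.ker (fderiv ℝ H s).toLinearMap

/-- The null direction `T_s S^⊥`. -/
def nullDir {n : ℕ} (H : V n → ℝ) (s : V n) : Submodule ℝ (V n) := perp (tangent H s)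

/-- The symplectic vector space `T_s S / T_s S^⊥`. -/
abbrev RedTangent {n : ℕ} (H : V n → ℝ) (s : V n) : Type :=
  tangent H s ⧸ (nullDir H s).submoduleOf (tangent H s)

/-- The class in `T_s S / T_s S^⊥` of a tangent vector. -/
abbrev cls {n : ℕ} {H : V n → ℝ} {s : V n} (u : tangent H s) : RedTangent H s :=
  Submodule.Quotient.mk u

/-- The symplectic frame bundle `Sp(TS / TS^⊥)` of the level set `S = H⁻¹(E)`: a point `s ∈ S`
with a symplectic isomorphism `V_n ≅ W / W^⊥ → T_s S / T_s S^⊥`. -/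
structure RedFrame {n : ℕ} (M : Set (V (n + 1))) (H : V (n + 1) → ℝ) (E : ℝ) where
  pt : V (n + 1)
  mem : pt ∈ level M H E
  frame : V n ≃ₗ[ℝ] RedTangent H pt
  symplectic : ∀ (x y : V n) (u v : tangent H pt),
    cls u = frame x → cls v = frame y → Ω u.1 v.1 = Ω x y

theorem RedFrame.ext_of_rep {n : ℕ} {M : Set (V (n + 1))} {H : V (n + 1) → ℝ} {E : ℝ}
    (F G : RedFrame M H E) (hp : F.pt = G.pt)
    (h : ∀ x, ∃ (u : tangent H F.pt) (v : tangent H G.pt),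
      F.frame x = cls u ∧ G.frame x = cls v ∧ v.1 - u.1 ∈ nullDir H F.pt) : F = G := by
  obtain ⟨p, hp1, f, hf⟩ := F
  obtain ⟨q, hq1, g, hg⟩ := G
  subst hp
  congr 1
  ext1 x
  obtain ⟨u, v, hu, hv, huv⟩ := h x
  change f x = _ at hu
  change g x = _ at hv
  rw [hu, hv]
  refine ((Submodule.Quotient.eq _).2 ?_).symm
  exact huv

/-- The bundle `P^S → Sp(M, ω; S)`, the restriction of `P = M × Mp^c(V_{n+1})` to those symplectic
frames `b` at points `s ∈ S` with `b W = T_s S`. Here frames of `T M = M × V_{n+1}` are written in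
the coordinate trivialization, and `Σ(s, a) = (s, σ(a))`. -/
structure PUp {n : ℕ} (M : Set (V (n + 1))) (H : V (n + 1) → ℝ) (E : ℝ) where
  pt : V (n + 1)
  a : Mpc (n + 1)
  mem : pt ∈ level M H E
  map_W : (W n).map a.σ.1.mulVecLin = tangent H pt

/-- The relation `(p · h, c) ∼ (p, ν̂(h) c)`, `h ∈ Mp^c(V; W)`, on `P^S × Mp^c(V_n)`. -/
def PDown.setoid {n : ℕ} (M : Set (V (n + 1))) (H : V (n + 1) → ℝ) (E : ℝ) :
    Setoid (PUp M H E × Mpc n) where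
  r x y := ∃ h : MpcW n, y.1.pt = x.1.pt ∧ y.1.a = x.1.a * h.1 ∧ x.2 = νhat h * y.2
  iseqv :=
    { refl := fun x => ⟨1, rfl, by simp, by simp⟩
      symm := by
        rintro x y ⟨h, h1, h2, h3⟩
        exact ⟨h⁻¹, h1.symm, by simp [h2], by simp [h3]⟩
      trans := by
        rintro x y z ⟨h, h1, h2, h3⟩ ⟨k, k1, k2, k3⟩
        exact ⟨h * k, k1.trans h1, by simp [h2, k2, mul_assoc], by simp [h3, k3, mul_assoc]⟩ }

/-- The bundle `P_S = P^S ×_{ν̂} Mp^c(V_n)` associated to `P^S` by `ν̂`. -/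
def PDown {n : ℕ} (M : Set (V (n + 1))) (H : V (n + 1) → ℝ) (E : ℝ) : Type :=
  Quotient (PDown.setoid M H E)

/-- The class `[p, c]` in `P_S`. -/
def PDown.mk {n : ℕ} {M : Set (V (n + 1))} {H : V (n + 1) → ℝ} {E : ℝ} (p : PUp M H E)
    (c : Mpc n) : PDown M H E :=
  Quotient.mk (PDown.setoid M H E) (p, c)

/-- A symplectic frame `b` with `b W = T_s S` as a map `V_n → T_s S`. -/
def PUp.toTangent {n : ℕ} {M : Set (V (n + 1))} {H : V (n + 1) → ℝ} {E : ℝ} (p : PUp M H E) :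
    V n →ₗ[ℝ] tangent H p.pt :=
  LinearMap.codRestrict _ (p.a.σ.1.mulVecLin ∘ₗ incl) fun x => by
    rw [← p.map_W]
    exact ⟨incl x, incl_mem x, rfl⟩

theorem PUp.toTangent_coe {n : ℕ} {M : Set (V (n + 1))} {H : V (n + 1) → ℝ} {E : ℝ}
    (p : PUp M H E) (x : V n) : (p.toTangent x).1 = p.a.σ.1 *ᵥ incl x := rfl

theorem PUp.single_mem {n : ℕ} {M : Set (V (n + 1))} {H : V (n + 1) → ℝ} {E : ℝ}
    (p : PUp M H E) (r : ℝ) :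
    p.a.σ.1 *ᵥ (r • Pi.single (.inl (Fin.last n)) 1) ∈ nullDir H p.pt := by
  intro u hu
  rw [← p.map_W] at hu
  obtain ⟨w, hw, rfl⟩ := hu
  have hw' : w (.inr (Fin.last n)) = 0 := hw
  rw [Matrix.mulVecLin_apply, Ω_mulVec]
  simp [Ω, Pi.single_apply, hw']

theorem PUp.bijective {n : ℕ} {M : Set (V (n + 1))} {H : V (n + 1) → ℝ} {E : ℝ}
    (p : PUp M H E) : Function.Bijective
      ((Submodule.mkQ ((nullDir H p.pt).submoduleOf (tangent H p.pt))) ∘ₗ p.toTangent) := by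
  constructor
  · rw [injective_iff_map_eq_zero]
    intro y hy
    have hy' : p.toTangent y ∈ (nullDir H p.pt).submoduleOf (tangent H p.pt) :=
      (Submodule.Quotient.mk_eq_zero _).1 hy
    have h : ∀ x, Ω y x = 0 := by
      intro x
      have := hy' (p.toTangent x).1 (p.toTangent x).2
      rw [← Ω_incl, ← Ω_mulVec p.a.σ]
      exact this
    ext (j | j)
    · simpa [Ω_inr] using h (Pi.single (.inr j) 1)
    · simpa [Ω_inl] using h (Pi.single (.inl j) 1)
  · intro z
    obtain ⟨u, rfl⟩ := Submodule.Quotient.mk_surjective _ z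
    obtain ⟨w, hw, hwu⟩ : u.1 ∈ (W n).map p.a.σ.1.mulVecLin := by
      have h := p.map_W
      exact h.symm.le u.2
    refine ⟨res w, ((Submodule.Quotient.eq _).2 ?_).symm⟩
    change u.1 - p.a.σ.1 *ᵥ incl (res w) ∈ nullDir H p.pt
    rw [← hwu, Matrix.mulVecLin_apply, ← Matrix.mulVec_sub]
    have e : w - incl (res w) = w (.inl (Fin.last n)) • Pi.single (.inl (Fin.last n)) 1 :=
      sub_eq_of_eq_add' (mem_W_eq hw)
    rw [e]
    exact p.single_mem _

theorem Ω_sub_left {n : ℕ} (u u' v : V n) : Ω (u - u') v = Ω u v - Ω u' v := by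
  simp only [Ω, Pi.sub_apply, ← Finset.sum_sub_distrib]
  exact Finset.sum_congr rfl fun _ _ => by ring

theorem Ω_neg_symm {n : ℕ} (u v : V n) : Ω u v = - Ω v u := by
  simp only [Ω, ← Finset.sum_neg_distrib]
  exact Finset.sum_congr rfl fun _ _ => by ring

/-- The symplectic form of `T_s S / T_s S^⊥` is well defined. -/
theorem Ω_eq_of_cls_eq {n : ℕ} {H : V n → ℝ} {s : V n} {u u' v v' : tangent H s}
    (hu : cls u = cls u') (hv : cls v = cls v') : Ω u.1 v.1 = Ω u'.1 v'.1 := by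
  have h1 : u.1 - u'.1 ∈ nullDir H s :=
    (Submodule.Quotient.eq ((nullDir H s).submoduleOf (tangent H s))).1 hu
  have h2 : v.1 - v'.1 ∈ nullDir H s :=
    (Submodule.Quotient.eq ((nullDir H s).submoduleOf (tangent H s))).1 hv
  have e1 := h1 v.1 v.2
  have e2 := h2 u'.1 u'.2
  rw [Ω_sub_left] at e1 e2
  rw [Ω_neg_symm u'.1 v'.1]
  rw [Ω_neg_symm v.1] at e2
  linarith

/-- A symplectic matrix as a linear automorphism of `V_n`. -/
def spEquiv {n : ℕ} (g : Sp n) : V n ≃ₗ[ℝ] V n :=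
  { g.1.mulVecLin with
    invFun := fun x => (g⁻¹).1 *ᵥ x
    left_inv := fun x => by
      change (g⁻¹).1 *ᵥ (g.1 *ᵥ x) = x
      rw [Matrix.mulVec_mulVec, ← Submonoid.coe_mul, inv_mul_cancel, Submonoid.coe_one,
        Matrix.one_mulVec]
    right_inv := fun x => by
      change g.1 *ᵥ ((g⁻¹).1 *ᵥ x) = x
      rw [Matrix.mulVec_mulVec, ← Submonoid.coe_mul, mul_inv_cancel, Submonoid.coe_one,
        Matrix.one_mulVec] }

/-- The symplectic frame `[σ(a)] ∘ σ(c)` of `T_s S / T_s S^⊥` under `((s, a), c)`. -/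
def PUp.toFrame {n : ℕ} {M : Set (V (n + 1))} {H : V (n + 1) → ℝ} {E : ℝ}
    (p : PUp M H E) (c : Mpc n) : RedFrame M H E where
  pt := p.pt
  mem := p.mem
  frame := (spEquiv c.σ).trans
    (LinearEquiv.ofBijective _ p.bijective)
  symplectic x y u v hu hv := by
    have hu' : cls u = cls (p.toTangent (c.σ.1 *ᵥ x)) := hu
    have hv' : cls v = cls (p.toTangent (c.σ.1 *ᵥ y)) := hv
    have e := Ω_eq_of_cls_eq hu' hv'
    rw [e, PUp.toTangent_coe, PUp.toTangent_coe, Ω_mulVec, Ω_incl, Ω_mulVec]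

theorem PUp.toFrame_apply {n : ℕ} {M : Set (V (n + 1))} {H : V (n + 1) → ℝ} {E : ℝ}
    (p : PUp M H E) (c : Mpc n) (x : V n) :
    (p.toFrame c).frame x = cls (p.toTangent (c.σ.1 *ᵥ x)) := rfl

/-- The projection `Σ_S : P_S → Sp(TS / TS^⊥)`. -/
def PDown.proj {n : ℕ} {M : Set (V (n + 1))} {H : V (n + 1) → ℝ} {E : ℝ} :
    PDown M H E → RedFrame M H E :=
  Quotient.lift (fun x => x.1.toFrame x.2) (by
    rintro ⟨p, c⟩ ⟨q, d⟩ ⟨h, h1, h2, h3⟩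
    change q.pt = p.pt at h1
    change q.a = p.a * h.1 at h2
    change c = νhat h * d at h3
    refine RedFrame.ext_of_rep _ _ h1.symm fun x =>
      ⟨p.toTangent (c.σ.1 *ᵥ x), q.toTangent (d.σ.1 *ᵥ x), p.toFrame_apply c x,
        q.toFrame_apply d x, ?_⟩
    obtain ⟨r, hr⟩ := mulVec_incl (MpcW.σ h) (d.σ.1 *ᵥ x)
    have hc : c.σ.1 *ᵥ x = (ν (MpcW.σ h)).1 *ᵥ (d.σ.1 *ᵥ x) := by
      rw [h3, Matrix.mulVec_mulVec]; rfl
    have hq : q.a.σ.1 *ᵥ incl (d.σ.1 *ᵥ x) =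
        p.a.σ.1 *ᵥ ((MpcW.σ h).1.1 *ᵥ incl (d.σ.1 *ᵥ x)) := by
      rw [h2, Matrix.mulVec_mulVec]; rfl
    rw [PUp.toTangent_coe, PUp.toTangent_coe, hq, hr, hc, ← Matrix.mulVec_sub, add_sub_cancel_left]
    exact p.single_mem r)

/-- A curve in `Mp^c(V_n)` is differentiable if its coordinates in the embedding
`a ↦ (σ(a), f(i·1))` into `Sp(V_n) × ℂ` are. -/
def MpcDifferentiable {n : ℕ} (a : ℝ → Mpc n) : Prop :=
  (∀ i j, Differentiable ℝ fun t => (a t).σ.1 i j) ∧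
    Differentiable ℝ fun t => (a t).f (basePt n)

/-- The value `½ η_* ϑ(a')` at time `t` of the `u(1)`-part of the trivial connection `ϑ` (the
Maurer–Cartan form of `Mp^c(V_n)`) on the velocity of a curve `a`, as an imaginary number. -/
def halfEta {n : ℕ} (a : ℝ → Mpc n) (t : ℝ) : ℂ :=
  (1 / 2) * (deriv (fun τ => ((a τ).η : ℂ)) t / ((a t).η : ℂ))

/-- The value at time `t` of `γ = (1/iħ) Π^* β + ½ η_* ϑ` on the velocity of the curve `(m, a)` in
`P = M × Mp^c(V_n)`. -/
def gammaVal {n : ℕ} (ħ : ℝ) (β : V n → V n → ℝ) (m : ℝ → V n) (a : ℝ → Mpc n) (t : ℝ) : ℂ :=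
  1 / (Complex.I * ħ) * (β (m t) (deriv m t) : ℂ) + halfEta a t

/-- `c` is the orbit `t ↦ φ̃^t(c 0) = φ^t_* ∘ c 0` in `Sp(TS / TS^⊥)`, where `φ^t` is the flow of
`ξ_H` and `φ^t_*` is the map `T_s S / T_s S^⊥ → T_{φ^t s} S / T_{φ^t s} S^⊥` it induces. -/
def IsFrameOrbit {n : ℕ} {M : Set (V (n + 1))} {H : V (n + 1) → ℝ} {E : ℝ}
    (c : ℝ → RedFrame M H E) : Prop :=
  ∀ t, FlowDefined (hamVec H) M t (c 0).pt ∧ (c t).pt = flow (hamVec H) M t (c 0).pt ∧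
    ∀ (x : V n) (u : tangent H (c 0).pt), cls u = (c 0).frame x →
      ∃ h : fderiv ℝ (flow (hamVec H) M t) (c 0).pt u.1 ∈ tangent H (c t).pt,
        cls ⟨_, h⟩ = (c t).frame x

/-- `c` is a closed orbit of `φ̃^t` in `Sp(TS / TS^⊥)`, with a (not necessarily minimal)
period `T`. -/
def IsClosedFrameOrbit {n : ℕ} {M : Set (V (n + 1))} {H : V (n + 1) → ℝ} {E : ℝ}
    (c : ℝ → RedFrame M H E) (T : ℝ) : Prop :=
  0 < T ∧ IsFrameOrbit c ∧ c T = c 0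

/-- `l` is a `γ_S`-horizontal lift to `P_S` of the curve `c` in `Sp(TS / TS^⊥)`. The connection
form `γ_S` is the one whose pullback to `P^S × Mp^c(V_n)` is `γ^S + ½ η_* ϑ`. -/
def IsHorizontalLift {n : ℕ} {M : Set (V (n + 1))} {H : V (n + 1) → ℝ} {E : ℝ} (ħ : ℝ)
    (β : V (n + 1) → V (n + 1) → ℝ) (c : ℝ → RedFrame M H E) (l : ℝ → PDown M H E) : Prop :=
  (∀ t, (l t).proj = c t) ∧
  ∃ (p : ℝ → PUp M H E) (d : ℝ → Mpc n),
    Differentiable ℝ (fun t => (p t).pt) ∧ MpcDifferentiable (fun t => (p t).a) ∧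
    MpcDifferentiable d ∧ (∀ t, l t = PDown.mk (p t) (d t)) ∧
    ∀ t, gammaVal ħ β (fun τ => (p τ).pt) (fun τ => (p τ).a) t + halfEta d t = 0

/-- The holonomy of `γ_S` over the closed curve `c|_[0, T]` in `Sp(TS / TS^⊥)` is trivial. -/
def TrivialHolonomy {n : ℕ} {M : Set (V (n + 1))} {H : V (n + 1) → ℝ} {E : ℝ} (ħ : ℝ)
    (β : V (n + 1) → V (n + 1) → ℝ) (c : ℝ → RedFrame M H E) (T : ℝ) : Prop :=
  ∀ l, IsHorizontalLift ħ β c l → l T = l 0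

/-- `E` is a quantized energy level of `(M, ω, H)` for the metaplectic-c prequantization
`P = M × Mp^c(V_{n+1})`, `γ = (1/iħ) Π^* β + ½ η_* ϑ`: it is a regular value of `H`, and `γ_S` has
trivial holonomy over all closed orbits of `φ̃^t` on `Sp(TS / TS^⊥)`. -/
def IsQuantizedLevel {n : ℕ} (ħ : ℝ) (β : V (n + 1) → V (n + 1) → ℝ) (M : Set (V (n + 1)))
    (H : V (n + 1) → ℝ) (E : ℝ) : Prop :=
  (∀ m ∈ level M H E, fderiv ℝ H m ≠ 0) ∧
  ∀ (c : ℝ → RedFrame M H E) (T : ℝ), IsClosedFrameOrbit c T → TrivialHolonomy ħ β c T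

/-! ### The hydrogen atom -/

/-- The phase space `(ℝ³ \ 0) × ℝ³`, with coordinates `q_j = m (inl j)`, `p_j = m (inr j)`. -/
def hydrogenSpace : Set (V 3) := {m | ∃ j, m (.inl j) ≠ 0}

/-- `H = |p|² / (2 m_e) - k / |q|`. -/
def hydrogenH (mₑ k : ℝ) (m : V 3) : ℝ :=
  1 / (2 * mₑ) * ∑ j, m (.inr j) ^ 2 - k / Real.sqrt (∑ j, m (.inl j) ^ 2)

/-- The one-form `β = ∑ (q_j dp_j + d(q_j p_j))` at `m`, evaluated on `v`. -/
def hydrogenβ (m v : V 3) : ℝ :=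
  ∑ j, (m (.inl j) * v (.inr j) + (m (.inl j) * v (.inr j) + m (.inr j) * v (.inl j)))

/-- `dβ = ω`. -/
theorem d_hydrogenβ (m u v : V 3) :
    fderiv ℝ (fun x => hydrogenβ x v) m u - fderiv ℝ (fun x => hydrogenβ x u) m v = Ω u v := by
  have h : ∀ w z : V 3, fderiv ℝ (fun x => hydrogenβ x w) m z = hydrogenβ z w := by
    intro w z
    let L : V 3 →ₗ[ℝ] ℝ :=
      { toFun := fun x => hydrogenβ x w
        map_add' := fun x y => by
          simp only [hydrogenβ, Pi.add_apply, ← Finset.sum_add_distrib]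
          exact Finset.sum_congr rfl fun _ _ => by ring
        map_smul' := fun r x => by
          simp only [hydrogenβ, Pi.smul_apply, smul_eq_mul, Finset.mul_sum, RingHom.id_apply]
          exact Finset.sum_congr rfl fun _ _ => by ring }
    exact congrArg (fun T : V 3 →L[ℝ] ℝ => T z) (LinearMap.toContinuousLinearMap L).fderiv
  rw [h, h]
  simp only [hydrogenβ, Ω, ← Finset.sum_sub_distrib]
  exact Finset.sum_congr rfl fun _ _ => by ring

end MpcQuant
end

/-!
The idea is to compare every orbit of reduced frames with one explicit frame that depends on the
state only.

For `E ≥ 0` the function `q · p` increases strictly along every orbit, since its derivative is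
`2 E + k / |q|` (`dotqp_lt`). So no orbit is periodic, no orbit of frames is closed, and the
condition on the holonomy is empty.

For `E < 0` write `E = -k / (2 a)` and `κ = √(mₑ k a)`, so that `E = E_n` means `κ = n ħ` (`a` is
the semi-major axis). A periodic orbit has angular momentum (`exists_ang_ne_zero`) and can be
rotated into the plane `q₃ = p₃ = 0`. There, two components of the angular momentum and two
components of the eccentricity (Laplace–Runge–Lenz) vector are first integrals whose Hamiltonian
vectors, suitably normalized, form a symplectic frame of `T S / T S^⊥`; the Hamiltonian vector of
`H` and a scaling vector complete it to a frame of `V_3` (`frameSp`). The derivative of the flow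
preserves the pairing with the Hamiltonian vectors of first integrals (`Ω_fderiv_eq`), so the flow
carries this frame along. The frame is a function of the state; hence it closes up whenever the
orbit does. The same holds for its lift to the metaplectic group: that lift amounts to a
continuous square root of `det (i C + D)`, and the determinant is the square of a nonzero function
of the state times two factors with positive real part, of which the principal root can be taken
(`det_den_frameSp`, `frameRoot`). Hence the metaplectic part contributes nothing to the holonomy.

What remains is the phase `exp (i / ħ ∮ β)` (`IsHorizontalLift.exists_phase`). A primitive of `β`
along the orbit is `q · p - κ θ`, with `θ` the eccentric anomaly
(`IsKeplerOrbit.hasDerivAt_action`), and `θ` increases over a period by `2 π j` for an integer `j`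
(`IsKeplerOrbit.anomaly_eq`). So the phase is `exp (-2 π i j κ / ħ)`, which is `1` if `κ` is a
multiple of `ħ`.

For the converse it suffices to exhibit one closed orbit of frames with `j = 1`, and the frame
over a circular orbit is one as soon as the flow is differentiable there. Near the circular orbit
the Kepler problem is solved in closed form in terms of the eccentric anomaly (`kepPt`), which
depends differentiably on the initial state by the implicit function theorem applied to Kepler's
equation (`IsElliptic.differentiableAt_flow`).
-/

noncomputable section

open scoped Matrix ComplexOrder

namespace MpcQuant

/-! ### Continuous families in the metaplectic-c group -/

/-- A square root of `w (0, ·)` extends to a square root of a nowhere vanishing homotopy `w`. -/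
theorem exists_sqrt_homotopy {A : Type*} [TopologicalSpace A] {w : unitInterval × A → ℂ}
    (hw : Continuous w) (hw0 : ∀ x, w x ≠ 0) {u : A → ℂ} (hu : Continuous u)
    (huw : ∀ a, u a ^ 2 = w (0, a)) :
    ∃ v : unitInterval × A → ℂ, Continuous v ∧ (∀ x, v x ^ 2 = w x) ∧ ∀ a, v (0, a) = u a := by
  have cov := isCoveringMap_npow (𝕜 := ℂ) 2 (by norm_num)
  have hu0 : ∀ a, u a ≠ 0 := fun a h => hw0 (0, a) (by rw [← huw, h]; simp)
  let w' : C(unitInterval × A, {x : ℂ // x ≠ 0}) := ⟨fun x => ⟨w x, hw0 x⟩, by fun_prop⟩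
  let u' : C(A, {x : ℂ // x ≠ 0}) := ⟨fun a => ⟨u a, hu0 a⟩, by fun_prop⟩
  have h0 : ∀ a, w' (0, a) = (fun x : {x : ℂ // x ≠ 0} =>
      (⟨x.1 ^ 2, pow_ne_zero 2 x.2⟩ : {x : ℂ // x ≠ 0})) (u' a) :=
    fun a => Subtype.ext (huw a).symm
  refine ⟨fun x => (cov.liftHomotopy w' u' h0 x).1, by fun_prop, fun x => ?_, fun a => ?_⟩
  · exact congrArg Subtype.val (congrFun (cov.liftHomotopy_lifts w' u' h0) x)
  · exact congrArg Subtype.val (cov.liftHomotopy_zero w' u' h0 a)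

theorem continuous_seg {n : ℕ} (Y : Siegel n) :
    Continuous fun x : unitInterval × Siegel n => seg Y x.2 x.1 := by
  refine Continuous.subtype_mk ?_ _
  have h : Continuous fun x : unitInterval × Siegel n => x.2.1 :=
    continuous_subtype_val.comp continuous_snd
  exact ((Complex.continuous_ofReal.comp (by fun_prop)).smul continuous_const).add
    ((Complex.continuous_ofReal.comp (by fun_prop)).smul h)

theorem seg_zero {n : ℕ} (Y Z : Siegel n) : seg Y Z 0 = Y := by
  apply Subtype.ext; simp [seg]

theorem seg_one {n : ℕ} (Y Z : Siegel n) : seg Y Z 1 = Z := by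
  apply Subtype.ext; simp [seg]

theorem continuous_map_ofReal {A : Type*} [TopologicalSpace A] {m : Type*}
    {M : A → Matrix m m ℝ} (hM : Continuous M) :
    Continuous fun a => (M a).map (fun x => (x : ℂ)) :=
  hM.matrix_map Complex.continuous_ofReal

theorem continuous_num_den {A : Type*} [TopologicalSpace A] {n : ℕ} {g : A → Sp n}
    {Z : A → Siegel n} (hg : Continuous g) (hZ : Continuous Z) :
    (Continuous fun a => num (g a) (Z a).1) ∧ Continuous fun a => den (g a) (Z a).1 := by
  have hg' : Continuous fun a => (g a).1 := continuous_subtype_val.comp hg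
  have hZ' : Continuous fun a => (Z a).1 := continuous_subtype_val.comp hZ
  constructor
  · exact ((continuous_map_ofReal (hg'.matrix_submatrix _ _)).matrix_mul hZ').add
      (continuous_map_ofReal (hg'.matrix_submatrix _ _))
  · exact ((continuous_map_ofReal (hg'.matrix_submatrix _ _)).matrix_mul hZ').add
      (continuous_map_ofReal (hg'.matrix_submatrix _ _))

theorem continuous_act_act {A : Type*} [TopologicalSpace A] {n : ℕ} {g : A → Sp n}
    {Z : A → Siegel n} (hg : Continuous g) (hZ : Continuous Z) :
    Continuous fun a => act (g a) (Z a) := by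
  obtain ⟨h1, h2⟩ := continuous_num_den hg hZ
  refine Continuous.subtype_mk (h1.matrix_mul ?_) _
  have : (fun a => (den (g a) (Z a).1)⁻¹) =
      fun a => ((den (g a) (Z a).1).det)⁻¹ • (den (g a) (Z a).1).adjugate := by
    funext a; rw [Matrix.inv_def, Ring.inverse_eq_inv']
  rw [this]
  exact (h2.matrix_det.inv₀ fun a => (isUnit_det_den _ _).ne_zero).smul h2.matrix_adjugate

namespace Mpc

/-- Every choice of a square root of `det (C Z + D)` at the base point defines an element of the
metaplectic group: the square root extends along segments from the base point. -/
theorem exists_lift {n : ℕ} (g : Sp n) {u : ℂ} (hu : u ^ 2 = (den g (basePt n).1).det) :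
    ∃ a : Mpc n, a.σ = g ∧ a.η = 1 ∧ a.f (basePt n) = u := by
  have hw : Continuous fun x : unitInterval × Siegel n => (den g (seg (basePt n) x.2 x.1).1).det :=
    (continuous_num_den continuous_const (continuous_seg _)).2.matrix_det
  obtain ⟨v, hv, hv2, hv0⟩ := exists_sqrt_homotopy hw (fun x => (isUnit_det_den _ _).ne_zero)
    (u := fun _ => u) continuous_const (fun a => by rw [seg_zero]; exact hu)
  refine ⟨⟨g, fun Z => v (1, Z), 1, by fun_prop, fun Z => ?_⟩, rfl, rfl, ?_⟩
  · rw [hv2, seg_one]; simp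
  · change v (1, basePt n) = u
    rw [← hv0 (basePt n)]
    have hs : ∀ x, seg (basePt n) (basePt n) x = basePt n := by
      intro x; apply Subtype.ext
      simp only [seg]
      rw [← add_smul]; simp
    refine (isPreconnected_univ (α := unitInterval)).eq_of_sq_eq
      (f := fun t => v (t, basePt n)) (g := fun _ => v (0, basePt n))
      (by fun_prop) continuousOn_const (fun t _ => ?_) (fun {_} _ => ?_)
      (y := 0) (Set.mem_univ _) rfl (Set.mem_univ 1)
    · simp only [Pi.pow_apply, hv2, hs]
    · intro h
      have := hv2 (0, basePt n)
      rw [h, hs] at this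
      exact (isUnit_det_den g (basePt n)).ne_zero (by simpa using this.symm)

theorem η_eq {n : ℕ} (a : Mpc n) (Z : Siegel n) : (a.η : ℂ) = a.f Z ^ 2 / (den a.σ Z.1).det := by
  rw [a.sq_f, mul_div_cancel_right₀ _ (isUnit_det_den _ _).ne_zero]

/-- An element of `Mp^c(V_n)` is determined by its coordinates `σ` and `f(i·1)`. -/
theorem ext_basePt {n : ℕ} {a b : Mpc n} (h : a.σ = b.σ) (hf : a.f (basePt n) = b.f (basePt n)) :
    a = b := by
  have hη : a.η = b.η := by
    apply Subtype.ext
    rw [a.η_eq (basePt n), b.η_eq (basePt n), h, hf]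
  refine Mpc.ext h ?_ hη
  funext Z
  have hs : Continuous fun x : unitInterval => seg (basePt n) Z x :=
    (continuous_seg _).comp (Continuous.prodMk_left Z)
  have := (isPreconnected_univ (α := unitInterval)).eq_of_sq_eq
      (f := fun t => a.f (seg (basePt n) Z t)) (g := fun t => b.f (seg (basePt n) Z t))
      (a.continuous_f.comp hs).continuousOn (b.continuous_f.comp hs).continuousOn
      (fun t _ => by simp only [Pi.pow_apply, a.sq_f, b.sq_f, h, hη])
      (fun {_} _ => b.f_ne_zero _)
      (y := 0) (Set.mem_univ _) (by simpa only [seg_zero] using hf) (Set.mem_univ 1)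
  simpa only [seg_one] using this

end Mpc

/-- A family in `Mp^c(V_n)` is continuous if `σ` is, and `f` is jointly continuous in the
parameter and the point of the Siegel upper half space. -/
def MpcContinuous {A : Type*} [TopologicalSpace A] {n : ℕ} (a : A → Mpc n) : Prop :=
  Continuous (fun t => (a t).σ) ∧ Continuous fun p : A × Siegel n => (a p.1).f p.2

/-- It suffices to check continuity of `f` at the base point: the values elsewhere follow by
lifting the homotopy along segments. -/
theorem MpcContinuous.of_basePt {A : Type*} [TopologicalSpace A] {n : ℕ} {a : A → Mpc n}
    (hσ : Continuous fun t => (a t).σ) (hf : Continuous fun t => (a t).f (basePt n)) :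
    MpcContinuous a := by
  refine ⟨hσ, ?_⟩
  have hη : Continuous fun t => ((a t).η : ℂ) := by
    simp only [fun t => (a t).η_eq (basePt n)]
    exact (hf.pow 2).div (continuous_num_den hσ continuous_const).2.matrix_det
      (fun t => (isUnit_det_den _ _).ne_zero)
  have hw : Continuous fun x : unitInterval × (A × Siegel n) =>
      ((a x.2.1).η : ℂ) * (den (a x.2.1).σ (seg (basePt n) x.2.2 x.1).1).det :=
    (hη.comp (by fun_prop)).mul (continuous_num_den (hσ.comp (by fun_prop))
      ((continuous_seg _).comp (by fun_prop :
        Continuous fun x : unitInterval × (A × Siegel n) => (x.1, x.2.2)))).2.matrix_det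
  obtain ⟨v, hv, hv2, hv0⟩ := exists_sqrt_homotopy hw
    (fun x => mul_ne_zero (Circle.coe_ne_zero _) (isUnit_det_den _ _).ne_zero)
    (u := fun x => (a x.1).f (basePt n)) (hf.comp continuous_fst)
    (fun x => by rw [seg_zero, Mpc.sq_f])
  have key : ∀ x : A × Siegel n, (a x.1).f x.2 = v (1, x) := by
    rintro ⟨t, Z⟩
    have hs : Continuous fun x : unitInterval => seg (basePt n) Z x :=
      (continuous_seg _).comp (Continuous.prodMk_left Z)
    have := (isPreconnected_univ (α := unitInterval)).eq_of_sq_eq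
      (f := fun x => v (x, (t, Z))) (g := fun x => (a t).f (seg (basePt n) Z x))
      (by fun_prop) ((a t).continuous_f.comp hs).continuousOn
      (fun x _ => by simp only [Pi.pow_apply, hv2, Mpc.sq_f])
      (fun {_} _ => (a t).f_ne_zero _)
      (y := 0) (Set.mem_univ _) (by simp only [seg_zero, hv0]) (Set.mem_univ 1)
    simpa only [seg_one] using this.symm
  simp only [key]
  fun_prop

theorem MpcContinuous.mul {A : Type*} [TopologicalSpace A] {n : ℕ} {a b : A → Mpc n}
    (ha : MpcContinuous a) (hb : MpcContinuous b) : MpcContinuous fun t => a t * b t := by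
  refine ⟨ha.1.mul hb.1, ?_⟩
  simp only [Mpc.f_mul]
  exact (ha.2.comp (continuous_fst.prodMk
    (continuous_act_act (hb.1.comp continuous_fst) continuous_snd))).mul hb.2

theorem continuous_Sp_inv {A : Type*} [TopologicalSpace A] {n : ℕ} {g : A → Sp n}
    (hg : Continuous g) : Continuous fun a => (g a)⁻¹ := by
  refine continuous_induced_rng.2 ?_
  have : (Subtype.val ∘ fun a => (g a)⁻¹) =
      fun a => (- Matrix.J (Fin n) ℝ) * (g a).1ᵀ * Matrix.J (Fin n) ℝ := by
    funext a; exact SymplecticGroup.coe_inv _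
  rw [this]
  exact (continuous_const.matrix_mul (continuous_subtype_val.comp hg).matrix_transpose).matrix_mul
    continuous_const

theorem MpcContinuous.inv {A : Type*} [TopologicalSpace A] {n : ℕ} {a : A → Mpc n}
    (ha : MpcContinuous a) : MpcContinuous fun t => (a t)⁻¹ := by
  have h := continuous_Sp_inv ha.1
  refine ⟨h, ?_⟩
  simp only [Mpc.f_inv]
  exact (ha.2.comp (continuous_fst.prodMk
    (continuous_act_act (h.comp continuous_fst) continuous_snd))).inv₀
    fun _ => Mpc.f_ne_zero _ _

theorem MpcContinuous.νhat {A : Type*} [TopologicalSpace A] {n : ℕ} {a : A → MpcW n}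
    (ha : MpcContinuous fun t => (a t).1) : MpcContinuous fun t => νhat (a t) := by
  have h : Continuous fun t => (a t).1.σ.1 := continuous_subtype_val.comp ha.1
  constructor
  · refine continuous_induced_rng.2 ?_
    exact h.matrix_submatrix _ _
  · have hχ : Continuous fun t => χ (MpcW.σ (a t)) := h.matrix_elem _ _
    have : Continuous fun p : A × Siegel n => (Real.sqrt |χ (MpcW.σ (a p.1))| : ℂ) *
        (a p.1).1.f (extend p.2) :=
      (Complex.continuous_ofReal.comp (Real.continuous_sqrt.comp
        (continuous_abs.comp (hχ.comp continuous_fst)))).mul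
        (ha.2.comp (continuous_fst.prodMk (continuous_extend.comp continuous_snd)))
    exact this

theorem MpcDifferentiable.continuous {n : ℕ} {a : ℝ → Mpc n} (h : MpcDifferentiable a) :
    MpcContinuous a :=
  MpcContinuous.of_basePt
    (continuous_induced_rng.2 (continuous_matrix fun i j => (h.1 i j).continuous))
    h.2.continuous

theorem MpcContinuous.f_basePt {A : Type*} [TopologicalSpace A] {n : ℕ} {a : A → Mpc n}
    (ha : MpcContinuous a) : Continuous fun t => (a t).f (basePt n) :=
  ha.2.comp (Continuous.prodMk_left (basePt n))

theorem MpcDifferentiable.differentiable_η {n : ℕ} {a : ℝ → Mpc n} (h : MpcDifferentiable a) :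
    Differentiable ℝ fun t => ((a t).η : ℂ) := by
  simp only [fun t => (a t).η_eq (basePt n)]
  have hd : Differentiable ℝ fun t => (den (a t).σ (basePt n).1).det := by
    simp only [Matrix.det_apply]
    refine Differentiable.fun_sum fun s _ => Differentiable.const_smul ?_ _
    refine Differentiable.fun_finsetProd fun i _ => ?_
    have h' : ∀ i j, Differentiable ℝ fun t => (((a t).σ.1 i j : ℝ) : ℂ) := fun i j =>
      Complex.ofRealCLM.differentiable.comp (h.1 i j)
    simp only [den, blkC, blkD, Matrix.add_apply, Matrix.mul_apply, Matrix.map_apply,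
      Matrix.toBlocks₂₁, Matrix.toBlocks₂₂, Matrix.of_apply]
    exact (Differentiable.fun_sum fun k _ => (h' _ _).mul_const _).add (h' _ _)
  exact fun t => ((h.2 t).pow 2).div (hd t) (isUnit_det_den _ _).ne_zero

/-! ### Frames transported by first integrals -/

section Holonomy

/-- The linear form `Ω(u, ·)`. -/
def ΩL {n : ℕ} (u : V n) : V n →L[ℝ] ℝ :=
  LinearMap.toContinuousLinearMap
    { toFun := fun v => Ω u v
      map_add' := fun v w => by
        simp only [Ω, Pi.add_apply, ← Finset.sum_add_distrib]
        exact Finset.sum_congr rfl fun _ _ => by ring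
      map_smul' := fun c v => by
        simp only [Ω, Pi.smul_apply, smul_eq_mul, RingHom.id_apply, Finset.mul_sum]
        exact Finset.sum_congr rfl fun _ _ => by ring }

theorem ΩL_apply {n : ℕ} (u v : V n) : ΩL u v = Ω u v := rfl

theorem eq_of_Ω_eq {n : ℕ} {x y : V n} (h : ∀ z, Ω z x = Ω z y) : x = y := by
  ext (j | j)
  · have := h (Pi.single (.inr j) 1)
    rw [Ω_neg_symm _ x, Ω_neg_symm _ y, Ω_inr, Ω_inr] at this
    exact neg_injective this
  · have := h (Pi.single (.inl j) 1)
    rw [Ω_neg_symm _ x, Ω_neg_symm _ y, Ω_inl, Ω_inl] at this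
    simpa using this

theorem Ω_incl_left {n : ℕ} (z : V n) (w : V (n + 1)) : Ω (incl z) w = Ω z (res w) := by
  rw [Ω_res, res_incl]; simp [incl]

variable {n : ℕ} {M : Set (V (n + 1))} {H : V (n + 1) → ℝ} {E : ℝ}

theorem PUp.mulVec_mem {p : PUp M H E} {w : V (n + 1)} (hw : w ∈ W n) :
    p.a.σ.1 *ᵥ w ∈ tangent H p.pt := by
  rw [← p.map_W]
  exact ⟨w, hw, rfl⟩

/-- A family `F z` of functions, invariant under the time `t` map near a point `s`, whose
Hamiltonian vector fields at `s` and at the image of `s` are the vectors `b₀ z` and `b₁ z`: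
the derivative of the time `t` map preserves the pairing with these vectors. -/
theorem Ω_fderiv_eq {k : ℕ} {φ : V k → V k} {s : V k} {F : V k → ℝ} {b₀ b₁ : V k}
    (hF : ∀ᶠ x in nhds s, F (φ x) = F x) (h0 : HasFDerivAt F (ΩL b₀) s)
    (h1 : HasFDerivAt F (ΩL b₁) (φ s)) (hφ : DifferentiableAt ℝ φ s) (u : V k) :
    Ω b₁ (fderiv ℝ φ s u) = Ω b₀ u := by
  have h2 : HasFDerivAt (F ∘ φ) ((ΩL b₁).comp (fderiv ℝ φ s)) s := h1.comp s hφ.hasFDerivAt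
  have h3 : HasFDerivAt F ((ΩL b₁).comp (fderiv ℝ φ s)) s :=
    h2.congr_of_eventuallyEq (hF.mono fun x hx => hx.symm)
  exact congrArg (fun T : V k →L[ℝ] ℝ => T u) (h3.unique h0)

/-- The element of `Mp^c(V; W)` relating two points of `P^S` in the same fibre. -/
def PUp.diff (b p : PUp M H E) (h : b.pt = p.pt) : MpcW n :=
  ⟨b.a⁻¹ * p.a, by
    change (W n).map (b.a⁻¹ * p.a).σ.1.mulVecLin = W n
    have e : (b.a⁻¹ * p.a).σ = (b.a.σ)⁻¹ * p.a.σ := rfl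
    rw [e, Submonoid.coe_mul, Matrix.mulVecLin_mul, Submodule.map_comp, p.map_W, ← h, ← b.map_W,
      ← Submodule.map_comp, ← Matrix.mulVecLin_mul, ← Submonoid.coe_mul, inv_mul_cancel,
      Submonoid.coe_one, Matrix.mulVecLin_one, Submodule.map_id]⟩

/-- Points of `P_S` can be written with a given representative `b` of the first component. -/
theorem PDown.mk_eq_mk_diff (b p : PUp M H E) (h : b.pt = p.pt) (d : Mpc n) :
    PDown.mk p d = PDown.mk b (νhat (b.diff p h) * d) := by
  refine (Quotient.sound (?_ : ∃ g : MpcW n, _ ∧ _ ∧ _)).symm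
  refine ⟨b.diff p h, h.symm, ?_, rfl⟩
  change p.a = b.a * (b.a⁻¹ * p.a)
  rw [mul_inv_cancel_left]

/-- The matrix entries of `ν` of the frame change from `b` to `p` are pairings of frame vectors. -/
theorem Ω_σ_diff (b p : PUp M H E) (h : b.pt = p.pt) (d : Mpc n) (x z : V n) :
    Ω z ((νhat (b.diff p h) * d).σ.1 *ᵥ x) =
      Ω (b.a.σ.1 *ᵥ incl z) (p.a.σ.1 *ᵥ incl (d.σ.1 *ᵥ x)) := by
  have e1 : (νhat (b.diff p h) * d).σ.1 *ᵥ x = (ν (MpcW.σ (b.diff p h))).1 *ᵥ (d.σ.1 *ᵥ x) := by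
    rw [Matrix.mulVec_mulVec]; rfl
  have e2 : p.a.σ.1 *ᵥ incl (d.σ.1 *ᵥ x) =
      b.a.σ.1 *ᵥ ((MpcW.σ (b.diff p h)).1.1 *ᵥ incl (d.σ.1 *ᵥ x)) := by
    have : p.a.σ = b.a.σ * (MpcW.σ (b.diff p h)).1 := by
      change p.a.σ = b.a.σ * ((b.a.σ)⁻¹ * p.a.σ)
      rw [mul_inv_cancel_left]
    rw [Matrix.mulVec_mulVec, ← Submonoid.coe_mul, ← this]
  rw [e1, e2, Ω_mulVec, Ω_incl_left, ν_mulVec]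

/-- Along an orbit of frames, the flow is automatically differentiable: otherwise the derivative
would be `0`, and the transported frame would not be injective. -/
theorem IsFrameOrbit.differentiableAt [NeZero n] {c : ℝ → RedFrame M H E} (hc : IsFrameOrbit c)
    (t : ℝ) : DifferentiableAt ℝ (flow (hamVec H) M t) (c 0).pt := by
  by_contra hd
  obtain ⟨-, -, h⟩ := hc t
  let x : V n := Pi.single (.inl 0) 1
  obtain ⟨u, hu⟩ := Submodule.Quotient.mk_surjective _ ((c 0).frame x)
  obtain ⟨h1, h2⟩ := h x u hu
  have h3 : (c t).frame x = 0 := by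
    rw [← h2]
    refine (Submodule.Quotient.mk_eq_zero _).2 ?_
    change fderiv ℝ (flow (hamVec H) M t) (c 0).pt u.1 ∈ nullDir H (c t).pt
    rw [fderiv_zero_of_not_differentiableAt hd]
    exact Submodule.zero_mem _
  have h4 : x = 0 := (c t).frame.map_eq_zero_iff.1 h3
  have := congrFun h4 (.inl 0)
  simp [x] at this

/-- A continuous function with constant fourth power is constant. -/
theorem eq_of_pow_four_eq {g : ℝ → ℂ} (hg : Continuous g) {K : ℂ} (hK : K ≠ 0)
    (h : ∀ t, g t ^ 4 = K) (s t : ℝ) : g s = g t := by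
  have hg0 : ∀ t, g t ≠ 0 := fun t h0 => hK (by rw [← h t, h0]; simp)
  have h2 : ∀ s, g s ^ 2 = g t ^ 2 := fun s =>
    (isPreconnected_univ (α := ℝ)).eq_of_sq_eq (f := fun s => g s ^ 2) (g := fun _ => g t ^ 2)
      (hg.pow 2).continuousOn continuousOn_const
      (fun s _ => by simp only [Pi.pow_apply]; rw [← pow_mul, ← pow_mul, h, h])
      (fun {_} _ => pow_ne_zero 2 (hg0 t)) (Set.mem_univ t) rfl (Set.mem_univ s)
  exact (isPreconnected_univ (α := ℝ)).eq_of_sq_eq (f := g) (g := fun _ => g t)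
      hg.continuousOn continuousOn_const (fun s _ => h2 s)
      (fun {_} _ => hg0 t) (Set.mem_univ t) rfl (Set.mem_univ s)

/-! ### Holonomy in terms of a transported frame -/

/-- A family of points of `P^S` over a curve, with values in the metaplectic group, whose frames
`z ↦ b_t z` consist of the Hamiltonian vectors of first integrals `F z`. -/
structure IsIntegralFrame (b : ℝ → PUp M H E) (F : V n → V (n + 1) → ℝ) : Prop where
  continuous : MpcContinuous fun t => (b t).a
  η_eq_one : ∀ t, (b t).a.η = 1
  invariant : ∀ t z x, x ∈ M → F z (flow (hamVec H) M t x) = F z x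
  hasFDerivAt : ∀ t z, HasFDerivAt (F z) (ΩL ((b t).a.σ.1 *ᵥ incl z)) (b t).pt

/-- Relative to an integral frame, an orbit of frames has constant coordinates. -/
theorem IsIntegralFrame.σ_diff [NeZero n] {b : ℝ → PUp M H E} {F : V n → V (n + 1) → ℝ}
    (hb : IsIntegralFrame b F) (hM : IsOpen M) {p : ℝ → PUp M H E} {d : ℝ → Mpc n}
    (hpt : ∀ t, (b t).pt = (p t).pt) (hc : IsFrameOrbit fun t => (p t).toFrame (d t)) (t : ℝ) :
    (νhat ((b t).diff (p t) (hpt t)) * d t).σ = (νhat ((b 0).diff (p 0) (hpt 0)) * d 0).σ := by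
  have hdiff := hc.differentiableAt t
  obtain ⟨-, hpt', h⟩ := hc t
  change DifferentiableAt ℝ (flow (hamVec H) M t) (p 0).pt at hdiff
  change (p t).pt = flow (hamVec H) M t (p 0).pt at hpt'
  apply Subtype.ext
  apply Matrix.ext_of_mulVec_single
  intro i
  apply eq_of_Ω_eq
  intro z
  rw [Ω_σ_diff, Ω_σ_diff]
  set x : V n := Pi.single i 1
  obtain ⟨h1, h2⟩ := h x ((p 0).toTangent ((d 0).σ.1 *ᵥ x)) ((p 0).toFrame_apply (d 0) x).symm
  rw [(p t).toFrame_apply (d t) x] at h2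
  have h3 : fderiv ℝ (flow (hamVec H) M t) (p 0).pt ((p 0).a.σ.1 *ᵥ incl ((d 0).σ.1 *ᵥ x)) -
      (p t).a.σ.1 *ᵥ incl ((d t).σ.1 *ᵥ x) ∈ nullDir H (p t).pt :=
    (Submodule.Quotient.eq ((nullDir H (p t).pt).submoduleOf (tangent H (p t).pt))).1 h2
  have h4 := h3 ((b t).a.σ.1 *ᵥ incl z) (by
    rw [← hpt t]; exact PUp.mulVec_mem (incl_mem z))
  rw [Ω_sub_left, sub_eq_zero, Ω_neg_symm, Ω_neg_symm ((p t).a.σ.1 *ᵥ _), neg_inj] at h4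
  rw [← h4]
  refine Ω_fderiv_eq (F := F z) ?_ ?_ ?_ hdiff _
  · filter_upwards [hM.mem_nhds (p 0).mem.1] with y hy
    exact hb.invariant t z y hy
  · rw [← hpt 0]; exact hb.hasFDerivAt 0 z
  · rw [← hpt', ← hpt t]; exact hb.hasFDerivAt t z

/-- A horizontal lift of an orbit of frames, compared with an integral frame, is given by a curve
in `Mp^c(V_n)` whose phase is the exponential of a primitive `S` of `β` along the curve. -/
theorem IsHorizontalLift.exists_phase [NeZero n] {ħ : ℝ} (hħ : ħ ≠ 0)
    {β : V (n + 1) → V (n + 1) → ℝ} {b : ℝ → PUp M H E} {F : V n → V (n + 1) → ℝ}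
    (hb : IsIntegralFrame b F) (hM : IsOpen M) {c : ℝ → RedFrame M H E}
    (hpt : ∀ t, (c t).pt = (b t).pt) (hc : IsFrameOrbit c)
    {S : ℝ → ℝ} (hS : ∀ t, HasDerivAt S (β (b t).pt (deriv (fun τ => (b τ).pt) t)) t)
    {l : ℝ → PDown M H E} (hl : IsHorizontalLift ħ β c l) :
    ∃ e : ℝ → Mpc n, (∀ t, l t = PDown.mk (b t) (e t)) ∧ (∀ t, (e t).σ = (e 0).σ) ∧
      ∀ t, (e t).f (basePt n) =
        (e 0).f (basePt n) * Complex.exp (Complex.I / ħ * (S t - S 0 : ℝ)) := by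
  obtain ⟨hproj, p, d, hp, ha, hd, hld, hγ⟩ := hl
  have hcp : c = fun t => (p t).toFrame (d t) := by
    funext t; rw [← hproj t, hld t]; rfl
  subst hcp
  have hbp : ∀ t, (b t).pt = (p t).pt := fun t => (hpt t).symm
  set e : ℝ → Mpc n := fun t => νhat ((b t).diff (p t) (hbp t)) * d t with he
  have hσ : ∀ t, (e t).σ = (e 0).σ := fun t => hb.σ_diff hM hbp hc t
  refine ⟨e, fun t => by rw [hld t]; exact PDown.mk_eq_mk_diff _ _ _ _, hσ, ?_⟩
  have hecont : MpcContinuous e := by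
    refine MpcContinuous.mul (MpcContinuous.νhat (a := fun t => (b t).diff (p t) (hbp t)) ?_)
      hd.continuous
    exact hb.continuous.inv.mul ha.continuous
  set s : ℝ → ℂ := fun t => ((p t).a.η : ℂ) * ((d t).η : ℂ) with hs
  -- `η ∘ ν̂ = ± η` makes `η (e t)` agree with `s t` up to a sign only
  have hη : ∀ t, ((e t).η : ℂ) ^ 2 = s t ^ 2 := by
    intro t
    have h1 : (e t).η = sgn (χ (MpcW.σ ((b t).diff (p t) (hbp t)))) *
      ((b t).a.η⁻¹ * (p t).a.η) * (d t).η := rfl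
    have h2 : ∀ x, ((sgn x : Circle) : ℂ) ^ 2 = 1 := by
      intro x; simp only [sgn]; split_ifs <;> simp
    rw [h1, hb.η_eq_one t]
    simp only [Circle.coe_mul, mul_pow, h2, inv_one, one_mul, s]
  have hsd : ∀ t, HasDerivAt s (2 * Complex.I / ħ *
      (β (b t).pt (deriv (fun τ => (b τ).pt) t) : ℝ) * s t) t := by
    intro t
    have h1 := (ha.differentiable_η t).hasDerivAt
    have h2 := (hd.differentiable_η t).hasDerivAt
    have h3 := hγ t
    have hbe : (fun τ => (p τ).pt) = fun τ => (b τ).pt := funext fun τ => (hbp τ).symm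
    refine (h1.mul h2).congr_deriv ?_
    simp only [gammaVal, halfEta, hbe, ← hbp t] at h3
    have ha0 := Circle.coe_ne_zero (p t).a.η
    have hd0 := Circle.coe_ne_zero (d t).η
    have hh : (ħ : ℂ) ≠ 0 := Complex.ofReal_ne_zero.2 hħ
    have hI : 1 / (Complex.I * ħ) = -Complex.I / ħ := by
      have := Complex.I_ne_zero
      field_simp
      rw [Complex.I_sq]; ring
    rw [hI] at h3
    set A := deriv (fun τ => ((p τ).a.η : ℂ)) t
    set D := deriv (fun τ => ((d τ).η : ℂ)) t
    set B := ((β (b t).pt (deriv (fun τ => (b τ).pt) t) : ℝ) : ℂ)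
    have h4 : A / ((p t).a.η : ℂ) + D / ((d t).η : ℂ) = 2 * Complex.I / ħ * B := by
      linear_combination 2 * h3
    rw [← h4]
    simp only [s]
    field_simp
  -- horizontality says that `s` is a multiple of `exp (2 i S / ħ)`
  set G : ℝ → ℂ := fun t => s t * Complex.exp (-(2 * Complex.I / ħ) * (S t : ℝ)) with hG
  have hGd : ∀ t, HasDerivAt G 0 t := by
    intro t
    have h1 : HasDerivAt (fun t => Complex.exp (-(2 * Complex.I / ħ) * (S t : ℝ)))
        (Complex.exp (-(2 * Complex.I / ħ) * (S t : ℝ)) * (-(2 * Complex.I / ħ) *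
          (β (b t).pt (deriv (fun τ => (b τ).pt) t) : ℝ))) t :=
      ((hS t).ofReal_comp.const_mul _).cexp
    refine ((hsd t).mul h1).congr_deriv ?_
    ring
  have hGc : ∀ t, G t = G 0 := fun t =>
    is_const_of_deriv_eq_zero (fun t => (hGd t).differentiableAt) (fun t => (hGd t).deriv) t 0
  -- `f ^ 4` is `η ^ 2` times a constant, since `σ (e t)` is constant; continuity determines `f`
  set g : ℝ → ℂ := fun t => (e t).f (basePt n) * Complex.exp (-(Complex.I / ħ) * (S t : ℝ)) with hg
  have hScont : Continuous S := continuous_iff_continuousAt.2 fun t => (hS t).continuousAt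
  have hgc : Continuous g := by
    have := hecont.f_basePt
    fun_prop
  have hg4 : ∀ t, g t ^ 4 = (G 0 * (den (e 0).σ (basePt n).1).det) ^ 2 := by
    intro t
    rw [← hGc t, ← hσ t]
    have h1 := (e t).sq_f (basePt n)
    have h2 := hη t
    have h3 : Complex.exp (-(2 * Complex.I / ħ) * (S t : ℝ)) =
        Complex.exp (-(Complex.I / ħ) * (S t : ℝ)) ^ 2 := by
      rw [← Complex.exp_nat_mul]; congr 1; push_cast; ring
    simp only [g, G, h3]
    calc _ = ((e t).f (basePt n) ^ 2) ^ 2 *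
        Complex.exp (-(Complex.I / ħ) * (S t : ℝ)) ^ 4 := by ring
      _ = ((e t).η : ℂ) ^ 2 * (den (e t).σ (basePt n).1).det ^ 2 *
        Complex.exp (-(Complex.I / ħ) * (S t : ℝ)) ^ 4 := by rw [h1]; ring
      _ = _ := by rw [h2]; ring
  have hK : (G 0 * (den (e 0).σ (basePt n).1).det) ^ 2 ≠ 0 := by
    rw [← hg4 0]
    exact pow_ne_zero _ (mul_ne_zero (Mpc.f_ne_zero _ _) (Complex.exp_ne_zero _))
  intro t
  have h := eq_of_pow_four_eq hgc hK hg4 t 0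
  simp only [g] at h
  have h5 : Complex.exp (Complex.I / ħ * (S t - S 0 : ℝ)) =
      Complex.exp (Complex.I / ħ * (S t : ℝ)) * Complex.exp (-(Complex.I / ħ) * (S 0 : ℝ)) := by
    rw [← Complex.exp_add]; congr 1; push_cast; ring
  have h6 : Complex.exp (-(Complex.I / ħ) * (S t : ℝ)) * Complex.exp (Complex.I / ħ * (S t : ℝ)) =
      1 := by
    rw [← Complex.exp_add, neg_mul, neg_add_cancel, Complex.exp_zero]
  rw [h5]
  linear_combination (Complex.exp (Complex.I / ħ * (S t : ℝ))) * h - (e t).f (basePt n) * h6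

/-- The scalar `z ∈ U(1)` as an element of `Mp^c(V_n)`. -/
def Mpc.scalar (n : ℕ) (z : Circle) : Mpc n where
  σ := 1
  f _ := z
  η := z ^ 2
  continuous_f := continuous_const
  sq_f Z := by rw [den_one]; simp

/-- Multiplying a frame with values in the metaplectic group by the phase `exp (i S / ħ)` gives a
horizontal lift. -/
theorem isHorizontalLift_scalar {ħ : ℝ} (hħ : ħ ≠ 0) {β : V (n + 1) → V (n + 1) → ℝ}
    {b : ℝ → PUp M H E} (hη : ∀ t, (b t).a.η = 1)
    (hpt : Differentiable ℝ fun t => (b t).pt) (hb : MpcDifferentiable fun t => (b t).a)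
    {S : ℝ → ℝ} (hS : ∀ t, HasDerivAt S (β (b t).pt (deriv (fun τ => (b τ).pt) t)) t) :
    IsHorizontalLift ħ β (fun t => (b t).toFrame 1)
      fun t => PDown.mk (b t) (Mpc.scalar n (Circle.exp (S t / ħ))) := by
  have hexp : ∀ t, HasDerivAt (fun t => ((Circle.exp (S t / ħ) : Circle) : ℂ))
      ((Circle.exp (S t / ħ) : ℂ) *
        ((β (b t).pt (deriv (fun τ => (b τ).pt) t) / ħ : ℝ) * Complex.I)) t := by
    intro t
    simp only [Circle.coe_exp]
    exact (((hS t).div_const ħ).ofReal_comp.mul_const _).cexp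
  refine ⟨fun t => rfl, b, fun t => Mpc.scalar n (Circle.exp (S t / ħ)), hpt, hb, ⟨?_, ?_⟩,
    fun t => rfl, fun t => ?_⟩
  · intro i j
    exact differentiable_const _
  · exact fun t => (hexp t).differentiableAt
  · have h1 : halfEta (fun τ => (b τ).a) t = 0 := by
      simp only [halfEta, hη]; simp
    have h2 : HasDerivAt (fun τ => ((Mpc.scalar n (Circle.exp (S τ / ħ))).η : ℂ)) _ t :=
      ((hexp t).pow 2).congr_of_eventuallyEq (Filter.Eventually.of_forall fun τ => by
        simp [Mpc.scalar])
    have h3 : ((Mpc.scalar n (Circle.exp (S t / ħ))).η : ℂ) = (Circle.exp (S t / ħ) : ℂ) ^ 2 := by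
      simp [Mpc.scalar]
    have h0 := Circle.coe_ne_zero (Circle.exp (S t / ħ))
    have hh : (ħ : ℂ) ≠ 0 := Complex.ofReal_ne_zero.2 hħ
    have hI := Complex.I_ne_zero
    simp only [gammaVal, h1]
    rw [halfEta, h2.deriv, h3]
    push_cast
    field_simp
    rw [Complex.I_sq]; ring

theorem PDown.mk_scalar_inj {p : PUp M H E} {z w : Circle}
    (h : PDown.mk p (Mpc.scalar n z) = PDown.mk p (Mpc.scalar n w)) : z = w := by
  obtain ⟨g, -, h2, h3⟩ := Quotient.exact h
  change p.a = p.a * g.1 at h2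
  change Mpc.scalar n z = νhat g * Mpc.scalar n w at h3
  have hg : g = 1 := Subtype.ext (left_eq_mul.1 h2)
  rw [hg, map_one, one_mul] at h3
  apply Subtype.ext
  exact congrArg (fun a => Mpc.f a (basePt n)) h3

/-- The derivative of the flow transports the classes of an integral frame into each other. -/
theorem IsIntegralFrame.fderiv_sub_mem_nullDir {b : ℝ → PUp M H E} {F : V n → V (n + 1) → ℝ}
    (hb : IsIntegralFrame b F) (hM : IsOpen M) {t : ℝ}
    (hpt : (b t).pt = flow (hamVec H) M t (b 0).pt)
    (hd : DifferentiableAt ℝ (flow (hamVec H) M t) (b 0).pt) {x : V n} {u : V (n + 1)}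
    (hu : u - (b 0).a.σ.1 *ᵥ incl x ∈ nullDir H (b 0).pt)
    (hmem : fderiv ℝ (flow (hamVec H) M t) (b 0).pt u ∈ tangent H (b t).pt) :
    fderiv ℝ (flow (hamVec H) M t) (b 0).pt u - (b t).a.σ.1 *ᵥ incl x ∈ nullDir H (b t).pt := by
  obtain ⟨w, hw, hwv⟩ : fderiv ℝ (flow (hamVec H) M t) (b 0).pt u ∈
      (W n).map (b t).a.σ.1.mulVecLin := by rw [(b t).map_W]; exact hmem
  have hres : res w = x := by
    apply eq_of_Ω_eq
    intro z
    have h2 := Ω_fderiv_eq (F := F z)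
      (Filter.mem_of_superset (hM.mem_nhds (b 0).mem.1) fun y hy => hb.invariant t z y hy)
      (hb.hasFDerivAt 0 z) (by rw [← hpt]; exact hb.hasFDerivAt t z) hd u
    rw [← hwv, Matrix.mulVecLin_apply, Ω_mulVec, Ω_incl_left] at h2
    have h3 := hu ((b 0).a.σ.1 *ᵥ incl z) (PUp.mulVec_mem (incl_mem z))
    rw [Ω_sub_left, sub_eq_zero, Ω_neg_symm, Ω_neg_symm ((b 0).a.σ.1 *ᵥ incl x), neg_inj] at h3
    rw [h2, h3, Ω_mulVec, Ω_incl]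
  have hw' : w - incl x = w (.inl (Fin.last n)) • Pi.single (.inl (Fin.last n)) 1 := by
    rw [← hres]; exact sub_eq_of_eq_add' (mem_W_eq hw)
  rw [← hwv, Matrix.mulVecLin_apply, ← Matrix.mulVec_sub, hw']
  exact (b t).single_mem _

theorem fderiv_mem_tangent {k : ℕ} {φ : V k → V k} {s : V k} {G : V k → ℝ}
    (hG : ∀ᶠ x in nhds s, G (φ x) = G x) (h0 : DifferentiableAt ℝ G s)
    (h1 : DifferentiableAt ℝ G (φ s)) (hφ : DifferentiableAt ℝ φ s) {u : V k}
    (hu : u ∈ tangent G s) : fderiv ℝ φ s u ∈ tangent G (φ s) := by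
  have h : ∀ y, DifferentiableAt ℝ G y → HasFDerivAt G (ΩL (hamVec G y)) y := fun y hy =>
    hy.hasFDerivAt.congr_fderiv (by ext v; exact (Ω_hamVec G _ v).symm)
  change fderiv ℝ G (φ s) _ = 0
  rw [← Ω_hamVec, Ω_fderiv_eq hG (h s h0) (h _ h1) hφ, Ω_hamVec]
  exact hu

theorem PUp.cls_eq_toFrame_one (p : PUp M H E) (x : V n) (v : tangent H p.pt) :
    cls v = (p.toFrame 1).frame x ↔ v.1 - p.a.σ.1 *ᵥ incl x ∈ nullDir H p.pt := by
  have h1 : (1 : Mpc n).σ.1 *ᵥ x = x := by rw [Mpc.σ_one]; simp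
  rw [PUp.toFrame_apply, h1]
  exact Submodule.Quotient.eq ((nullDir H p.pt).submoduleOf (tangent H p.pt))

/-- An integral frame over an orbit of the flow is an orbit of the flow on reduced frames,
provided that the flow is differentiable. -/
theorem IsIntegralFrame.isFrameOrbit {b : ℝ → PUp M H E} {F : V n → V (n + 1) → ℝ}
    (hb : IsIntegralFrame b F) (hM : IsOpen M)
    (hdef : ∀ t, FlowDefined (hamVec H) M t (b 0).pt)
    (hpt : ∀ t, (b t).pt = flow (hamVec H) M t (b 0).pt)
    (hH : ∀ t x, x ∈ M → H (flow (hamVec H) M t x) = H x)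
    (hHd : ∀ t, DifferentiableAt ℝ H (b t).pt)
    (hd : ∀ t, DifferentiableAt ℝ (flow (hamVec H) M t) (b 0).pt) :
    IsFrameOrbit fun t => (b t).toFrame 1 := by
  intro t
  refine ⟨hdef t, hpt t, fun x u hu => ?_⟩
  have hu' := ((b 0).cls_eq_toFrame_one x u).1 hu
  have hmem : fderiv ℝ (flow (hamVec H) M t) (b 0).pt u.1 ∈ tangent H (b t).pt := by
    rw [hpt t]
    exact fderiv_mem_tangent
      (Filter.mem_of_superset (hM.mem_nhds (b 0).mem.1) fun y hy => hH t y hy) (hHd 0)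
      (by rw [← hpt t]; exact hHd t) (hd t) u.2
  exact ⟨hmem, ((b t).cls_eq_toFrame_one x ⟨_, hmem⟩).2
    (hb.fderiv_sub_mem_nullDir hM (hpt t) (hd t) hu' hmem)⟩

end Holonomy

/-! ### Flows of locally Lipschitz vector fields -/

section Flow

variable {n : ℕ} {X : V n → V n} {M : Set (V n)}

theorem IsIntegralFrom.mono {t s : ℝ} {x : V n} {c : ℝ → V n} (h : IsIntegralFrom X M t x c)
    (hs : s ∈ Set.uIcc 0 t) : IsIntegralFrom X M s x c := by
  have hsub : Set.uIcc 0 s ⊆ Set.uIcc 0 t := Set.uIcc_subset_uIcc_left hs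
  exact ⟨h.1, fun τ hτ => ⟨(h.2 τ (hsub hτ)).1, (h.2 τ (hsub hτ)).2.mono hsub⟩⟩

/-- Integral curves of a locally Lipschitz vector field are unique. -/
theorem IsIntegralFrom.unique (hX : LocallyLipschitzOn M X) {t : ℝ} {x : V n} {c d : ℝ → V n}
    (hc : IsIntegralFrom X M t x c) (hd : IsIntegralFrom X M t x d) : c t = d t := by
  obtain ⟨hc0, hc⟩ := hc
  obtain ⟨hd0, hd⟩ := hd
  have hcc : ContinuousOn c (Set.uIcc 0 t) := fun s hs => (hc s hs).2.continuousWithinAt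
  have hdc : ContinuousOn d (Set.uIcc 0 t) := fun s hs => (hd s hs).2.continuousWithinAt
  obtain ⟨K, hK⟩ : ∃ K, K = c '' Set.uIcc 0 t ∪ d '' Set.uIcc 0 t := ⟨_, rfl⟩
  have hKc : IsCompact K := hK ▸
    (isCompact_uIcc.image_of_continuousOn hcc).union (isCompact_uIcc.image_of_continuousOn hdc)
  have hKM : K ⊆ M := by
    rw [hK]
    rintro _ (⟨s, hs, rfl⟩ | ⟨s, hs, rfl⟩)
    · exact (hc s hs).1
    · exact (hd s hs).1
  obtain ⟨L, hL⟩ := LocallyLipschitzOn.exists_lipschitzOnWith_of_compact hKc (hX.mono hKM)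
  rcases le_total 0 t with ht | ht
  · rw [Set.uIcc_of_le ht] at hc hd hcc hdc hK
    have h := ODE_solution_unique_of_mem_Icc_right (v := fun _ => X) (s := fun _ => K) (K := L)
      (a := 0) (b := t) (fun _ _ => hL) hcc
      (fun s hs => (hc s ⟨hs.1, hs.2.le⟩).2.mono_of_mem_nhdsWithin
        (Icc_mem_nhdsGE_of_mem hs))
      (fun s hs => hK ▸ Or.inl ⟨s, ⟨hs.1, hs.2.le⟩, rfl⟩) hdc
      (fun s hs => (hd s ⟨hs.1, hs.2.le⟩).2.mono_of_mem_nhdsWithin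
        (Icc_mem_nhdsGE_of_mem hs))
      (fun s hs => hK ▸ Or.inr ⟨s, ⟨hs.1, hs.2.le⟩, rfl⟩) (hc0.trans hd0.symm)
    exact h ⟨ht, le_rfl⟩
  · rw [Set.uIcc_of_ge ht] at hc hd hcc hdc hK
    have h := ODE_solution_unique_of_mem_Icc_left (v := fun _ => X) (s := fun _ => K) (K := L)
      (a := t) (b := 0) (fun _ _ => hL) hcc
      (fun s hs => (hc s ⟨hs.1.le, hs.2⟩).2.mono_of_mem_nhdsWithin
        (Icc_mem_nhdsLE_of_mem hs))
      (fun s hs => hK ▸ Or.inl ⟨s, ⟨hs.1.le, hs.2⟩, rfl⟩) hdc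
      (fun s hs => (hd s ⟨hs.1.le, hs.2⟩).2.mono_of_mem_nhdsWithin
        (Icc_mem_nhdsLE_of_mem hs))
      (fun s hs => hK ▸ Or.inr ⟨s, ⟨hs.1.le, hs.2⟩, rfl⟩) (hc0.trans hd0.symm)
    exact h ⟨le_rfl, ht⟩

theorem flow_eq (hX : LocallyLipschitzOn M X) {t : ℝ} {x : V n} {c : ℝ → V n}
    (hc : IsIntegralFrom X M t x c) : flow X M t x = c t := by
  have h : FlowDefined X M t x := ⟨c, hc⟩
  rw [flow, dif_pos h]
  exact h.choose_spec.unique hX hc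

/-- A flow line defined for all times is an integral curve. -/
theorem hasDerivAt_flow (hX : LocallyLipschitzOn M X) {x : V n} (h : ∀ t, FlowDefined X M t x)
    (t : ℝ) : flow X M t x ∈ M ∧ HasDerivAt (fun s => flow X M s x) (X (flow X M t x)) t := by
  obtain ⟨c, hc⟩ := h (if 0 ≤ t then t + 1 else t - 1)
  have e : ∀ s ∈ Set.uIcc 0 (if 0 ≤ t then t + 1 else t - 1), flow X M s x = c s :=
    fun s hs => flow_eq hX (hc.mono hs)
  by_cases h0 : t = 0
  · -- at time `0`, glue a curve defined for positive times and one defined for negative times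
    subst h0
    obtain ⟨c₁, hc₁⟩ := h 1
    obtain ⟨c₂, hc₂⟩ := h (-1)
    have e₁ : ∀ s ∈ Set.Icc (0 : ℝ) 1, flow X M s x = c₁ s := fun s hs =>
      flow_eq hX (hc₁.mono (by rwa [Set.uIcc_of_le zero_le_one]))
    have e₂ : ∀ s ∈ Set.Icc (-1 : ℝ) 0, flow X M s x = c₂ s := fun s hs =>
      flow_eq hX (hc₂.mono (by rwa [Set.uIcc_of_ge (by norm_num)]))
    have i₁ := hc₁.2 0 Set.left_mem_uIcc
    have i₂ := hc₂.2 0 Set.left_mem_uIcc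
    rw [Set.uIcc_of_le zero_le_one] at i₁
    rw [Set.uIcc_of_ge (by norm_num)] at i₂
    have f₁ := e₁ 0 ⟨le_rfl, zero_le_one⟩
    have f₂ := e₂ 0 ⟨by norm_num, le_rfl⟩
    refine ⟨f₁ ▸ i₁.1, ?_⟩
    have d₁ : HasDerivWithinAt (fun s => flow X M s x) (X (flow X M 0 x)) (Set.Ici 0) 0 := by
      rw [f₁]
      exact (i₁.2.congr e₁ f₁).mono_of_mem_nhdsWithin (Icc_mem_nhdsGE zero_lt_one)
    have d₂ : HasDerivWithinAt (fun s => flow X M s x) (X (flow X M 0 x)) (Set.Iic 0) 0 := by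
      rw [f₂]
      exact (i₂.2.congr e₂ f₂).mono_of_mem_nhdsWithin (Icc_mem_nhdsLE (by norm_num))
    have := d₂.union d₁
    rwa [Set.Iic_union_Ici, hasDerivWithinAt_univ] at this
  · have hnhds : Set.uIcc 0 (if 0 ≤ t then t + 1 else t - 1) ∈ nhds t := by
      split_ifs with ht
      · have : 0 < t := lt_of_le_of_ne ht (Ne.symm h0)
        rw [Set.uIcc_of_le (by linarith)]
        exact Icc_mem_nhds this (by linarith)
      · rw [not_le] at ht
        rw [Set.uIcc_of_ge (by linarith)]
        exact Icc_mem_nhds (by linarith) ht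
    have i := hc.2 t (mem_of_mem_nhds hnhds)
    have et := e t (mem_of_mem_nhds hnhds)
    rw [et]
    exact ⟨i.1, (i.2.hasDerivAt hnhds).congr_of_eventuallyEq
      (Filter.mem_of_superset hnhds fun s hs => e s hs)⟩

theorem IsIntegralFrom.of_hasDerivAt {x : V n} {c : ℝ → V n} (h0 : c 0 = x)
    (h : ∀ t, c t ∈ M ∧ HasDerivAt c (X (c t)) t) (t : ℝ) : IsIntegralFrom X M t x c :=
  ⟨h0, fun s _ => ⟨(h s).1, (h s).2.hasDerivWithinAt⟩⟩

theorem eq_of_hasDerivWithinAt_zero {g : ℝ → ℝ} {t : ℝ}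
    (hg : ∀ s ∈ Set.uIcc 0 t, HasDerivWithinAt g 0 (Set.uIcc 0 t) s) : g t = g 0 := by
  rcases eq_or_ne t 0 with rfl | h0
  · rfl
  refine (convex_uIcc 0 t).is_const_of_fderivWithin_eq_zero (𝕜 := ℝ)
    (fun s hs => (hg s hs).differentiableWithinAt) (fun s hs => ?_) Set.right_mem_uIcc
    Set.left_mem_uIcc
  have hu : UniqueDiffWithinAt ℝ (Set.uIcc 0 t) s :=
    uniqueDiffOn_Icc (by rcases lt_or_gt_of_ne h0 with h | h <;> simp [h]) s hs
  refine ((hg s hs).hasFDerivWithinAt.fderivWithin hu).trans ?_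
  ext; simp

/-- A function whose derivative vanishes on the vector field is constant along the flow. -/
theorem flow_invariant {F : V n → ℝ} {DF : V n → V n →L[ℝ] ℝ}
    (hF : ∀ x ∈ M, HasFDerivAt F (DF x) x) (h0 : ∀ x ∈ M, DF x (X x) = 0) (t : ℝ) (x : V n) :
    F (flow X M t x) = F x := by
  by_cases h : FlowDefined X M t x
  · rw [flow, dif_pos h]
    obtain ⟨hc0, hc⟩ := h.choose_spec
    have := eq_of_hasDerivWithinAt_zero (g := F ∘ h.choose) (t := t) fun s hs => by
      have := (hF _ (hc s hs).1).comp_hasDerivWithinAt s (hc s hs).2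
      rwa [h0 _ (hc s hs).1] at this
    rw [Function.comp_apply, Function.comp_apply, hc0] at this
    exact this
  · rw [flow, dif_neg h]

end Flow

/-! ### First integrals of the Kepler problem -/

/-- The distance `|q|`. -/
def rad (m : V 3) : ℝ := Real.sqrt (∑ j, m (.inl j) ^ 2)

/-- The scalar product `q · p`. -/
def dotqp (m : V 3) : ℝ := ∑ j, m (.inl j) * m (.inr j)

/-- The squared momentum `|p|²`. -/
def psq (m : V 3) : ℝ := ∑ j, m (.inr j) ^ 2

/-- The component `q_i p_j - q_j p_i` of the angular momentum. -/
def ang (i j : Fin 3) (m : V 3) : ℝ := m (.inl i) * m (.inr j) - m (.inl j) * m (.inr i)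

/-- The components of the eccentricity vector `(|p|² q - (q · p) p) / (mₑ k) - q / |q|`, which is
the Laplace–Runge–Lenz vector divided by `mₑ k`. -/
def ecc (mₑ k : ℝ) (j : Fin 3) (m : V 3) : ℝ :=
  (psq m * m (.inl j) - dotqp m * m (.inr j)) / (mₑ * k) - m (.inl j) / rad m

/-- The Kepler vector field. -/
def kepVec (mₑ k : ℝ) (m : V 3) : V 3 :=
  Sum.elim (fun j => m (.inr j) / mₑ) (fun j => -(k * m (.inl j) / rad m ^ 3))

/-- The Hamiltonian vector field of `ang i j`. -/
def angVec (i j : Fin 3) (m : V 3) : V 3 :=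
  Sum.elim (m (.inl i) • Pi.single j 1 - m (.inl j) • Pi.single i 1)
    (m (.inr i) • Pi.single j 1 - m (.inr j) • Pi.single i 1)

/-- The Hamiltonian vector field of `ecc mₑ k j`. -/
def eccVec (mₑ k : ℝ) (j : Fin 3) (m : V 3) : V 3 :=
  Sum.elim
    (fun i => (2 * m (.inr i) * m (.inl j) - m (.inl i) * m (.inr j) -
      dotqp m * (Pi.single j 1 : Fin 3 → ℝ) i) / (mₑ * k))
    (fun i => -(psq m * (Pi.single j 1 : Fin 3 → ℝ) i - m (.inr i) * m (.inr j)) / (mₑ * k) +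
      (Pi.single j 1 : Fin 3 → ℝ) i / rad m - m (.inl j) * m (.inl i) / rad m ^ 3)

theorem rad_sq (m : V 3) : rad m ^ 2 = ∑ j, m (.inl j) ^ 2 :=
  Real.sq_sqrt (Finset.sum_nonneg fun _ _ => sq_nonneg _)

theorem rad_pos {m : V 3} (hm : m ∈ hydrogenSpace) : 0 < rad m := by
  obtain ⟨j, hj⟩ := hm
  refine Real.sqrt_pos.2 (Finset.sum_pos' (fun _ _ => sq_nonneg _) ⟨j, Finset.mem_univ _, ?_⟩)
  positivity

theorem mem_hydrogenSpace_of_rad {m : V 3} (hm : 0 < rad m) : m ∈ hydrogenSpace := by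
  by_contra h
  have h' : ∀ j, m (.inl j) = 0 := by simpa [hydrogenSpace] using h
  simp [rad, h'] at hm

theorem isOpen_hydrogenSpace : IsOpen hydrogenSpace := by
  have : hydrogenSpace = ⋃ j, {m : V 3 | m (.inl j) ≠ 0} := by ext m; simp [hydrogenSpace]
  rw [this]
  exact isOpen_iUnion fun j => isOpen_ne_fun (continuous_apply _) continuous_const

theorem hasFDerivAt_coord (i : Fin 3 ⊕ Fin 3) (m : V 3) :
    HasFDerivAt (fun x : V 3 => x i) (ContinuousLinearMap.proj (R := ℝ) (φ := fun _ => ℝ) i) m :=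
  hasFDerivAt_apply i m

theorem hasFDerivAt_rad {m : V 3} (hm : m ∈ hydrogenSpace) :
    HasFDerivAt rad (ΩL (Sum.elim 0 fun j => -(m (.inl j) / rad m))) m := by
  have hr := rad_pos hm
  have h := (HasFDerivAt.fun_sum (u := Finset.univ) fun j _ =>
    HasFDerivAt.pow (hasFDerivAt_coord (.inl j) m) 2).sqrt
    (by rw [← rad_sq]; positivity : ∑ j, m (.inl j) ^ 2 ≠ 0)
  refine h.congr_fderiv (ContinuousLinearMap.ext fun v => ?_)
  change _ = Ω _ _
  simp [Ω, Fin.sum_univ_three]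
  have e : Real.sqrt (m (.inl 0) ^ 2 + m (.inl 1) ^ 2 + m (.inl 2) ^ 2) = rad m := by
    simp [rad, Fin.sum_univ_three]
  rw [e]
  field_simp

theorem hasFDerivAt_hydrogenH (mₑ k : ℝ) {m : V 3} (hm : m ∈ hydrogenSpace) :
    HasFDerivAt (hydrogenH mₑ k) (ΩL (kepVec mₑ k m)) m := by
  have hr := rad_pos hm
  have h := ((HasFDerivAt.fun_sum (u := Finset.univ) fun j _ =>
    HasFDerivAt.pow (hasFDerivAt_coord (.inr j) m) 2).const_mul (1 / (2 * mₑ))).sub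
    (((hasDerivAt_inv hr.ne').comp_hasFDerivAt m (hasFDerivAt_rad hm)).const_mul k)
  refine HasFDerivAt.congr_fderiv (f := hydrogenH mₑ k) h (ContinuousLinearMap.ext fun v => ?_)
  simp [ΩL_apply, Ω, Fin.sum_univ_three, kepVec]
  field_simp
  ring

theorem hasFDerivAt_ang (i j : Fin 3) (m : V 3) : HasFDerivAt (ang i j) (ΩL (angVec i j m)) m := by
  have h := ((hasFDerivAt_coord (.inl i) m).mul (hasFDerivAt_coord (.inr j) m)).sub
    ((hasFDerivAt_coord (.inl j) m).mul (hasFDerivAt_coord (.inr i) m))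
  refine HasFDerivAt.congr_fderiv (f := ang i j) h (ContinuousLinearMap.ext fun v => ?_)
  fin_cases i <;> fin_cases j <;> simp [ΩL_apply, Ω, Fin.sum_univ_three, angVec] <;> ring

theorem hasFDerivAt_psq (m : V 3) :
    HasFDerivAt psq (ΩL (Sum.elim (fun j => 2 * m (.inr j)) 0)) m := by
  have h := (HasFDerivAt.fun_sum (u := Finset.univ) fun j _ =>
    HasFDerivAt.pow (hasFDerivAt_coord (.inr j) m) 2)
  refine HasFDerivAt.congr_fderiv (f := psq) h (ContinuousLinearMap.ext fun v => ?_)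
  simp [ΩL_apply, Ω, Fin.sum_univ_three]

theorem hasFDerivAt_dotqp (m : V 3) :
    HasFDerivAt dotqp (ΩL (Sum.elim (fun j => m (.inl j)) fun j => -m (.inr j))) m := by
  have h := (HasFDerivAt.fun_sum (u := Finset.univ) fun j _ =>
    (hasFDerivAt_coord (.inl j) m).mul (hasFDerivAt_coord (.inr j) m))
  refine HasFDerivAt.congr_fderiv (f := dotqp) h (ContinuousLinearMap.ext fun v => ?_)
  simp [ΩL_apply, Ω, Fin.sum_univ_three]

theorem hasFDerivAt_ecc (mₑ k : ℝ) (j : Fin 3) {m : V 3} (hm : m ∈ hydrogenSpace) :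
    HasFDerivAt (ecc mₑ k j) (ΩL (eccVec mₑ k j m)) m := by
  have hr := rad_pos hm
  have h := (((((hasFDerivAt_psq m).mul (hasFDerivAt_coord (.inl j) m)).sub
    ((hasFDerivAt_dotqp m).mul (hasFDerivAt_coord (.inr j) m)))).mul_const (mₑ * k)⁻¹).sub
    ((hasFDerivAt_coord (.inl j) m).mul
      ((hasDerivAt_inv hr.ne').comp_hasFDerivAt m (hasFDerivAt_rad hm)))
  refine HasFDerivAt.congr_fderiv (f := ecc mₑ k j) h (ContinuousLinearMap.ext fun v => ?_)
  fin_cases j <;> simp [ΩL_apply, Ω, Fin.sum_univ_three, eccVec] <;> field_simp <;> ring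

theorem Ω_angVec_kepVec (mₑ k : ℝ) (i j : Fin 3) (m : V 3) :
    Ω (angVec i j m) (kepVec mₑ k m) = 0 := by
  fin_cases i <;> fin_cases j <;> simp [Ω, Fin.sum_univ_three, angVec, kepVec] <;> ring

theorem Ω_eccVec_kepVec {mₑ k : ℝ} (hm : mₑ ≠ 0) (hk : k ≠ 0) (j : Fin 3) {m : V 3}
    (hx : m ∈ hydrogenSpace) : Ω (eccVec mₑ k j m) (kepVec mₑ k m) = 0 := by
  have hr := rad_pos hx
  have h2 := rad_sq m
  simp only [Fin.sum_univ_three] at h2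
  set r := rad m with hr'
  have key : ∀ j, Ω (eccVec mₑ k j m) (kepVec mₑ k m) =
      (m (.inr j) / mₑ) * ((m (.inl 0) ^ 2 + m (.inl 1) ^ 2 + m (.inl 2) ^ 2) / r ^ 3 - 1 / r) := by
    intro j
    fin_cases j <;>
      simp [Ω, Fin.sum_univ_three, eccVec, kepVec, dotqp, psq, ← hr'] <;> field_simp <;> ring
  rw [key, ← h2]
  field_simp
  ring

/-! ### Orbits of the Kepler problem -/

theorem eq_of_ΩL_eq {n : ℕ} {u v : V n} (h : ΩL u = ΩL v) : u = v :=
  eq_of_Ω_eq fun z => by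
    rw [Ω_neg_symm, Ω_neg_symm z, ← ΩL_apply, ← ΩL_apply, h]

theorem hamVec_eq_of_hasFDerivAt {n : ℕ} {F : V n → ℝ} {u m : V n}
    (h : HasFDerivAt F (ΩL u) m) : hamVec F m = u := by
  apply eq_of_ΩL_eq
  refine ContinuousLinearMap.ext fun v => ?_
  rw [ΩL_apply, Ω_hamVec, h.fderiv]

theorem hamVec_hydrogenH (mₑ k : ℝ) {m : V 3} (hm : m ∈ hydrogenSpace) :
    hamVec (hydrogenH mₑ k) m = kepVec mₑ k m :=
  hamVec_eq_of_hasFDerivAt (hasFDerivAt_hydrogenH mₑ k hm)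

theorem fderiv_hydrogenH_ne_zero (mₑ : ℝ) {k : ℝ} (hk : k ≠ 0) {m : V 3} (hm : m ∈ hydrogenSpace) :
    fderiv ℝ (hydrogenH mₑ k) m ≠ 0 := by
  intro h
  have hr := rad_pos hm
  obtain ⟨j, hj⟩ := hm
  have h1 := congrFun (hamVec_hydrogenH mₑ k ⟨j, hj⟩) (.inr j)
  simp only [hamVec, h, kepVec, Sum.elim_inr, zero_apply, neg_zero] at h1
  have : k * m (.inl j) / rad m ^ 3 ≠ 0 := by positivity
  exact this (by linarith)

theorem contDiffAt_rad {m : V 3} (hm : m ∈ hydrogenSpace) : ContDiffAt ℝ 1 rad m := by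
  have h : ∑ j, m (.inl j) ^ 2 ≠ 0 := by
    rw [← rad_sq]; exact pow_ne_zero _ (rad_pos hm).ne'
  exact ContDiffAt.sqrt (by fun_prop) h

theorem contDiffAt_kepVec (mₑ k : ℝ) {m : V 3} (hm : m ∈ hydrogenSpace) :
    ContDiffAt ℝ 1 (kepVec mₑ k) m := by
  have hr := contDiffAt_rad hm
  have hr0 := (rad_pos hm).ne'
  refine contDiffAt_pi.2 fun i => ?_
  rcases i with j | j
  · simp only [kepVec, Sum.elim_inl]
    fun_prop
  · simp only [kepVec, Sum.elim_inr]
    exact ((contDiffAt_const.mul (by fun_prop)).div (hr.pow 3) (pow_ne_zero _ hr0)).neg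

theorem locallyLipschitzOn_hamVec (mₑ k : ℝ) :
    LocallyLipschitzOn hydrogenSpace (hamVec (hydrogenH mₑ k)) := by
  intro x hx
  obtain ⟨K, t, ht, hK⟩ := (contDiffAt_kepVec mₑ k hx).exists_lipschitzOnWith
  refine ⟨K, t ∩ hydrogenSpace, Filter.inter_mem (mem_nhdsWithin_of_mem_nhds ht)
    self_mem_nhdsWithin, fun y hy z hz => ?_⟩
  rw [hamVec_hydrogenH mₑ k hy.2, hamVec_hydrogenH mₑ k hz.2]
  exact hK hy.1 hz.1

section Invariants

variable {mₑ k : ℝ} (t : ℝ) (x : V 3)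

theorem hydrogenH_flow : hydrogenH mₑ k (flow (hamVec (hydrogenH mₑ k)) hydrogenSpace t x) =
    hydrogenH mₑ k x :=
  flow_invariant (fun _ hy => hasFDerivAt_hydrogenH mₑ k hy)
    (fun y hy => by
      rw [hamVec_hydrogenH mₑ k hy, ΩL_apply]
      linarith [Ω_neg_symm (kepVec mₑ k y) (kepVec mₑ k y)]) t x

theorem ang_flow (i j : Fin 3) : ang i j (flow (hamVec (hydrogenH mₑ k)) hydrogenSpace t x) =
    ang i j x :=
  flow_invariant (fun y _ => hasFDerivAt_ang i j y)
    (fun y hy => by rw [hamVec_hydrogenH mₑ k hy, ΩL_apply, Ω_angVec_kepVec]) t x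

end Invariants

/-- A solution of the Kepler problem that is defined for all times. -/
def IsKeplerOrbit (mₑ k : ℝ) (m : ℝ → V 3) : Prop :=
  ∀ t, m t ∈ hydrogenSpace ∧ HasDerivAt m (kepVec mₑ k (m t)) t

theorem isKeplerOrbit_flow {mₑ k : ℝ} {x : V 3}
    (h : ∀ t, FlowDefined (hamVec (hydrogenH mₑ k)) hydrogenSpace t x) :
    IsKeplerOrbit mₑ k fun t => flow (hamVec (hydrogenH mₑ k)) hydrogenSpace t x := by
  intro t
  obtain ⟨h1, h2⟩ := hasDerivAt_flow (locallyLipschitzOn_hamVec mₑ k) h t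
  exact ⟨h1, by rwa [hamVec_hydrogenH mₑ k h1] at h2⟩

theorem Ω_dotqp_kepVec (mₑ k : ℝ) {m : V 3} (hm : m ∈ hydrogenSpace) :
    Ω (Sum.elim (fun j => m (.inl j)) fun j => -m (.inr j)) (kepVec mₑ k m) =
      psq m / mₑ - k / rad m := by
  have hr := rad_pos hm
  have h2 := rad_sq m
  have h3 : k / rad m = k * rad m ^ 2 / rad m ^ 3 := by field_simp
  rw [h3, h2]
  simp [Ω, Fin.sum_univ_three, kepVec, psq]
  ring

theorem Ω_rad_kepVec (mₑ k : ℝ) {m : V 3} (hm : m ∈ hydrogenSpace) :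
    Ω (Sum.elim 0 fun j => -(m (.inl j) / rad m)) (kepVec mₑ k m) =
      dotqp m / (mₑ * rad m) := by
  have hr := rad_pos hm
  simp [Ω, Fin.sum_univ_three, kepVec, dotqp]
  field_simp

/-- For `E ≥ 0`, the virial `q · p` increases strictly along every orbit: its derivative is
`2 E + k / |q|`. -/
theorem dotqp_lt {mₑ k E : ℝ} (hm : 0 < mₑ) (hk : 0 < k) (hE : 0 ≤ E) {s : V 3}
    (hs : s ∈ level hydrogenSpace (hydrogenH mₑ k) E) {T : ℝ} (hT : 0 < T)
    (h : FlowDefined (hamVec (hydrogenH mₑ k)) hydrogenSpace T s) :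
    dotqp s < dotqp (flow (hamVec (hydrogenH mₑ k)) hydrogenSpace T s) := by
  obtain ⟨c, hc⟩ := h
  have hc' := hc.2
  rw [flow_eq (locallyLipschitzOn_hamVec mₑ k) hc]
  rw [Set.uIcc_of_le hT.le] at hc'
  have hmono : StrictMonoOn (dotqp ∘ c) (Set.Icc 0 T) := by
    refine strictMonoOn_of_deriv_pos (convex_Icc 0 T) (fun t ht => ?_) (fun t ht => ?_)
    · exact ((hasFDerivAt_dotqp _).continuousAt.comp_continuousWithinAt
        (hc' t ht).2.continuousWithinAt)
    · rw [interior_Icc] at ht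
      have ht' : t ∈ Set.Icc 0 T := ⟨ht.1.le, ht.2.le⟩
      obtain ⟨h1, h2⟩ := hc' t ht'
      have h3 := (hasFDerivAt_dotqp (c t)).comp_hasDerivAt t
        (h2.hasDerivAt (Icc_mem_nhds ht.1 ht.2))
      rw [h3.deriv, ΩL_apply, hamVec_hydrogenH mₑ k h1, Ω_dotqp_kepVec mₑ k h1]
      have hr := rad_pos h1
      have hH : hydrogenH mₑ k (c t) = E := by
        rw [← hs.2, ← hydrogenH_flow t s (mₑ := mₑ) (k := k),
          flow_eq (locallyLipschitzOn_hamVec mₑ k)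
            (hc.mono (by rw [Set.uIcc_of_le hT.le]; exact ht'))]
      have hH' : 1 / (2 * mₑ) * psq (c t) - k / rad (c t) = E := hH
      have : psq (c t) / mₑ = 2 * (1 / (2 * mₑ) * psq (c t)) := by field_simp
      have hp : 0 < k / rad (c t) := by positivity
      rw [this]
      linarith
  have := hmono (Set.left_mem_Icc.2 hT.le) (Set.right_mem_Icc.2 hT.le) hT
  simpa [hc.1] using this

theorem psq_mul_rad_sq (m : V 3) :
    psq m * rad m ^ 2 = dotqp m ^ 2 + (ang 0 1 m ^ 2 + ang 1 2 m ^ 2 + ang 2 0 m ^ 2) := by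
  rw [rad_sq]
  simp [psq, dotqp, ang, Fin.sum_univ_three]
  ring

namespace IsKeplerOrbit

variable {mₑ k : ℝ} {m : ℝ → V 3} (h : IsKeplerOrbit mₑ k m)
include h

theorem continuous : Continuous m :=
  continuous_iff_continuousAt.2 fun t => (h t).2.continuousAt

theorem rad_pos (t : ℝ) : 0 < rad (m t) := MpcQuant.rad_pos (h t).1

theorem hasDerivAt_inl (j : Fin 3) (t : ℝ) :
    HasDerivAt (fun t => m t (.inl j)) (m t (.inr j) / mₑ) t :=
  hasDerivAt_pi.1 (h t).2 (.inl j)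

theorem hasDerivAt_inr (j : Fin 3) (t : ℝ) :
    HasDerivAt (fun t => m t (.inr j)) (-(k * m t (.inl j) / rad (m t) ^ 3)) t :=
  hasDerivAt_pi.1 (h t).2 (.inr j)

theorem hasDerivAt_rad (t : ℝ) :
    HasDerivAt (fun t => rad (m t)) (dotqp (m t) / (mₑ * rad (m t))) t := by
  have := (hasFDerivAt_rad (h t).1).comp_hasDerivAt t (h t).2
  rwa [ΩL_apply, Ω_rad_kepVec mₑ k (h t).1] at this

theorem hasDerivAt_dotqp (t : ℝ) :
    HasDerivAt (fun t => dotqp (m t)) (psq (m t) / mₑ - k / rad (m t)) t := by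
  have := (hasFDerivAt_dotqp (m t)).comp_hasDerivAt t (h t).2
  rwa [ΩL_apply, Ω_dotqp_kepVec mₑ k (h t).1] at this

theorem continuous_rad : Continuous fun t => rad (m t) :=
  continuous_iff_continuousAt.2 fun t => (h.hasDerivAt_rad t).continuousAt

theorem eq_flow (t : ℝ) : m t = flow (hamVec (hydrogenH mₑ k)) hydrogenSpace t (m 0) :=
  (flow_eq (locallyLipschitzOn_hamVec mₑ k) (IsIntegralFrom.of_hasDerivAt rfl (fun s => by
    rw [hamVec_hydrogenH mₑ k (h s).1]; exact h s) t)).symm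

theorem hydrogenH_eq (t : ℝ) : hydrogenH mₑ k (m t) = hydrogenH mₑ k (m 0) := by
  rw [h.eq_flow t, hydrogenH_flow]

theorem ang_eq (i j : Fin 3) (t : ℝ) : ang i j (m t) = ang i j (m 0) := by
  rw [h.eq_flow t, ang_flow]

/-- An orbit without angular momentum is not periodic: its radial momentum `q · p / |q|` decreases
strictly. -/
theorem exists_ang_ne_zero (hk : 0 < k) {T : ℝ} (hT : 0 < T) (hper : m T = m 0) :
    ¬ (ang 0 1 (m 0) = 0 ∧ ang 1 2 (m 0) = 0 ∧ ang 2 0 (m 0) = 0) := by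
  rintro ⟨h1, h2, h3⟩
  have hd : ∀ t, HasDerivAt (fun t => dotqp (m t) / rad (m t)) (-(k / rad (m t) ^ 2)) t := by
    intro t
    have hr := h.rad_pos t
    refine ((h.hasDerivAt_dotqp t).div (h.hasDerivAt_rad t) hr.ne').congr_deriv ?_
    have e := psq_mul_rad_sq (m t)
    rw [h.ang_eq 0 1, h.ang_eq 1 2, h.ang_eq 2 0, h1, h2, h3] at e
    have e' : psq (m t) = dotqp (m t) ^ 2 / rad (m t) ^ 2 := by
      rw [eq_div_iff (by positivity), e]; ring
    rw [e']
    by_cases hm : mₑ = 0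
    · subst hm; simp; field_simp
    · field_simp
      ring
  have hanti : StrictAnti fun t => dotqp (m t) / rad (m t) :=
    strictAnti_of_deriv_neg fun t => by
      have := h.rad_pos t
      rw [(hd t).deriv]
      exact neg_neg_of_pos (by positivity)
  have := hanti hT
  simp only [hper] at this
  exact lt_irrefl _ this

end IsKeplerOrbit

/-! ### The eccentric anomaly and the action -/

/-- The vector `q / |q| - (q · p) p / (mₑ k)`; `a` times it is the position relative to the centre
of the Kepler ellipse of semi-major axis `a`. -/
def ctr (mₑ k : ℝ) (m : V 3) (j : Fin 3) : ℝ :=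
  m (.inl j) / rad m - dotqp m * m (.inr j) / (mₑ * k)

namespace IsKeplerOrbit

variable {mₑ k a κ : ℝ} {m : ℝ → V 3}

/-- The energy `E = -k / (2 a)`, expressed through the semi-major axis `a`. -/
theorem psq_eq (h : IsKeplerOrbit mₑ k m) (hm : 0 < mₑ)
    (hE : hydrogenH mₑ k (m 0) = -k / (2 * a)) (t : ℝ) :
    psq (m t) = mₑ * k * (2 / rad (m t) - 1 / a) := by
  have h1 : 1 / (2 * mₑ) * psq (m t) - k / rad (m t) = -k / (2 * a) :=
    (h.hydrogenH_eq t).trans hE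
  have h2 : psq (m t) = 2 * mₑ * (1 / (2 * mₑ) * psq (m t)) := by field_simp
  rw [h2, sub_eq_iff_eq_add.1 h1]
  have : -k / (2 * a) = -(k / 2) * (1 / a) := by
    by_cases ha : a = 0
    · simp [ha]
    · field_simp
  rw [this]
  ring

/-- The vectors `ctr` and `(κ / (mₑ k a)) |q| p` rotate into each other with angular velocity
`κ / (mₑ a |q|)`, the time derivative of the eccentric anomaly. -/
theorem hasDerivAt_ctr (h : IsKeplerOrbit mₑ k m) (hm : 0 < mₑ) (hk : 0 < k) (ha : 0 < a)
    (hE : hydrogenH mₑ k (m 0) = -k / (2 * a)) (j : Fin 3) (t : ℝ) :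
    HasDerivAt (fun t => ctr mₑ k (m t) j) (m t (.inr j) / (mₑ * a)) t := by
  have hr := h.rad_pos t
  refine (((h.hasDerivAt_inl j t).div (h.hasDerivAt_rad t) hr.ne').sub
    (((h.hasDerivAt_dotqp t).mul (h.hasDerivAt_inr j t)).div_const (mₑ * k))).congr_deriv ?_
  rw [h.psq_eq hm hE t]
  field_simp
  ring

theorem hasDerivAt_rad_mul_inr (h : IsKeplerOrbit mₑ k m) (hm : 0 < mₑ) (hk : 0 < k) (j : Fin 3)
    (t : ℝ) : HasDerivAt (fun t => rad (m t) * m t (.inr j))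
      (-(k / rad (m t) * ctr mₑ k (m t) j)) t := by
  have hr := h.rad_pos t
  refine ((h.hasDerivAt_rad t).mul (h.hasDerivAt_inr j t)).congr_deriv ?_
  simp only [ctr]
  field_simp
  ring

/-- The eccentric anomaly of an orbit, normalized to vanish at time `0`. -/
def anomaly (mₑ a κ : ℝ) (m : ℝ → V 3) (t : ℝ) : ℝ := ∫ s in (0 : ℝ)..t, κ / (mₑ * a * rad (m s))

theorem hasDerivAt_anomaly (h : IsKeplerOrbit mₑ k m) (hm : 0 < mₑ) (ha : 0 < a) (t : ℝ) :
    HasDerivAt (anomaly mₑ a κ m) (κ / (mₑ * a * rad (m t))) t := by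
  have hc : Continuous fun s => κ / (mₑ * a * rad (m s)) :=
    continuous_const.div (continuous_const.mul h.continuous_rad) fun s => by
      have := h.rad_pos s; positivity
  exact intervalIntegral.integral_hasDerivAt_right (hc.intervalIntegrable _ _)
    (hc.stronglyMeasurableAtFilter _ _) hc.continuousAt

/-- A primitive of the one-form `β` along an orbit, for any choice `θ` of the eccentric anomaly. -/
theorem hasDerivAt_action (h : IsKeplerOrbit mₑ k m) (hm : 0 < mₑ) (ha : 0 < a)
    (hκ : κ ^ 2 = mₑ * k * a) {θ : ℝ → ℝ}
    (hθ : ∀ t, HasDerivAt θ (κ / (mₑ * a * rad (m t))) t) (t : ℝ) :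
    HasDerivAt (fun t => dotqp (m t) - κ * θ t) (hydrogenβ (m t) (deriv m t)) t := by
  have hr := h.rad_pos t
  refine ((h.hasDerivAt_dotqp t).sub ((hθ t).const_mul κ)).congr_deriv ?_
  rw [(h t).2.deriv]
  have h2 := rad_sq (m t)
  have e1 : hydrogenβ (m t) (kepVec mₑ k (m t)) =
      psq (m t) / mₑ - 2 * k * (∑ j, m t (.inl j) ^ 2) / rad (m t) ^ 3 := by
    simp [hydrogenβ, kepVec, Fin.sum_univ_three, psq]
    ring
  have e2 : κ * (κ / (mₑ * a * rad (m t))) = k / rad (m t) := by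
    rw [mul_div, ← sq, hκ]; field_simp
  rw [e1, e2, ← h2]
  field_simp
  ring

/-- Over a period the eccentric anomaly increases by a multiple of `2 π`. -/
theorem anomaly_eq (h : IsKeplerOrbit mₑ k m) (hm : 0 < mₑ) (hk : 0 < k) (ha : 0 < a)
    (hκ0 : 0 < κ) (hκ : κ ^ 2 = mₑ * k * a)
    (hE : hydrogenH mₑ k (m 0) = -k / (2 * a)) {T : ℝ} (hper : m T = m 0) :
    ∃ j : ℤ, anomaly mₑ a κ m T = 2 * Real.pi * j := by
  set θ := anomaly mₑ a κ m
  have hθ : ∀ t, HasDerivAt θ (κ / (mₑ * a * rad (m t))) t := h.hasDerivAt_anomaly hm ha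
  -- `Z j` is a constant times `exp (-i θ)`, by `hasDerivAt_ctr` and `hasDerivAt_rad_mul_inr`
  set Z : Fin 3 → ℝ → ℂ := fun j t =>
    (ctr mₑ k (m t) j : ℝ) + (κ / (mₑ * k * a) * (rad (m t) * m t (.inr j)) : ℝ) * Complex.I with hZ
  have hZd : ∀ j t, HasDerivAt (Z j) (-Complex.I * ((κ / (mₑ * a * rad (m t)) : ℝ) * Z j t)) t := by
    intro j t
    have hr := h.rad_pos t
    refine ((h.hasDerivAt_ctr hm hk ha hE j t).ofReal_comp.add
      (((h.hasDerivAt_rad_mul_inr hm hk j t).const_mul (κ / (mₑ * k * a))).ofReal_comp.mul_const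
        Complex.I)).congr_deriv ?_
    have e : m t (.inr j) / (mₑ * a) = κ / (mₑ * a * rad (m t)) *
        (κ / (mₑ * k * a) * (rad (m t) * m t (.inr j))) := by
      field_simp
      rw [hκ]; ring
    have e2 : κ / (mₑ * k * a) * -(k / rad (m t) * ctr mₑ k (m t) j) =
        - (κ / (mₑ * a * rad (m t)) * ctr mₑ k (m t) j) := by
      field_simp
    rw [e, e2]
    simp only [Z]
    push_cast
    linear_combination ((κ / (mₑ * a * rad (m t)) *
        (κ / (mₑ * k * a) * (rad (m t) * m t (.inr j)))) : ℂ) * Complex.I_sq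
  have hconst : ∀ j, Z j T * Complex.exp (Complex.I * θ T) = Z j 0 := by
    intro j
    have hd : ∀ t, HasDerivAt (fun t => Z j t * Complex.exp (Complex.I * (θ t : ℝ))) 0 t := by
      intro t
      refine ((hZd j t).mul (((hθ t).ofReal_comp.const_mul Complex.I).cexp)).congr_deriv ?_
      ring
    have := is_const_of_deriv_eq_zero (fun t => (hd t).differentiableAt) (fun t => (hd t).deriv) T 0
    have h0 : θ 0 = 0 := intervalIntegral.integral_same
    rw [h0] at this
    simpa using this
  have hne : ∃ j, Z j 0 ≠ 0 := by
    by_contra hall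
    push Not at hall
    have hr := h.rad_pos 0
    have hp : ∀ j, m 0 (.inr j) = 0 := fun j => by
      have := congrArg Complex.im (hall j)
      simp only [Z, Complex.add_im, Complex.ofReal_im, Complex.mul_I_im, Complex.ofReal_re,
        zero_add, Complex.zero_im] at this
      have hc : κ / (mₑ * k * a) ≠ 0 := by positivity
      exact ((mul_eq_zero.1 this).resolve_left hc |> mul_eq_zero.1).resolve_left hr.ne'
    obtain ⟨j, hj⟩ := (h 0).1
    have := congrArg Complex.re (hall j)
    simp [Z, ctr, hp] at this
    exact this.elim hj hr.ne'
  obtain ⟨j, hj⟩ := hne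
  have h1 := hconst j
  have h2 : Z j T = Z j 0 := by simp only [Z, hper]
  rw [h2] at h1
  have h3 : Complex.exp (Complex.I * θ T) = 1 := mul_left_cancel₀ hj (by rw [h1, mul_one])
  obtain ⟨n, hn⟩ := Complex.exp_eq_one_iff.1 h3
  refine ⟨n, ?_⟩
  have := congrArg Complex.im hn
  simp at this
  linarith

end IsKeplerOrbit

/-! ### A symplectic frame of Hamiltonian vectors along planar orbits -/

/-- A state of the Kepler problem in the plane `q₃ = p₃ = 0`, with positive angular momentum `ℓ`,
semi-major axis `a`, and `κ = √(mₑ k a)`. -/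
structure IsPlanar (mₑ k a κ ℓ : ℝ) (m : V 3) : Prop where
  mₑ_pos : 0 < mₑ
  k_pos : 0 < k
  a_pos : 0 < a
  κ_pos : 0 < κ
  ℓ_pos : 0 < ℓ
  κ_sq : κ ^ 2 = mₑ * k * a
  mem : m ∈ hydrogenSpace
  q_eq : m (.inl 2) = 0
  p_eq : m (.inr 2) = 0
  ang_eq : ang 0 1 m = ℓ
  psq_eq : psq m = mₑ * k * (2 / rad m - 1 / a)

/-- The generator of the scaling `(q, p) ↦ (λ² q, λ⁻¹ p)`, normalized to be conjugate to the
Kepler vector field on the energy surface `H = -k / (2 a)`. -/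
def scaleVec (k a : ℝ) (m : V 3) : V 3 :=
  Sum.elim (fun j => a / k * (2 * m (.inl j))) (fun j => a / k * -m (.inr j))

/-- The columns of the frame: up to normalization, the Hamiltonian vectors of two components of
the eccentricity vector and of two components of the angular momentum, the Kepler vector field,
and the scaling vector conjugate to it. -/
def frameCol (mₑ k a κ ℓ : ℝ) (m : V 3) : Fin 3 ⊕ Fin 3 → V 3 :=
  Sum.elim ![κ • eccVec mₑ k 0 m, angVec 1 2 m, kepVec mₑ k m]
    ![(κ / ℓ) • eccVec mₑ k 1 m, (1 / ℓ) • angVec 2 0 m, scaleVec k a m]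

/-- A matrix whose columns form a symplectic basis is symplectic. -/
theorem mem_Sp_of_cols {n : ℕ} {c : Fin n ⊕ Fin n → V n}
    (h1 : ∀ i j, Ω (c (.inl i)) (c (.inl j)) = 0) (h2 : ∀ i j, Ω (c (.inr i)) (c (.inr j)) = 0)
    (h3 : ∀ i j, Ω (c (.inl i)) (c (.inr j)) = if i = j then 1 else 0) :
    (Matrix.of fun i j => c j i) ∈ Matrix.symplecticGroup (Fin n) ℝ := by
  rw [SymplecticGroup.mem_iff']
  ext i j
  have hc : ∀ j, (Matrix.of fun i j => c j i) *ᵥ (Pi.single j 1) = c j := by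
    intro j; ext i; simp
  have h := Ω_mulVec_eq (Matrix.of fun i j => c j i) (Pi.single i 1) (Pi.single j 1)
  rw [hc, hc] at h
  have h' : ((Matrix.of fun i j => c j i)ᵀ * Matrix.J (Fin n) ℝ * (Matrix.of fun i j => c j i)) i j
      = - Ω (c i) (c j) := by
    rw [h]; simp
  rw [h']
  rcases i with i | i <;> rcases j with j | j
  · simp [h1, Matrix.J]
  · simp [h3, Matrix.J, Matrix.one_apply]
  · rw [Ω_neg_symm, h3]; simp [Matrix.J, Matrix.one_apply, eq_comm]
  · simp [h2, Matrix.J]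

theorem Ω_smul_left {n : ℕ} (c : ℝ) (u v : V n) : Ω (c • u) v = c * Ω u v := by
  simp only [Ω, Pi.smul_apply, smul_eq_mul, Finset.mul_sum]
  exact Finset.sum_congr rfl fun _ _ => by ring

theorem Ω_smul_right {n : ℕ} (c : ℝ) (u v : V n) : Ω u (c • v) = c * Ω u v := by
  rw [Ω_neg_symm, Ω_smul_left, Ω_neg_symm u]; ring

theorem Ω_self {n : ℕ} (u : V n) : Ω u u = 0 := by linarith [Ω_neg_symm u u]

theorem Ω_eccVec_scaleVec (mₑ k a : ℝ) (j : Fin 3) {m : V 3} (hx : m ∈ hydrogenSpace) :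
    Ω (eccVec mₑ k j m) (scaleVec k a m) = 0 := by
  have hr := rad_pos hx
  have h2 := rad_sq m
  simp only [Fin.sum_univ_three] at h2
  set r := rad m with hr'
  have key : ∀ j, Ω (eccVec mₑ k j m) (scaleVec k a m) = (a / k * 2 * m (.inl j)) *
      ((m (.inl 0) ^ 2 + m (.inl 1) ^ 2 + m (.inl 2) ^ 2) / r ^ 3 - 1 / r) := by
    intro j
    fin_cases j <;>
      simp [Ω, Fin.sum_univ_three, eccVec, scaleVec, dotqp, psq, ← hr'] <;> ring
  rw [key, ← h2]
  field_simp
  ring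

namespace IsPlanar

variable {mₑ k a κ ℓ : ℝ} {m : V 3} (h : IsPlanar mₑ k a κ ℓ m)
include h

theorem rad_pos : 0 < rad m := MpcQuant.rad_pos h.mem

theorem rad_sq : rad m ^ 2 = m (.inl 0) ^ 2 + m (.inl 1) ^ 2 := by
  rw [MpcQuant.rad_sq, Fin.sum_univ_three, h.q_eq]; ring

theorem psq_def : psq m = m (.inr 0) ^ 2 + m (.inr 1) ^ 2 := by
  rw [psq, Fin.sum_univ_three, h.p_eq]; ring

theorem dotqp_def : dotqp m = m (.inl 0) * m (.inr 0) + m (.inl 1) * m (.inr 1) := by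
  rw [dotqp, Fin.sum_univ_three, h.p_eq]; ring

theorem inv_rad : (rad m)⁻¹ = (m (.inl 0) ^ 2 + m (.inl 1) ^ 2) / rad m ^ 3 := by
  have hr := h.rad_pos
  rw [← h.rad_sq]
  field_simp

theorem eccVec_zero : eccVec mₑ k 0 m = Sum.elim
    ![-(m (.inl 1) * m (.inr 1)) / (mₑ * k),
      (2 * m (.inl 0) * m (.inr 1) - m (.inl 1) * m (.inr 0)) / (mₑ * k), 0]
    ![m (.inl 1) ^ 2 / rad m ^ 3 - m (.inr 1) ^ 2 / (mₑ * k),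
      -(m (.inl 0) * m (.inl 1)) / rad m ^ 3 + m (.inr 0) * m (.inr 1) / (mₑ * k), 0] := by
  ext (i | i) <;> fin_cases i <;>
    simp [eccVec, h.q_eq, h.p_eq, h.dotqp_def, h.psq_def, div_eq_mul_inv _ (rad m), h.inv_rad] <;>
    ring

theorem eccVec_one : eccVec mₑ k 1 m = Sum.elim
    ![(2 * m (.inl 1) * m (.inr 0) - m (.inl 0) * m (.inr 1)) / (mₑ * k),
      -(m (.inl 0) * m (.inr 0)) / (mₑ * k), 0]
    ![-(m (.inl 0) * m (.inl 1)) / rad m ^ 3 + m (.inr 0) * m (.inr 1) / (mₑ * k),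
      m (.inl 0) ^ 2 / rad m ^ 3 - m (.inr 0) ^ 2 / (mₑ * k), 0] := by
  ext (i | i) <;> fin_cases i <;>
    simp [eccVec, h.q_eq, h.p_eq, h.dotqp_def, h.psq_def, div_eq_mul_inv _ (rad m), h.inv_rad] <;>
    ring

theorem Ω_eccVec_eccVec : Ω (eccVec mₑ k 0 m) (eccVec mₑ k 1 m) = ℓ / κ ^ 2 := by
  have hr := h.rad_pos
  have hm := h.mₑ_pos
  have hk := h.k_pos
  have ha := h.a_pos
  have key : Ω (eccVec mₑ k 0 m) (eccVec mₑ k 1 m) = 1 / (mₑ * k) *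
      (2 * ang 0 1 m * (m (.inl 0) ^ 2 + m (.inl 1) ^ 2) / rad m ^ 3 -
        ang 0 1 m * psq m / (mₑ * k)) := by
    rw [h.eccVec_zero, h.eccVec_one]
    simp [Ω, Fin.sum_univ_three, h.psq_def, ang]
    field_simp
    ring
  rw [key, ← h.rad_sq, h.psq_eq, h.ang_eq, h.κ_sq]
  field_simp
  ring

theorem Ω_kepVec_scaleVec : Ω (kepVec mₑ k m) (scaleVec k a m) = 1 := by
  have hr := h.rad_pos
  have hm := h.mₑ_pos
  have hk := h.k_pos
  have ha := h.a_pos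
  have key : Ω (kepVec mₑ k m) (scaleVec k a m) = a / k *
      (2 * k * (m (.inl 0) ^ 2 + m (.inl 1) ^ 2) / rad m ^ 3 - psq m / mₑ) := by
    simp [Ω, Fin.sum_univ_three, kepVec, scaleVec, h.psq_def, h.q_eq, h.p_eq]
    field_simp
    ring
  rw [key, ← h.rad_sq, h.psq_eq]
  field_simp
  ring

theorem frame_mem :
    (Matrix.of fun i j => frameCol mₑ k a κ ℓ m j i) ∈ Matrix.symplecticGroup (Fin 3) ℝ := by
  have hm := h.mₑ_pos.ne'
  have hk := h.k_pos.ne'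
  have hℓ := h.ℓ_pos.ne'
  have hκ := h.κ_pos.ne'
  have h1 : Ω (eccVec mₑ k 0 m) (angVec 1 2 m) = 0 := by
    simp [Ω, Fin.sum_univ_three, eccVec, angVec, h.q_eq, h.p_eq]
  have h2 : Ω (eccVec mₑ k 0 m) (angVec 2 0 m) = 0 := by
    simp [Ω, Fin.sum_univ_three, eccVec, angVec, h.q_eq, h.p_eq]
  have h3 : Ω (eccVec mₑ k 1 m) (angVec 1 2 m) = 0 := by
    simp [Ω, Fin.sum_univ_three, eccVec, angVec, h.q_eq, h.p_eq]
  have h4 : Ω (eccVec mₑ k 1 m) (angVec 2 0 m) = 0 := by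
    simp [Ω, Fin.sum_univ_three, eccVec, angVec, h.q_eq, h.p_eq]
  have h5 : Ω (angVec 1 2 m) (scaleVec k a m) = 0 := by
    simp [Ω, Fin.sum_univ_three, scaleVec, angVec, h.q_eq, h.p_eq]
  have h6 : Ω (angVec 2 0 m) (scaleVec k a m) = 0 := by
    simp [Ω, Fin.sum_univ_three, scaleVec, angVec, h.q_eq, h.p_eq]
  have h7 : Ω (angVec 1 2 m) (angVec 2 0 m) = ℓ := by
    rw [← h.ang_eq]
    simp [Ω, Fin.sum_univ_three, angVec, ang, h.q_eq, h.p_eq]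
    ring
  have e := fun j => Ω_eccVec_kepVec hm hk j h.mem
  have s := fun j => Ω_eccVec_scaleVec mₑ k a j h.mem
  have g := fun i j => Ω_angVec_kepVec mₑ k i j m
  refine mem_Sp_of_cols (c := frameCol mₑ k a κ ℓ m) (fun i j => ?_) (fun i j => ?_) fun i j => ?_
  · have hlt : ∀ i j : Fin 3, i < j → Ω (frameCol mₑ k a κ ℓ m (.inl i))
        (frameCol mₑ k a κ ℓ m (.inl j)) = 0 := by
      intro i j hij
      fin_cases i <;> fin_cases j <;> simp at hij <;>
        simp [frameCol, Ω_smul_left, h1, e, g]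
    rcases lt_trichotomy i j with hij | rfl | hij
    · exact hlt i j hij
    · exact Ω_self _
    · rw [Ω_neg_symm, hlt j i hij, neg_zero]
  · have hlt : ∀ i j : Fin 3, i < j → Ω (frameCol mₑ k a κ ℓ m (.inr i))
        (frameCol mₑ k a κ ℓ m (.inr j)) = 0 := by
      intro i j hij
      fin_cases i <;> fin_cases j <;> simp at hij <;>
        simp [frameCol, Ω_smul_left, Ω_smul_right, h4, h6, s]
    rcases lt_trichotomy i j with hij | rfl | hij
    · exact hlt i j hij
    · exact Ω_self _
    · rw [Ω_neg_symm, hlt j i hij, neg_zero]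
  · have h3' : Ω (angVec 1 2 m) (eccVec mₑ k 1 m) = 0 := by rw [Ω_neg_symm, h3, neg_zero]
    have e' := fun j => (Ω_neg_symm (kepVec mₑ k m) (eccVec mₑ k j m)).trans (by rw [e, neg_zero])
    have g' := fun i j => (Ω_neg_symm (kepVec mₑ k m) (angVec i j m)).trans (by rw [g, neg_zero])
    fin_cases i <;> fin_cases j <;>
      simp [frameCol, Ω_smul_left, Ω_smul_right, h2, h3', h5, h7, s, e', g', h.Ω_eccVec_eccVec,
        h.Ω_kepVec_scaleVec, hℓ]
    field_simp

end IsPlanar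

/-- The frame with columns `frameCol`, as a symplectic matrix. -/
def frameSp {mₑ k a κ ℓ : ℝ} {m : V 3} (h : IsPlanar mₑ k a κ ℓ m) : Sp 3 :=
  ⟨Matrix.of fun i j => frameCol mₑ k a κ ℓ m j i, h.frame_mem⟩

/-! ### The square root of the automorphy factor along the frame -/

/-- The plane vector `(x, y)` as the complex number `x / ℓ - i y`. The weights are such that the
entries of `i C + D` for the frame `frameSp` combine into such numbers. -/
def toC (ℓ x y : ℝ) : ℂ := ((x / ℓ : ℝ) : ℂ) - y * Complex.I

theorem toC_im_mul_conj {ℓ x y x' y' : ℝ} :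
    (toC ℓ x y * (starRingEnd ℂ) (toC ℓ x' y')).im = (x * y' - y * x') / ℓ := by
  simp [toC]; ring

/-- The complex number of the vector `ctr`. -/
def ctrC (mₑ k ℓ : ℝ) (m : V 3) : ℂ := toC ℓ (ctr mₑ k m 0) (ctr mₑ k m 1)

/-- The complex number of the momentum. -/
def momC (ℓ : ℝ) (m : V 3) : ℂ := toC ℓ (m (.inr 0)) (m (.inr 1))

/-- The complex number of `(q · p) q / |q|³ - |p|² p / (mₑ k)`. -/
def auxC (mₑ k ℓ : ℝ) (m : V 3) : ℂ :=
  toC ℓ (dotqp m * m (.inl 0) / rad m ^ 3 - psq m * m (.inr 0) / (mₑ * k))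
    (dotqp m * m (.inl 1) / rad m ^ 3 - psq m * m (.inr 1) / (mₑ * k))

theorem den_frameSp_apply {mₑ k a κ ℓ : ℝ} {m : V 3} (h : IsPlanar mₑ k a κ ℓ m) (i j : Fin 3) :
    den (frameSp h) (basePt 3).1 i j = (frameCol mₑ k a κ ℓ m (.inl j) (.inr i) : ℂ) * Complex.I +
      (frameCol mₑ k a κ ℓ m (.inr j) (.inr i) : ℂ) := by
  simp [den, blkC, blkD, basePt, frameSp, Matrix.toBlocks₂₁, Matrix.toBlocks₂₂, mul_comm]

/-- The automorphy factor of the frame at `i·1`. Here `momC` is `-i ctrC` and the second factor is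
`i ctrC / κ`, each times a number with positive real part: see `IsPlanar.re_pos₁` and
`IsPlanar.re_pos₂`. -/
theorem det_den_frameSp {mₑ k a κ ℓ : ℝ} {m : V 3} (h : IsPlanar mₑ k a κ ℓ m) :
    (den (frameSp h) (basePt 3).1).det = κ * momC ℓ m *
      ((k / rad m ^ 3 : ℝ) * Complex.I * ctrC mₑ k ℓ m + (a / k : ℝ) * auxC mₑ k ℓ m) := by
  have hr := h.rad_pos
  have hm := h.mₑ_pos
  have hk := h.k_pos
  have hℓ := h.ℓ_pos
  have hr' : (rad m : ℂ) ≠ 0 := by exact_mod_cast hr.ne'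
  have hm' : (mₑ : ℂ) ≠ 0 := by exact_mod_cast hm.ne'
  have hk' : (k : ℂ) ≠ 0 := by exact_mod_cast hk.ne'
  have hℓ' : (ℓ : ℂ) ≠ 0 := by exact_mod_cast hℓ.ne'
  have h2 : (rad m : ℂ) ^ 2 = (m (.inl 0) : ℂ) ^ 2 + (m (.inl 1) : ℂ) ^ 2 := by
    exact_mod_cast h.rad_sq
  have key : (den (frameSp h) (basePt 3).1).det = κ * momC ℓ m *
      ((k / rad m ^ 3 : ℝ) * Complex.I * (((m (.inl 0) : ℂ) ^ 2 + (m (.inl 1) : ℂ) ^ 2) *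
        toC ℓ (m (.inl 0)) (m (.inl 1)) / rad m ^ 3 - dotqp m * momC ℓ m / (mₑ * k)) +
        (a / k : ℝ) * auxC mₑ k ℓ m) := by
    rw [Matrix.det_fin_three]
    simp only [den_frameSp_apply, frameCol, h.eccVec_zero, h.eccVec_one]
    simp [angVec, kepVec, scaleVec, momC, auxC, toC, h.q_eq, h.p_eq,
      h.psq_def, h.dotqp_def]
    field_simp
    ring_nf
  rw [key, ← h2]
  congr 2
  simp only [ctrC, ctr, momC, toC]
  push_cast
  field_simp
  ring

theorem re_I_mul_div (z w : ℂ) :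
    (Complex.I * z / w).re = -(z * (starRingEnd ℂ) w).im / Complex.normSq w := by
  rw [Complex.div_re]
  simp
  ring

/-- A square root of `det (i C + D)` for the frame `frameSp`. It is the complex number of the
vector `ctr`, corrected by principal square roots of numbers with positive real part, and depends
on the state only: hence it returns to its initial value after a period. -/
def frameRoot (mₑ k a κ ℓ : ℝ) (m : V 3) : ℂ :=
  ctrC mₑ k ℓ m * (Complex.I * momC ℓ m / ctrC mₑ k ℓ m) ^ (1 / 2 : ℂ) *
    ((κ * (k / rad m ^ 3) : ℝ) -
      (κ * (a / k) : ℝ) * (Complex.I * auxC mₑ k ℓ m / ctrC mₑ k ℓ m)) ^ (1 / 2 : ℂ)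

namespace IsPlanar

variable {mₑ k a κ ℓ : ℝ} {m : V 3} (h : IsPlanar mₑ k a κ ℓ m)
include h

theorem momC_mul_conj_im : (momC ℓ m * (starRingEnd ℂ) (ctrC mₑ k ℓ m)).im = -(1 / rad m) := by
  have hr := h.rad_pos
  have hℓ := h.ℓ_pos
  have e := h.ang_eq
  rw [momC, ctrC, toC_im_mul_conj, ctr, ctr]
  rw [ang] at e
  field_simp
  linear_combination -e

theorem auxC_mul_conj_im :
    (auxC mₑ k ℓ m * (starRingEnd ℂ) (ctrC mₑ k ℓ m)).im = ℓ ^ 2 / (mₑ * k * rad m ^ 3) := by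
  have hr := h.rad_pos
  have hℓ := h.ℓ_pos
  have hm := h.mₑ_pos
  have hk := h.k_pos
  have e := h.ang_eq
  have e2 := psq_mul_rad_sq m
  have e3 : ang 1 2 m = 0 := by simp [ang, h.q_eq, h.p_eq]
  have e4 : ang 2 0 m = 0 := by simp [ang, h.q_eq, h.p_eq]
  rw [e, e3, e4] at e2
  rw [auxC, ctrC, toC_im_mul_conj, ctr, ctr]
  have key : ((dotqp m * m (.inl 0) / rad m ^ 3 - psq m * m (.inr 0) / (mₑ * k)) *
      (m (.inl 1) / rad m - dotqp m * m (.inr 1) / (mₑ * k)) -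
      (dotqp m * m (.inl 1) / rad m ^ 3 - psq m * m (.inr 1) / (mₑ * k)) *
      (m (.inl 0) / rad m - dotqp m * m (.inr 0) / (mₑ * k))) =
      ang 0 1 m * (psq m * rad m ^ 2 - dotqp m ^ 2) / (mₑ * k * rad m ^ 3) := by
    rw [ang]
    field_simp
    ring
  rw [key, e2, e]
  field_simp
  ring

theorem ctrC_ne_zero : ctrC mₑ k ℓ m ≠ 0 := by
  intro h0
  have hr := h.rad_pos
  have := h.momC_mul_conj_im
  rw [h0] at this
  simp at this
  exact hr.ne' this

theorem re_pos₁ : 0 < (Complex.I * momC ℓ m / ctrC mₑ k ℓ m).re := by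
  have hr := h.rad_pos
  have := Complex.normSq_pos.2 h.ctrC_ne_zero
  rw [re_I_mul_div, h.momC_mul_conj_im, neg_neg]
  positivity

theorem re_pos₂ : 0 < (((κ * (k / rad m ^ 3) : ℝ) : ℂ) -
    (κ * (a / k) : ℝ) * (Complex.I * auxC mₑ k ℓ m / ctrC mₑ k ℓ m)).re := by
  have hr := h.rad_pos
  have := Complex.normSq_pos.2 h.ctrC_ne_zero
  have hm := h.mₑ_pos
  have hk := h.k_pos
  have ha := h.a_pos
  have hκ := h.κ_pos
  rw [Complex.sub_re, Complex.ofReal_re, Complex.re_ofReal_mul, re_I_mul_div, h.auxC_mul_conj_im,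
    neg_div, mul_neg, sub_neg_eq_add]
  positivity

theorem frameRoot_sq :
    frameRoot mₑ k a κ ℓ m ^ 2 = (den (frameSp h) (basePt 3).1).det := by
  have hc := h.ctrC_ne_zero
  have hs : ∀ z : ℂ, (z ^ (1 / 2 : ℂ)) ^ 2 = z := fun z => by
    rw [← Complex.cpow_mul_nat]; norm_num
  rw [frameRoot, mul_pow, mul_pow, hs, hs, det_den_frameSp]
  push_cast
  field_simp
  linear_combination -(momC ℓ m * κ * a * auxC mₑ k ℓ m / k) * Complex.I_sq

end IsPlanar

theorem continuous_frameRoot {mₑ k a κ ℓ : ℝ} {m : ℝ → V 3}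
    (h : ∀ t, IsPlanar mₑ k a κ ℓ (m t)) (hc : Continuous m) :
    Continuous fun t => frameRoot mₑ k a κ ℓ (m t) := by
  have hq : ∀ i, Continuous fun t => m t i := fun i => (continuous_apply i).comp hc
  have hr : Continuous fun t => rad (m t) :=
    Real.continuous_sqrt.comp (continuous_finsetSum _ fun j _ => (hq _).pow 2)
  have hr0 : ∀ t, rad (m t) ≠ 0 := fun t => (h t).rad_pos.ne'
  have hd : Continuous fun t => dotqp (m t) :=
    continuous_finsetSum _ fun j _ => (hq _).mul (hq _)
  have hp : Continuous fun t => psq (m t) := continuous_finsetSum _ fun j _ => (hq _).pow 2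
  have htoC : ∀ {x y : ℝ → ℝ}, Continuous x → Continuous y →
      Continuous fun t => toC ℓ (x t) (y t) := fun hx hy =>
    (Complex.continuous_ofReal.comp (hx.div_const ℓ)).sub
      ((Complex.continuous_ofReal.comp hy).mul continuous_const)
  have hctr : ∀ j, Continuous fun t => ctr mₑ k (m t) j := fun j =>
    ((hq _).div hr hr0).sub ((hd.mul (hq _)).div_const _)
  have h1 : Continuous fun t => ctrC mₑ k ℓ (m t) := htoC (hctr 0) (hctr 1)
  have h2 : Continuous fun t => momC ℓ (m t) := htoC (hq _) (hq _)
  have haux : ∀ j, Continuous fun t => dotqp (m t) * m t (.inl j) / rad (m t) ^ 3 -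
      psq (m t) * m t (.inr j) / (mₑ * k) := fun j =>
    ((hd.mul (hq _)).div (hr.pow 3) fun t => pow_ne_zero _ (hr0 t)).sub
      ((hp.mul (hq _)).div_const _)
  have h3 : Continuous fun t => auxC mₑ k ℓ (m t) := htoC (haux 0) (haux 1)
  have hc0 : ∀ t, ctrC mₑ k ℓ (m t) ≠ 0 := fun t => (h t).ctrC_ne_zero
  refine (h1.mul (Continuous.cpow ((continuous_const.mul h2).div h1 hc0) continuous_const
    fun t => Or.inl (h t).re_pos₁)).mul (Continuous.cpow ?_ continuous_const
    fun t => Or.inl (h t).re_pos₂)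
  refine (Complex.continuous_ofReal.comp (continuous_const.mul
    (continuous_const.div (hr.pow 3) fun t => pow_ne_zero _ (hr0 t)))).sub
    (continuous_const.mul ((continuous_const.mul h3).div h1 hc0))

/-- A continuous square root of a differentiable function without zeros is differentiable. -/
theorem differentiable_of_sq {u w : ℝ → ℂ} (hu : Continuous u) (hw : Differentiable ℝ w)
    (huw : ∀ t, u t ^ 2 = w t) (h0 : ∀ t, u t ≠ 0) : Differentiable ℝ u := by
  intro t
  have h1 := (hw t).hasDerivAt
  rw [hasDerivAt_iff_tendsto_slope] at h1
  have hs : Filter.Tendsto (fun s => u s + u t) (nhdsWithin t {t}ᶜ) (nhds (u t + u t)) :=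
    ((hu.tendsto t).mono_left nhdsWithin_le_nhds).add_const _
  have hne : u t + u t ≠ 0 := by rw [← two_mul]; exact mul_ne_zero two_ne_zero (h0 t)
  refine HasDerivAt.differentiableAt (f' := (u t + u t)⁻¹ * deriv w t) ?_
  rw [hasDerivAt_iff_tendsto_slope]
  refine ((hs.inv₀ hne).mul h1).congr' ?_
  filter_upwards [hs.eventually_ne hne] with s hs0
  have : w s - w t = (u s + u t) * (u s - u t) := by rw [← huw, ← huw]; ring
  rw [slope_def_module, slope_def_module, this, Complex.real_smul, Complex.real_smul]
  field_simp

/-! ### Rotations -/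

/-- An orthogonal transformation of `ℝ³`, acting on positions and momenta. -/
def rotSp (O : Matrix.orthogonalGroup (Fin 3) ℝ) : Sp 3 :=
  ⟨Matrix.fromBlocks O.1 0 0 O.1, by
    rw [SymplecticGroup.fromBlocks_mem_iff]
    have := (Matrix.mem_orthogonalGroup_iff' _ _).1 O.2
    simpa using this⟩

theorem rotSp_mulVec (O : Matrix.orthogonalGroup (Fin 3) ℝ) (m : V 3) :
    (rotSp O).1 *ᵥ m = Sum.elim (O.1 *ᵥ fun j => m (.inl j)) (O.1 *ᵥ fun j => m (.inr j)) := by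
  rw [rotSp, Matrix.fromBlocks_mulVec]
  simp [Function.comp_def]

theorem rotSp_mul (O P : Matrix.orthogonalGroup (Fin 3) ℝ) : rotSp (O * P) = rotSp O * rotSp P := by
  apply Subtype.ext
  simp [rotSp, Matrix.fromBlocks_multiply]

theorem rotSp_inv_mul (O : Matrix.orthogonalGroup (Fin 3) ℝ) : rotSp O⁻¹ * rotSp O = 1 := by
  rw [← rotSp_mul, inv_mul_cancel]
  apply Subtype.ext
  simp [rotSp]

theorem dotProduct_orthogonal (O : Matrix.orthogonalGroup (Fin 3) ℝ) (x y : Fin 3 → ℝ) :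
    (O.1 *ᵥ x) ⬝ᵥ (O.1 *ᵥ y) = x ⬝ᵥ y := by
  rw [Matrix.dotProduct_mulVec, ← Matrix.mulVec_transpose, Matrix.mulVec_mulVec]
  have := (Matrix.mem_orthogonalGroup_iff' _ _).1 O.2
  rw [show O.1ᵀ * O.1 = 1 from this, Matrix.one_mulVec]

theorem rad_rotSp (O : Matrix.orthogonalGroup (Fin 3) ℝ) (m : V 3) :
    rad ((rotSp O).1 *ᵥ m) = rad m := by
  have h := dotProduct_orthogonal O (fun j => m (.inl j)) (fun j => m (.inl j))
  simp only [dotProduct, ← sq] at h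
  rw [rotSp_mulVec, rad, rad]
  simp only [Sum.elim_inl]
  rw [h]

theorem psq_rotSp (O : Matrix.orthogonalGroup (Fin 3) ℝ) (m : V 3) :
    psq ((rotSp O).1 *ᵥ m) = psq m := by
  have h := dotProduct_orthogonal O (fun j => m (.inr j)) (fun j => m (.inr j))
  simp only [dotProduct, ← sq] at h
  rw [rotSp_mulVec, psq, psq]
  simpa only [Sum.elim_inr] using h

theorem hydrogenH_rotSp (mₑ k : ℝ) (O : Matrix.orthogonalGroup (Fin 3) ℝ) (m : V 3) :
    hydrogenH mₑ k ((rotSp O).1 *ᵥ m) = hydrogenH mₑ k m := by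
  change 1 / (2 * mₑ) * psq _ - k / rad _ = 1 / (2 * mₑ) * psq _ - k / rad _
  rw [psq_rotSp, rad_rotSp]

theorem rotSp_mem (O : Matrix.orthogonalGroup (Fin 3) ℝ) {m : V 3} (hm : m ∈ hydrogenSpace) :
    (rotSp O).1 *ᵥ m ∈ hydrogenSpace :=
  mem_hydrogenSpace_of_rad (by rw [rad_rotSp]; exact rad_pos hm)

theorem kepVec_rotSp (mₑ k : ℝ) (O : Matrix.orthogonalGroup (Fin 3) ℝ) (m : V 3) :
    kepVec mₑ k ((rotSp O).1 *ᵥ m) = (rotSp O).1 *ᵥ kepVec mₑ k m := by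
  ext (i | i)
  · rw [rotSp_mulVec, rotSp_mulVec]
    simp [kepVec, Matrix.mulVec, dotProduct, Fin.sum_univ_three]
    ring
  · have h := rad_rotSp O m
    simp only [kepVec, Sum.elim_inr]
    rw [h, rotSp_mulVec, rotSp_mulVec]
    simp [Matrix.mulVec, dotProduct, Fin.sum_univ_three]
    ring

theorem IsKeplerOrbit.rotSp {mₑ k : ℝ} {m : ℝ → V 3} (h : IsKeplerOrbit mₑ k m)
    (O : Matrix.orthogonalGroup (Fin 3) ℝ) :
    IsKeplerOrbit mₑ k fun t => (rotSp O).1 *ᵥ m t := by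
  intro t
  refine ⟨rotSp_mem O (h t).1, ?_⟩
  rw [kepVec_rotSp]
  exact ((MpcQuant.rotSp O).1.mulVecLin.toContinuousLinearMap.hasFDerivAt).comp_hasDerivAt t (h t).2

theorem det_den_rotSp_mul (O : Matrix.orthogonalGroup (Fin 3) ℝ) (g : Sp 3) (Z : Siegel 3) :
    (den (rotSp O * g) Z.1).det = (O.1.det : ℂ) * (den g Z.1).det := by
  have h : den (rotSp O) (act g Z).1 = O.1.map (fun x => (x : ℂ)) := by
    ext i j
    simp [den, blkC, blkD, rotSp]
  rw [den_mul, Matrix.det_mul, h]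
  congr 1
  exact (RingHom.map_det Complex.ofRealHom O.1).symm

/-- Two orthonormal vectors and their vector product are the rows of an orthogonal matrix. -/
theorem orthogonal_of_rows {e n : Fin 3 → ℝ} (he : e ⬝ᵥ e = 1) (hn : n ⬝ᵥ n = 1)
    (hen : e ⬝ᵥ n = 0) :
    Matrix.of ![e, crossProduct n e, n] ∈ Matrix.orthogonalGroup (Fin 3) ℝ := by
  rw [Matrix.mem_orthogonalGroup_iff]
  have h1 : e ⬝ᵥ crossProduct n e = 0 := dot_cross_self _ _
  have h2 : n ⬝ᵥ crossProduct n e = 0 := dot_self_cross _ _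
  have h3 : crossProduct n e ⬝ᵥ crossProduct n e = 1 := by
    rw [cross_dot_cross, hn, he, dotProduct_comm n e, hen]; ring
  ext i j
  change (![e, crossProduct n e, n] i) ⬝ᵥ (![e, crossProduct n e, n] j) = _
  fin_cases i <;> fin_cases j <;>
    simp [he, hn, hen, h1, h2, h3, dotProduct_comm n e, dotProduct_comm _ e, dotProduct_comm _ n]

/-- A state with non-vanishing angular momentum can be rotated into the plane `q₃ = p₃ = 0`, with
positive angular momentum. -/
theorem exists_rotSp_planar {m : V 3} (hm : m ∈ hydrogenSpace)
    (hL : ¬ (ang 0 1 m = 0 ∧ ang 1 2 m = 0 ∧ ang 2 0 m = 0)) :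
    ∃ O : Matrix.orthogonalGroup (Fin 3) ℝ, ((rotSp O).1 *ᵥ m) (.inl 2) = 0 ∧
      ((rotSp O).1 *ᵥ m) (.inr 2) = 0 ∧ 0 < ang 0 1 ((rotSp O).1 *ᵥ m) := by
  have hr := rad_pos hm
  set q : Fin 3 → ℝ := fun j => m (.inl j) with hq
  set p : Fin 3 → ℝ := fun j => m (.inr j) with hp
  set L : Fin 3 → ℝ := crossProduct q p with hLdef
  have hLL : 0 < L ⬝ᵥ L := by
    have e : L ⬝ᵥ L = ang 0 1 m ^ 2 + ang 1 2 m ^ 2 + ang 2 0 m ^ 2 := by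
      simp [L, q, p, cross_apply, dotProduct, Fin.sum_univ_three, ang]; ring
    rw [e]
    by_contra hneg
    have h1 := sq_nonneg (ang 0 1 m)
    have h2 := sq_nonneg (ang 1 2 m)
    have h3 := sq_nonneg (ang 2 0 m)
    refine hL ⟨?_, ?_, ?_⟩ <;> refine pow_eq_zero_iff two_ne_zero |>.1 ?_ <;> linarith
  set Λ := Real.sqrt (L ⬝ᵥ L) with hΛ
  have hΛ0 : 0 < Λ := Real.sqrt_pos.2 hLL
  have hΛ2 : L ⬝ᵥ L = Λ * Λ := (Real.mul_self_sqrt hLL.le).symm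
  have hqq : q ⬝ᵥ q = rad m * rad m := by
    rw [← sq, rad_sq]; simp [dotProduct, q, sq]
  have hqL : q ⬝ᵥ L = 0 := dot_self_cross _ _
  have hpL : p ⬝ᵥ L = 0 := dot_cross_self _ _
  set r := rad m
  refine ⟨⟨_, orthogonal_of_rows (e := r⁻¹ • q) (n := Λ⁻¹ • L) ?_ ?_ ?_⟩, ?_, ?_, ?_⟩
  · rw [smul_dotProduct, dotProduct_smul, hqq]; simp only [smul_eq_mul]; field_simp
  · rw [smul_dotProduct, dotProduct_smul, hΛ2]; simp only [smul_eq_mul]; field_simp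
  · rw [smul_dotProduct, dotProduct_smul, hqL]; simp
  · rw [rotSp_mulVec]
    change (Λ⁻¹ • L) ⬝ᵥ q = 0
    rw [smul_dotProduct, dotProduct_comm, hqL, smul_zero]
  · rw [rotSp_mulVec]
    change (Λ⁻¹ • L) ⬝ᵥ p = 0
    rw [smul_dotProduct, dotProduct_comm, hpL, smul_zero]
  · rw [rotSp_mulVec]
    change 0 < ((r⁻¹ • q) ⬝ᵥ q) * ((crossProduct (Λ⁻¹ • L) (r⁻¹ • q)) ⬝ᵥ p) -
      ((crossProduct (Λ⁻¹ • L) (r⁻¹ • q)) ⬝ᵥ q) * ((r⁻¹ • q) ⬝ᵥ p)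
    have e1 : (crossProduct L q) ⬝ᵥ q = 0 := by rw [dotProduct_comm]; exact dot_cross_self _ _
    have e2 : (crossProduct L q) ⬝ᵥ p = Λ * Λ := by
      rw [← hΛ2]
      conv_rhs => rw [hLdef]
      simp [cross_apply, dotProduct, Fin.sum_univ_three, L]; ring
    simp only [map_smul, LinearMap.smul_apply, smul_dotProduct, smul_eq_mul, e1, e2, hqq]
    have : r⁻¹ * (r * r) * (r⁻¹ * (Λ⁻¹ * (Λ * Λ))) - r⁻¹ * (Λ⁻¹ * 0) * (r⁻¹ * q ⬝ᵥ p) = Λ := by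
      field_simp; ring
    rw [this]
    exact hΛ0

/-! ### The integral frame over a Kepler orbit -/

/-- A symplectic matrix that maps `v_{n+1}` to the Hamiltonian vector maps `W` onto the tangent
space of the level set. -/
theorem map_W_eq_tangent {n : ℕ} {H : V (n + 1) → ℝ} {m : V (n + 1)} (g : Sp (n + 1))
    (hg : g.1 *ᵥ Pi.single (.inl (Fin.last n)) 1 = hamVec H m) :
    (W n).map g.1.mulVecLin = tangent H m := by
  have key : ∀ w : V (n + 1), fderiv ℝ H m (g.1 *ᵥ w) = w (.inr (Fin.last n)) := by
    intro w
    rw [← Ω_hamVec, ← hg, Ω_mulVec, Ω_neg_symm, Ω_inl, neg_neg]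
  ext u
  constructor
  · rintro ⟨w, hw, rfl⟩
    exact (key w).trans hw
  · intro hu
    have e : g.1 *ᵥ ((g⁻¹).1 *ᵥ u) = u := by
      rw [Matrix.mulVec_mulVec, ← Submonoid.coe_mul, mul_inv_cancel, Submonoid.coe_one,
        Matrix.one_mulVec]
    refine ⟨(g⁻¹).1 *ᵥ u, ?_, e⟩
    change ((g⁻¹).1 *ᵥ u) (.inr (Fin.last n)) = 0
    rw [← key ((g⁻¹).1 *ᵥ u), e]
    exact hu

/-- Symplectic maps transform Hamiltonian vectors into Hamiltonian vectors. -/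
theorem hasFDerivAt_comp_sp {n : ℕ} (g : Sp n) {G : V n → ℝ} {X m : V n}
    (h : HasFDerivAt G (ΩL X) (g.1 *ᵥ m)) :
    HasFDerivAt (fun x => G (g.1 *ᵥ x)) (ΩL ((g⁻¹).1 *ᵥ X)) m := by
  refine (HasFDerivAt.comp m h
    (g.1.mulVecLin.toContinuousLinearMap.hasFDerivAt)).congr_fderiv
      (ContinuousLinearMap.ext fun v => ?_)
  change Ω X (g.1 *ᵥ v) = Ω _ v
  rw [← Ω_mulVec g⁻¹, Matrix.mulVec_mulVec _ (g⁻¹).1 g.1, ← Submonoid.coe_mul, inv_mul_cancel,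
    Submonoid.coe_one, Matrix.one_mulVec]

/-- The first integral belonging to the vector `z` of the frame. -/
def frameFun (mₑ k κ ℓ : ℝ) (z : V 2) (x : V 3) : ℝ :=
  z (.inl 0) * (κ * ecc mₑ k 0 x) + z (.inl 1) * ang 1 2 x +
    z (.inr 0) * (κ / ℓ * ecc mₑ k 1 x) + z (.inr 1) * (1 / ℓ * ang 2 0 x)

/-- The Hamiltonian vector field of `frameFun`. -/
def frameVec (mₑ k κ ℓ : ℝ) (z : V 2) (x : V 3) : V 3 :=
  z (.inl 0) • κ • eccVec mₑ k 0 x + z (.inl 1) • angVec 1 2 x +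
    z (.inr 0) • (κ / ℓ) • eccVec mₑ k 1 x + z (.inr 1) • (1 / ℓ) • angVec 2 0 x

theorem Ω_add_left {n : ℕ} (u u' v : V n) : Ω (u + u') v = Ω u v + Ω u' v := by
  simp only [Ω, Pi.add_apply, ← Finset.sum_add_distrib]
  exact Finset.sum_congr rfl fun _ _ => by ring

theorem hasFDerivAt_frameFun (mₑ k κ ℓ : ℝ) (z : V 2) {x : V 3} (hx : x ∈ hydrogenSpace) :
    HasFDerivAt (frameFun mₑ k κ ℓ z) (ΩL (frameVec mₑ k κ ℓ z x)) x := by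
  have h := (((((hasFDerivAt_ecc mₑ k 0 hx).const_mul κ).const_mul (z (.inl 0))).add
    ((hasFDerivAt_ang 1 2 x).const_mul (z (.inl 1)))).add
    (((hasFDerivAt_ecc mₑ k 1 hx).const_mul (κ / ℓ)).const_mul (z (.inr 0)))).add
    (((hasFDerivAt_ang 2 0 x).const_mul (1 / ℓ)).const_mul (z (.inr 1)))
  refine HasFDerivAt.congr_fderiv (f := frameFun mₑ k κ ℓ z) h (ContinuousLinearMap.ext fun v => ?_)
  simp [ΩL_apply, frameVec, Ω_add_left, Ω_smul_left]

theorem Ω_frameVec_kepVec {mₑ k : ℝ} (hm : mₑ ≠ 0) (hk : k ≠ 0) (κ ℓ : ℝ) (z : V 2) {x : V 3}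
    (hx : x ∈ hydrogenSpace) : Ω (frameVec mₑ k κ ℓ z x) (kepVec mₑ k x) = 0 := by
  simp [frameVec, Ω_add_left, Ω_smul_left, Ω_angVec_kepVec, Ω_eccVec_kepVec hm hk _ hx]

theorem frameSp_mulVec_incl {mₑ k a κ ℓ : ℝ} {m : V 3} (h : IsPlanar mₑ k a κ ℓ m) (z : V 2) :
    (frameSp h).1 *ᵥ incl z = frameVec mₑ k κ ℓ z m := by
  ext i
  simp [frameSp, Matrix.mulVec, dotProduct, Fintype.sum_sum_type, Fin.sum_univ_three, frameCol,
    frameVec, incl, Fin.snoc]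
  ring

theorem frameSp_mulVec_single {mₑ k a κ ℓ : ℝ} {m : V 3} (h : IsPlanar mₑ k a κ ℓ m) :
    (frameSp h).1 *ᵥ Pi.single (.inl (Fin.last 2)) 1 = kepVec mₑ k m := by
  ext i
  rw [Matrix.mulVec_single_one]
  rfl

namespace IsKeplerOrbit

variable {mₑ k a κ : ℝ} {m : ℝ → V 3}

/-- By conservation of the angular momentum, a planar orbit stays in its plane. -/
theorem isPlanar (h : IsKeplerOrbit mₑ k m) (hm : 0 < mₑ) (hk : 0 < k) (ha : 0 < a)
    (hκ0 : 0 < κ) (hκ : κ ^ 2 = mₑ * k * a) (hE : hydrogenH mₑ k (m 0) = -k / (2 * a))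
    (hq : m 0 (.inl 2) = 0) (hp : m 0 (.inr 2) = 0) (hℓ : 0 < ang 0 1 (m 0)) (t : ℝ) :
    IsPlanar mₑ k a κ (ang 0 1 (m 0)) (m t) := by
  have h0 := h.ang_eq 0 1 t
  have h1 := h.ang_eq 1 2 t
  have h2 := h.ang_eq 2 0 t
  have e1 : ang 1 2 (m 0) = 0 := by simp [ang, hq, hp]
  have e2 : ang 2 0 (m 0) = 0 := by simp [ang, hq, hp]
  rw [e1] at h1
  rw [e2] at h2
  refine ⟨hm, hk, ha, hκ0, hℓ, hκ, (h t).1, ?_, ?_, h0, h.psq_eq hm hE t⟩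
  · refine (mul_eq_zero.1 (?_ : ang 0 1 (m 0) * m t (.inl 2) = 0)).resolve_left hℓ.ne'
    rw [← h0]
    simp only [ang] at h1 h2 ⊢
    linear_combination -(m t (.inl 0)) * h1 - m t (.inl 1) * h2
  · refine (mul_eq_zero.1 (?_ : ang 0 1 (m 0) * m t (.inr 2) = 0)).resolve_left hℓ.ne'
    rw [← h0]
    simp only [ang] at h1 h2 ⊢
    linear_combination -(m t (.inr 0)) * h1 - m t (.inr 1) * h2

theorem differentiable_frameCol (h : IsKeplerOrbit mₑ k m) (ℓ : ℝ) (i j : Fin 3 ⊕ Fin 3) :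
    Differentiable ℝ fun t => frameCol mₑ k a κ ℓ (m t) j i := by
  have hq : ∀ i, Differentiable ℝ fun t => m t i := fun i t =>
    (hasDerivAt_pi.1 (h t).2 i).differentiableAt
  have hr : Differentiable ℝ fun t => rad (m t) := fun t => (h.hasDerivAt_rad t).differentiableAt
  have hr0 : ∀ t, rad (m t) ≠ 0 := fun t => (h.rad_pos t).ne'
  have hr3 : ∀ t, rad (m t) ^ 3 ≠ 0 := fun t => pow_ne_zero _ (hr0 t)
  have hd : Differentiable ℝ fun t => dotqp (m t) := fun t =>
    (h.hasDerivAt_dotqp t).differentiableAt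
  have hp : Differentiable ℝ fun t => psq (m t) := by unfold psq; fun_prop
  have h1 : ∀ j i, Differentiable ℝ fun t => eccVec mₑ k j (m t) i := by
    rintro j (i | i)
    · simp only [eccVec, Sum.elim_inl]
      fun_prop
    · simp only [eccVec, Sum.elim_inr]
      fun_prop (disch := assumption)
  have h2 : ∀ j l i, Differentiable ℝ fun t => angVec j l (m t) i := by
    rintro j l (i | i)
    · simp only [angVec, Sum.elim_inl, Pi.sub_apply, Pi.smul_apply, smul_eq_mul]
      fun_prop
    · simp only [angVec, Sum.elim_inr, Pi.sub_apply, Pi.smul_apply, smul_eq_mul]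
      fun_prop
  have h3 : ∀ i, Differentiable ℝ fun t => kepVec mₑ k (m t) i := by
    rintro (i | i)
    · simp only [kepVec, Sum.elim_inl]
      fun_prop
    · simp only [kepVec, Sum.elim_inr]
      fun_prop (disch := assumption)
  have h4 : ∀ i, Differentiable ℝ fun t => scaleVec k a (m t) i := by
    rintro (i | i)
    · simp only [scaleVec, Sum.elim_inl]
      fun_prop
    · simp only [scaleVec, Sum.elim_inr]
      fun_prop
  rcases j with j | j <;> fin_cases j
  · exact (h1 0 i).const_mul κ
  · exact h2 1 2 i
  · exact h3 i
  · exact (h1 1 i).const_mul (κ / ℓ)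
  · exact (h2 2 0 i).const_mul (1 / ℓ)
  · exact h4 i

/-- Over a Kepler orbit of negative energy with angular momentum there is an integral frame, with a
lift to the metaplectic group that closes up whenever the orbit does. -/
theorem exists_integralFrame (h : IsKeplerOrbit mₑ k m) (hm : 0 < mₑ) (hk : 0 < k) (ha : 0 < a)
    (hκ0 : 0 < κ) (hκ : κ ^ 2 = mₑ * k * a) {E : ℝ} (hE : hydrogenH mₑ k (m 0) = E)
    (hEa : E = -k / (2 * a))
    (hL : ¬ (ang 0 1 (m 0) = 0 ∧ ang 1 2 (m 0) = 0 ∧ ang 2 0 (m 0) = 0)) :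
    ∃ (b : ℝ → PUp hydrogenSpace (hydrogenH mₑ k) E) (F : V 2 → V 3 → ℝ),
      (∀ t, (b t).pt = m t) ∧ IsIntegralFrame b F ∧ MpcDifferentiable (fun t => (b t).a) ∧
      ∀ s t, m s = m t → b s = b t := by
  obtain ⟨O, hO1, hO2, hO3⟩ := exists_rotSp_planar (h 0).1 hL
  set R := MpcQuant.rotSp O with hR
  have hRi : MpcQuant.rotSp O⁻¹ = R⁻¹ := eq_inv_of_mul_eq_one_left (rotSp_inv_mul O)
  have h' : IsKeplerOrbit mₑ k fun t => R.1 *ᵥ m t := h.rotSp O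
  set ℓ := ang 0 1 (R.1 *ᵥ m 0)
  have hpl : ∀ t, IsPlanar mₑ k a κ ℓ (R.1 *ᵥ m t) := fun t =>
    h'.isPlanar hm hk ha hκ0 hκ (by rw [hydrogenH_rotSp, hE, hEa]) hO1 hO2 hO3 t
  have hRR : ∀ v : V 3, (R⁻¹).1 *ᵥ (R.1 *ᵥ v) = v := fun v => by
    rw [Matrix.mulVec_mulVec, ← Submonoid.coe_mul, inv_mul_cancel, Submonoid.coe_one,
      Matrix.one_mulVec]
  -- the rotation back multiplies the automorphy factor by its determinant `± 1`
  obtain ⟨c, hc⟩ := IsAlgClosed.exists_pow_nat_eq ((O⁻¹).1.det : ℂ) (n := 2) two_pos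
  set g : ℝ → Sp 3 := fun t => R⁻¹ * frameSp (hpl t) with hg
  set u : ℝ → ℂ := fun t => c * frameRoot mₑ k a κ ℓ (R.1 *ᵥ m t) with hu
  have hu2 : ∀ t, u t ^ 2 = (den (g t) (basePt 3).1).det := by
    intro t
    simp only [u, g]
    rw [← hRi, det_den_rotSp_mul, mul_pow, hc, (hpl t).frameRoot_sq]
  choose A hAσ hAη hAf using fun t => Mpc.exists_lift (g t) (hu2 t)
  have hcol : ∀ t, (g t).1 *ᵥ Pi.single (.inl (Fin.last 2)) 1 = hamVec (hydrogenH mₑ k) (m t) := by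
    intro t
    have : (g t).1 = (R⁻¹).1 * (frameSp (hpl t)).1 := rfl
    rw [this, ← Matrix.mulVec_mulVec, frameSp_mulVec_single, hR, kepVec_rotSp, ← hR, hRR,
      hamVec_hydrogenH mₑ k (h t).1]
  let b : ℝ → PUp hydrogenSpace (hydrogenH mₑ k) E := fun t =>
    { pt := m t
      a := A t
      mem := ⟨(h t).1, by rw [h.hydrogenH_eq t, hE]⟩
      map_W := by rw [hAσ]; exact map_W_eq_tangent (g t) (hcol t) }
  have hentry : ∀ i j, Differentiable ℝ fun t => (g t).1 i j := by
    intro i j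
    have : (fun t => (g t).1 i j) = fun t => ∑ l, (R⁻¹).1 i l *
        frameCol mₑ k a κ ℓ (R.1 *ᵥ m t) j l := rfl
    rw [this]
    exact Differentiable.fun_sum fun l _ => (h'.differentiable_frameCol ℓ l j).const_mul _
  have hden : Differentiable ℝ fun t => (den (g t) (basePt 3).1).det := by
    have hij : ∀ i j, Differentiable ℝ fun t => den (g t) (basePt 3).1 i j := by
      intro i j
      simp only [den, blkC, blkD, Matrix.add_apply, Matrix.mul_apply, Matrix.map_apply,
        Matrix.toBlocks₂₁, Matrix.toBlocks₂₂, Matrix.of_apply]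
      exact (Differentiable.fun_sum fun l _ =>
        ((Complex.ofRealCLM.differentiable.comp (hentry _ _)).mul_const _)).add
          (Complex.ofRealCLM.differentiable.comp (hentry _ _))
    simp only [Matrix.det_fin_three]
    fun_prop
  have hucont : Continuous u := continuous_const.mul (continuous_frameRoot hpl h'.continuous)
  have hdiff : MpcDifferentiable fun t => (b t).a := by
    constructor
    · intro i j
      change Differentiable ℝ fun t => (A t).σ.1 i j
      simp only [hAσ]
      exact hentry i j
    · change Differentiable ℝ fun t => (A t).f (basePt 3)
      simp only [hAf]
      refine differentiable_of_sq hucont hden hu2 fun t => ?_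
      rw [← hAf t]
      exact (A t).f_ne_zero _
  refine ⟨b, fun z x => frameFun mₑ k κ ℓ z (R.1 *ᵥ x), fun t => rfl,
    ⟨hdiff.continuous, hAη, ?_, ?_⟩, hdiff, ?_⟩
  · intro t z x _
    refine flow_invariant (F := fun x => frameFun mₑ k κ ℓ z (R.1 *ᵥ x))
      (fun y hy => hasFDerivAt_comp_sp R (hasFDerivAt_frameFun mₑ k κ ℓ z (rotSp_mem O hy)))
      (fun y hy => ?_) t x
    rw [hamVec_hydrogenH mₑ k hy, ΩL_apply, ← Ω_mulVec R, Matrix.mulVec_mulVec _ R.1 (R⁻¹).1,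
      ← Submonoid.coe_mul, mul_inv_cancel, Submonoid.coe_one, Matrix.one_mulVec, hR,
      ← kepVec_rotSp]
    exact Ω_frameVec_kepVec hm.ne' hk.ne' κ ℓ z (rotSp_mem O hy)
  · intro t z
    have e : (b t).a.σ.1 *ᵥ incl z = (R⁻¹).1 *ᵥ frameVec mₑ k κ ℓ z (R.1 *ᵥ m t) := by
      change (A t).σ.1 *ᵥ incl z = _
      rw [hAσ, ← frameSp_mulVec_incl (hpl t), Matrix.mulVec_mulVec]
      rfl
    rw [e]
    exact hasFDerivAt_comp_sp R (hasFDerivAt_frameFun mₑ k κ ℓ z (hpl t).mem)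
  · intro s t hst
    have hA : A s = A t := by
      have hgst : g s = g t := by
        apply Subtype.ext
        simp only [g]
        ext i j
        have : ∀ t, (R⁻¹ * frameSp (hpl t)).1 i j = ∑ l, (R⁻¹).1 i l *
          frameCol mₑ k a κ ℓ (R.1 *ᵥ m t) j l := fun _ => rfl
        rw [this, this, hst]
      refine Mpc.ext_basePt (by rw [hAσ, hAσ, hgst]) ?_
      rw [hAf, hAf]
      simp only [u, hst]
    have : ∀ (p q : PUp hydrogenSpace (hydrogenH mₑ k) E), p.pt = q.pt → p.a = q.a → p = q := by
      rintro ⟨_, _, _, _⟩ ⟨_, _, _, _⟩ rfl rfl; rfl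
    exact this _ _ hst hA

end IsKeplerOrbit

/-! ### Quantized energy levels -/

theorem IsFrameOrbit.isKeplerOrbit {mₑ k E : ℝ} {c : ℝ → RedFrame hydrogenSpace (hydrogenH mₑ k) E}
    (hc : IsFrameOrbit c) : IsKeplerOrbit mₑ k fun t => (c t).pt := by
  have h := isKeplerOrbit_flow (mₑ := mₑ) (k := k) (x := (c 0).pt) fun t => (hc t).1
  have e : (fun t => (c t).pt) =
      fun t => flow (hamVec (hydrogenH mₑ k)) hydrogenSpace t (c 0).pt :=
    funext fun t => (hc t).2.1
  rw [e]
  exact h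

theorem flow_ne_self {mₑ k E : ℝ} (hm : 0 < mₑ) (hk : 0 < k) (hE : 0 ≤ E) {s : V 3}
    (hs : s ∈ level hydrogenSpace (hydrogenH mₑ k) E) {T : ℝ} (hT : 0 < T)
    (h : FlowDefined (hamVec (hydrogenH mₑ k)) hydrogenSpace T s) :
    flow (hamVec (hydrogenH mₑ k)) hydrogenSpace T s ≠ s := fun h0 => by
  have := dotqp_lt hm hk hE hs hT h
  rw [h0] at this
  exact lt_irrefl _ this

theorem not_isClosedFrameOrbit {mₑ k E : ℝ} (hm : 0 < mₑ) (hk : 0 < k) (hE : 0 ≤ E)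
    (c : ℝ → RedFrame hydrogenSpace (hydrogenH mₑ k) E) (T : ℝ) : ¬ IsClosedFrameOrbit c T := by
  rintro ⟨hT, hc, h0⟩
  obtain ⟨h1, h2, -⟩ := hc T
  rw [h0] at h2
  exact flow_ne_self hm hk hE (c 0).mem hT h1 h2.symm

/-- If `κ = √(mₑ k a)` is a multiple of `ħ`, then the holonomy over every closed orbit of frames of
energy `-k / (2 a)` is trivial. -/
theorem trivialHolonomy_of_eq {mₑ k a κ ħ E : ℝ} (hm : 0 < mₑ) (hk : 0 < k) (ha : 0 < a)
    (hħ : 0 < ħ) (hκ0 : 0 < κ) (hκ : κ ^ 2 = mₑ * k * a) (hE : E = -k / (2 * a)) {n : ℕ}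
    (hn : κ = n * ħ) {c : ℝ → RedFrame hydrogenSpace (hydrogenH mₑ k) E} {T : ℝ}
    (hc : IsClosedFrameOrbit c T) : TrivialHolonomy ħ hydrogenβ c T := by
  obtain ⟨hT, hc, hper⟩ := hc
  intro l hl
  have h := hc.isKeplerOrbit
  have hperm : (c T).pt = (c 0).pt := by rw [hper]
  obtain ⟨b, F, hbpt, hbF, -, hb⟩ := h.exists_integralFrame hm hk ha hκ0 hκ (c 0).mem.2 hE
    (h.exists_ang_ne_zero hk hT hperm)
  have hbe : (fun t => (b t).pt) = fun t => (c t).pt := funext hbpt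
  have hS : ∀ t, HasDerivAt (fun t => dotqp (c t).pt - κ * IsKeplerOrbit.anomaly mₑ a κ
      (fun t => (c t).pt) t) (hydrogenβ (b t).pt (deriv (fun τ => (b τ).pt) t)) t := by
    intro t
    rw [hbe, hbpt t]
    exact h.hasDerivAt_action hm ha hκ (h.hasDerivAt_anomaly hm ha) t
  obtain ⟨e, hle, heσ, hef⟩ := hl.exists_phase hħ.ne' hbF isOpen_hydrogenSpace
    (fun t => (hbpt t).symm) hc hS
  obtain ⟨j, hj⟩ := h.anomaly_eq hm hk ha hκ0 hκ ((c 0).mem.2.trans hE) hperm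
  have h0 : IsKeplerOrbit.anomaly mₑ a κ (fun t => (c t).pt) 0 = 0 :=
    intervalIntegral.integral_same
  have hphase := hef T
  rw [hj, h0, hperm, hn] at hphase
  have h1 : Complex.exp (Complex.I / ħ * ((dotqp (c 0).pt - n * ħ * (2 * Real.pi * j) -
      (dotqp (c 0).pt - n * ħ * 0) : ℝ) : ℂ)) = 1 := by
    have hh : (ħ : ℂ) ≠ 0 := Complex.ofReal_ne_zero.2 hħ.ne'
    rw [Complex.exp_eq_one_iff]
    refine ⟨-(n * j), ?_⟩
    push_cast
    field_simp
    ring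
  rw [h1, mul_one] at hphase
  rw [hle T, hle 0, hb T 0 hperm, Mpc.ext_basePt (heσ T) hphase]

/-! ### Explicit solutions near a circular orbit -/

/-- A function on the line with derivative bounded below by a positive constant has a differentiable
inverse. -/
theorem exists_inverse_of_le_deriv {K r : ℝ → ℝ} {c : ℝ} (hc : 0 < c)
    (hK : ∀ θ, HasDerivAt K (r θ) θ) (hr : ∀ θ, c ≤ r θ) :
    StrictMono K ∧ ∃ θ : ℝ → ℝ, (∀ t, K (θ t) = t) ∧ ∀ t, HasDerivAt θ (r (θ t))⁻¹ t := by
  have hmono : StrictMono K := strictMono_of_deriv_pos fun θ => by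
    rw [(hK θ).deriv]; exact hc.trans_le (hr θ)
  have hcont : Continuous K := continuous_iff_continuousAt.2 fun θ => (hK θ).continuousAt
  have hmono2 : Monotone fun θ => K θ - c * θ :=
    monotone_of_hasDerivAt_nonneg (fun θ => (hK θ).sub ((hasDerivAt_id θ).const_mul c)) fun θ => by
      simpa using hr θ
  have htop : Filter.Tendsto K Filter.atTop Filter.atTop := by
    refine Filter.tendsto_atTop_mono' _ (f₁ := fun θ => K 0 + c * θ) ?_
      (Filter.tendsto_atTop_add_const_left _ _ (Filter.tendsto_id.const_mul_atTop hc))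
    filter_upwards [Filter.eventually_ge_atTop 0] with θ hθ
    have := hmono2 hθ
    simp only [mul_zero, sub_zero] at this
    linarith
  have hbot : Filter.Tendsto K Filter.atBot Filter.atBot := by
    refine Filter.tendsto_atBot_mono' _ (f₁ := fun θ => K 0 + c * θ) ?_
      (Filter.tendsto_atBot_add_const_left _ _ (Filter.tendsto_id.const_mul_atBot hc))
    filter_upwards [Filter.eventually_le_atBot 0] with θ hθ
    have := hmono2 hθ
    simp only [mul_zero, sub_zero] at this
    linarith
  let e := hmono.orderIsoOfSurjective K (hcont.surjective htop hbot)
  have he : ∀ t, K (e.symm t) = t := fun t => e.apply_symm_apply t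
  exact ⟨hmono, e.symm, he, fun t => HasDerivAt.of_local_left_inverse
    e.symm.continuous.continuousAt (hK _) (hc.trans_le (hr _)).ne'
    (Filter.Eventually.of_forall he)⟩

/-- The semi-major axis of the Kepler orbit through a state of negative energy. -/
def sma (mₑ k : ℝ) (x : V 3) : ℝ := -k / (2 * hydrogenH mₑ k x)

/-- The action `√(mₑ k a)`, where `a` is the semi-major axis. -/
def kap (mₑ k : ℝ) (x : V 3) : ℝ := Real.sqrt (mₑ * k * sma mₑ k x)

/-- The derivative of the distance with respect to the eccentric anomaly. -/
def rho (mₑ k : ℝ) (x : V 3) : ℝ := dotqp x * kap mₑ k x / (mₑ * k)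

/-- The distance from the origin after the eccentric anomaly has increased by `θ`. -/
def kepRad (mₑ k : ℝ) (x : V 3) (θ : ℝ) : ℝ :=
  sma mₑ k x - (sma mₑ k x - rad x) * Real.cos θ + rho mₑ k x * Real.sin θ

/-- Kepler's equation: the time in which the eccentric anomaly increases by `θ`. -/
def kepTime (mₑ k : ℝ) (x : V 3) (θ : ℝ) : ℝ :=
  mₑ * sma mₑ k x / kap mₑ k x * (sma mₑ k x * θ - (sma mₑ k x - rad x) * Real.sin θ +
    rho mₑ k x * (1 - Real.cos θ))

/-- The state reached from `x` when the eccentric anomaly has increased by `θ`. -/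
def kepPt (mₑ k : ℝ) (x : V 3) (θ : ℝ) : V 3 :=
  Sum.elim
    (fun j => (1 - sma mₑ k x / rad x * (1 - Real.cos θ)) * x (.inl j) +
      sma mₑ k x / kap mₑ k x * (rho mₑ k x * (1 - Real.cos θ) + rad x * Real.sin θ) * x (.inr j))
    (fun j => kap mₑ k x / (sma mₑ k x * kepRad mₑ k x θ) *
      (-(sma mₑ k x / rad x * Real.sin θ) * x (.inl j) +
      sma mₑ k x / kap mₑ k x * (rho mₑ k x * Real.sin θ + rad x * Real.cos θ) * x (.inr j)))

/-- A state on a Kepler ellipse of eccentricity `< 1`, that is, with negative energy and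
non-vanishing angular momentum. -/
structure IsElliptic (mₑ k : ℝ) (x : V 3) : Prop where
  mem : x ∈ hydrogenSpace
  neg : hydrogenH mₑ k x < 0
  lt : (sma mₑ k x - rad x) ^ 2 + rho mₑ k x ^ 2 < sma mₑ k x ^ 2

namespace IsElliptic

variable {mₑ k : ℝ} {x : V 3} (h : IsElliptic mₑ k x)
include h

theorem sma_pos (hk : 0 < k) : 0 < sma mₑ k x :=
  div_pos_of_neg_of_neg (neg_neg_of_pos hk) (by linarith [h.neg])

theorem kap_sq (hm : 0 < mₑ) (hk : 0 < k) : kap mₑ k x ^ 2 = mₑ * k * sma mₑ k x :=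
  Real.sq_sqrt (by have := h.sma_pos hk; positivity)

theorem kap_pos (hm : 0 < mₑ) (hk : 0 < k) : 0 < kap mₑ k x :=
  Real.sqrt_pos.2 (by have := h.sma_pos hk; positivity)

theorem psq_eq (hm : 0 < mₑ) (hk : 0 < k) :
    psq x = mₑ * k * (2 / rad x - 1 / sma mₑ k x) := by
  have hH := h.neg.ne
  have h1 : hydrogenH mₑ k x = 1 / (2 * mₑ) * psq x - k / rad x := rfl
  have h2 : k * (1 / sma mₑ k x) = -2 * hydrogenH mₑ k x := by
    rw [sma]; field_simp
  have h3 : mₑ * k * (2 / rad x - 1 / sma mₑ k x) =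
      mₑ * (2 * (k / rad x) - k * (1 / sma mₑ k x)) := by ring
  rw [h3, h2, h1]
  field_simp
  ring

theorem exists_le_kepRad (hk : 0 < k) : ∃ c, 0 < c ∧ ∀ θ, c ≤ kepRad mₑ k x θ := by
  have ha := h.sma_pos hk
  refine ⟨sma mₑ k x - Real.sqrt ((sma mₑ k x - rad x) ^ 2 + rho mₑ k x ^ 2), ?_, fun θ => ?_⟩
  · rw [sub_pos, Real.sqrt_lt' ha]; exact h.lt
  · have : (sma mₑ k x - rad x) * Real.cos θ - rho mₑ k x * Real.sin θ ≤
        Real.sqrt ((sma mₑ k x - rad x) ^ 2 + rho mₑ k x ^ 2) := by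
      refine Real.le_sqrt_of_sq_le ?_
      have := Real.sin_sq_add_cos_sq θ
      nlinarith [sq_nonneg ((sma mₑ k x - rad x) * Real.sin θ + rho mₑ k x * Real.cos θ)]
    rw [kepRad]
    linarith

theorem kepRad_pos (hk : 0 < k) (θ : ℝ) : 0 < kepRad mₑ k x θ := by
  obtain ⟨c, hc, hle⟩ := h.exists_le_kepRad hk
  exact hc.trans_le (hle θ)

theorem rad_kepPt (hm : 0 < mₑ) (hk : 0 < k) (θ : ℝ) :
    rad (kepPt mₑ k x θ) = kepRad mₑ k x θ := by
  have hr := rad_pos h.mem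
  have ha := h.sma_pos hk
  have hκ := h.kap_pos hm hk
  have hκ2 := h.kap_sq hm hk
  have hp := h.psq_eq hm hk
  have hR := h.kepRad_pos hk θ
  have hσ : dotqp x = rho mₑ k x * (mₑ * k) / kap mₑ k x := by rw [rho]; field_simp
  have hsc := Real.sin_sq θ
  rw [← Real.sqrt_sq hR.le, rad]
  congr 1
  have e : ∀ f g : ℝ, ∑ j, (f * x (.inl j) + g * x (.inr j)) ^ 2 =
      f ^ 2 * rad x ^ 2 + 2 * f * g * dotqp x + g ^ 2 * psq x := by
    intro f g
    rw [rad_sq]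
    simp [dotqp, psq, Fin.sum_univ_three]
    ring
  refine (e _ _).trans ?_
  rw [hp, hσ, kepRad]
  set a := sma mₑ k x
  set κ := kap mₑ k x
  set ρ := rho mₑ k x
  set r := rad x
  set s := Real.sin θ
  set c := Real.cos θ
  have e1 : (a / κ * (ρ * (1 - c) + r * s)) ^ 2 * (mₑ * k * (2 / r - 1 / a)) =
      (ρ * (1 - c) + r * s) ^ 2 * (2 * a / r - 1) := by
    have : (a / κ * (ρ * (1 - c) + r * s)) ^ 2 * (mₑ * k * (2 / r - 1 / a)) =
      (ρ * (1 - c) + r * s) ^ 2 * (2 * a / r - 1) * (mₑ * k * a / κ ^ 2) := by field_simp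
    rw [this, hκ2, div_self (by positivity), mul_one]
  have e2 : 2 * (1 - a / r * (1 - c)) * (a / κ * (ρ * (1 - c) + r * s)) * (ρ * (mₑ * k) / κ) =
      2 * (1 - a / r * (1 - c)) * (ρ * (1 - c) + r * s) * ρ := by
    have : 2 * (1 - a / r * (1 - c)) * (a / κ * (ρ * (1 - c) + r * s)) * (ρ * (mₑ * k) / κ) =
      2 * (1 - a / r * (1 - c)) * (ρ * (1 - c) + r * s) * ρ * (mₑ * k * a / κ ^ 2) := by field_simp
    rw [this, hκ2, div_self (by positivity), mul_one]
  rw [e1, e2]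
  field_simp
  linear_combination (2 * r ^ 2 * a - r * ρ ^ 2 - r ^ 3) * hsc

theorem kepPt_zero (hm : 0 < mₑ) (hk : 0 < k) : kepPt mₑ k x 0 = x := by
  have hr := rad_pos h.mem
  have ha := h.sma_pos hk
  have hκ := h.kap_pos hm hk
  ext (j | j)
  · simp [kepPt]
  · simp [kepPt, kepRad]
    field_simp

omit h in
theorem hasDerivAt_kepTime (θ : ℝ) :
    HasDerivAt (kepTime mₑ k x) (mₑ * sma mₑ k x / kap mₑ k x * kepRad mₑ k x θ) θ := by
  refine (((((hasDerivAt_id θ).const_mul (sma mₑ k x)).sub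
    ((Real.hasDerivAt_sin θ).const_mul (sma mₑ k x - rad x))).add
    (((Real.hasDerivAt_cos θ).const_sub 1).const_mul (rho mₑ k x))).const_mul
    (mₑ * sma mₑ k x / kap mₑ k x)).congr_deriv ?_
  rw [kepRad]
  ring

/-- Parametrized by the solution `θ` of Kepler's equation, `kepPt` solves the equations of
motion. -/
theorem hasDerivAt_kepPt (hm : 0 < mₑ) (hk : 0 < k) {θ : ℝ → ℝ} {t : ℝ}
    (hθ : HasDerivAt θ (mₑ * sma mₑ k x / kap mₑ k x * kepRad mₑ k x (θ t))⁻¹ t) :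
    HasDerivAt (fun t => kepPt mₑ k x (θ t)) (kepVec mₑ k (kepPt mₑ k x (θ t))) t := by
  have hr := rad_pos h.mem
  have ha := h.sma_pos hk
  have hκ := h.kap_pos hm hk
  have hκ2 := h.kap_sq hm hk
  have hR := h.kepRad_pos hk (θ t)
  have hs := hθ.sin
  have hc := hθ.cos
  have hsc := Real.sin_sq (θ t)
  refine hasDerivAt_pi.2 ?_
  rintro (j | j)
  · refine ((((hc.const_sub 1).const_mul (sma mₑ k x / rad x)).const_sub 1).mul_const
      (x (.inl j))|>.add (((((hc.const_sub 1).const_mul (rho mₑ k x)).add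
        (hs.const_mul (rad x))).const_mul (sma mₑ k x / kap mₑ k x)).mul_const
        (x (.inr j)))).congr_deriv ?_
    simp only [kepVec, kepPt, Sum.elim_inl, Sum.elim_inr]
    field_simp
  · have hRd : HasDerivAt (fun t => kepRad mₑ k x (θ t)) _ t :=
      ((hc.const_mul (sma mₑ k x - rad x)).const_sub (sma mₑ k x)).add (hs.const_mul (rho mₑ k x))
    refine (((hRd.const_mul (sma mₑ k x)).fun_inv (by positivity)).const_mul (kap mₑ k x) |>.mul
      (((hs.const_mul (sma mₑ k x / rad x)).neg.mul_const (x (.inl j))).add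
      ((((hs.const_mul (rho mₑ k x)).add (hc.const_mul (rad x))).const_mul
        (sma mₑ k x / kap mₑ k x)).mul_const (x (.inr j))))).congr_deriv ?_
    simp only [kepVec, Sum.elim_inr, h.rad_kepPt hm hk]
    have hRe : kepRad mₑ k x (θ t) = sma mₑ k x - (sma mₑ k x - rad x) * Real.cos (θ t) +
      rho mₑ k x * Real.sin (θ t) := rfl
    simp only [kepPt, Sum.elim_inl, Pi.neg_apply, Pi.add_apply]
    clear hRd hs hc hθ h
    generalize sma mₑ k x = a at *
    generalize kap mₑ k x = κ at *
    generalize rho mₑ k x = ρ at *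
    generalize rad x = r at *
    generalize kepRad mₑ k x (θ t) = R at *
    generalize Real.sin (θ t) = s at *
    generalize Real.cos (θ t) = c at *
    generalize x (.inl j) = X
    generalize x (.inr j) = P
    have hkm : k = κ ^ 2 / (mₑ * a) := by rw [hκ2]; field_simp
    rw [hkm]
    field_simp
    rw [hRe]
    linear_combination ((a - r) * κ * X - a * r * ρ * P) * hsc

theorem exists_orbit (hm : 0 < mₑ) (hk : 0 < k) :
    ∃ θ : ℝ → ℝ, StrictMono (kepTime mₑ k x) ∧ (∀ t, kepTime mₑ k x (θ t) = t) ∧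
      IsKeplerOrbit mₑ k (fun t => kepPt mₑ k x (θ t)) ∧
      ∀ t, HasDerivAt θ (kap mₑ k x / (mₑ * sma mₑ k x * rad (kepPt mₑ k x (θ t)))) t := by
  have ha := h.sma_pos hk
  have hκ := h.kap_pos hm hk
  obtain ⟨c, hc, hle⟩ := h.exists_le_kepRad hk
  have hc' : 0 < mₑ * sma mₑ k x / kap mₑ k x := by positivity
  obtain ⟨hmono, θ, h1, h2⟩ := exists_inverse_of_le_deriv (mul_pos hc' hc)
    hasDerivAt_kepTime fun θ => mul_le_mul_of_nonneg_left (hle θ) hc'.le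
  refine ⟨θ, hmono, h1, fun t => ⟨mem_hydrogenSpace_of_rad ?_, h.hasDerivAt_kepPt hm hk (h2 t)⟩,
    fun t => ?_⟩
  · rw [h.rad_kepPt hm hk]
    exact h.kepRad_pos hk _
  · convert h2 t using 1
    have := h.kepRad_pos hk (θ t)
    rw [h.rad_kepPt hm hk]
    field_simp

theorem flow_kepTime (hm : 0 < mₑ) (hk : 0 < k) (θ : ℝ) :
    flow (hamVec (hydrogenH mₑ k)) hydrogenSpace (kepTime mₑ k x θ) x = kepPt mₑ k x θ := by
  obtain ⟨Θ, hmono, h1, h2, -⟩ := h.exists_orbit hm hk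
  have e : ∀ θ, Θ (kepTime mₑ k x θ) = θ := fun θ => hmono.injective (h1 _)
  have e0 : Θ 0 = 0 := by
    have := e 0
    rwa [show kepTime mₑ k x 0 = 0 by simp [kepTime]] at this
  have := h2.eq_flow (kepTime mₑ k x θ)
  simp only [e, e0, h.kepPt_zero hm hk] at this
  exact this.symm

end IsElliptic

/-! ### Differentiability of the flow -/

/-- If the values `φ x` are those of a differentiable `P` at the solutions of an implicit equation,
then `φ` is differentiable. -/
theorem differentiableAt_of_implicit {A B : Type*} [NormedAddCommGroup A] [NormedSpace ℝ A]
    [CompleteSpace A] [NormedAddCommGroup B] [NormedSpace ℝ B] {K : A × ℝ → ℝ} {P : A × ℝ → B}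
    {s : A} {θ c : ℝ} (hK : ContDiffAt ℝ 1 K (s, θ)) (hP : DifferentiableAt ℝ P (s, θ))
    (hd : HasDerivAt (fun τ => K (s, τ)) c θ) (hc : c ≠ 0) {φ : A → B}
    (hφ : ∀ᶠ x in nhds s, ∀ τ, K (x, τ) = K (s, θ) → φ x = P (x, τ)) :
    DifferentiableAt ℝ φ s := by
  have hstrict := hK.hasStrictFDerivAt one_ne_zero
  set L := fderiv ℝ K (s, θ)
  have hpart : (L ∘L .inr ℝ A ℝ) 1 ≠ 0 := by
    have h1 : HasFDerivAt (fun τ : ℝ => K (s, τ)) (L ∘L .inr ℝ A ℝ) θ :=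
      HasFDerivAt.comp θ (g := K) hstrict.hasFDerivAt (hasFDerivAt_prodMk_right s θ)
    rw [h1.hasDerivAt.unique hd]
    exact hc
  have hinv : (L ∘L .inr ℝ A ℝ).IsInvertible := by
    refine ⟨ContinuousLinearEquiv.unitsEquivAut ℝ (Units.mk0 _ hpart), ?_⟩
    ext
    simp
  have h1 := hstrict.eventually_apply_implicitFunctionOfProdDomain hinv
  have h2 := (hstrict.hasStrictFDerivAt_implicitFunctionOfProdDomain hinv).hasFDerivAt
  have h3 : hstrict.implicitFunctionOfProdDomain hinv s = θ :=
    (hstrict.eventually_apply_eq_iff_implicitFunctionOfProdDomain hinv).self_of_nhds.mp rfl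
  set ψ := hstrict.implicitFunctionOfProdDomain hinv
  have h4 : DifferentiableAt ℝ (fun x => P (x, ψ x)) s := by
    rw [← h3] at hP
    exact DifferentiableAt.comp s (f := fun x => (x, ψ x)) hP
      (differentiableAt_id.prodMk h2.differentiableAt)
  refine h4.congr_of_eventuallyEq ?_
  filter_upwards [h1, hφ] with x hx1 hx2
  exact hx2 _ hx1

section Smooth

variable {mₑ k : ℝ} {s : V 3}

theorem contDiffAt_hydrogenH (hs : s ∈ hydrogenSpace) : ContDiffAt ℝ 1 (hydrogenH mₑ k) s := by
  have hr := contDiffAt_rad hs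
  have : hydrogenH mₑ k = fun x => 1 / (2 * mₑ) * ∑ j, x (.inr j) ^ 2 - k / rad x := rfl
  rw [this]
  exact ContDiffAt.sub (by fun_prop) (contDiffAt_const.div hr (rad_pos hs).ne')

variable (h : IsElliptic mₑ k s)
include h

theorem IsElliptic.contDiffAt_sma : ContDiffAt ℝ 1 (sma mₑ k) s :=
  contDiffAt_const.div (contDiffAt_const.mul (contDiffAt_hydrogenH h.mem))
    (mul_ne_zero two_ne_zero h.neg.ne)

theorem IsElliptic.contDiffAt_kap (hm : 0 < mₑ) (hk : 0 < k) : ContDiffAt ℝ 1 (kap mₑ k) s :=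
  (contDiffAt_const.mul h.contDiffAt_sma).sqrt (by have := h.sma_pos hk; positivity)

theorem IsElliptic.contDiffAt_rho (hm : 0 < mₑ) (hk : 0 < k) : ContDiffAt ℝ 1 (rho mₑ k) s := by
  have h1 : ContDiffAt ℝ 1 dotqp s := by unfold dotqp; fun_prop
  exact (h1.mul (h.contDiffAt_kap hm hk)).div_const _

theorem IsElliptic.eventually (hm : 0 < mₑ) (hk : 0 < k) : ∀ᶠ x in nhds s, IsElliptic mₑ k x := by
  have h1 := (contDiffAt_hydrogenH (mₑ := mₑ) (k := k) h.mem).continuousAt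
  have h2 := h.contDiffAt_sma.continuousAt
  have h3 := (h.contDiffAt_rho hm hk).continuousAt
  have h4 := (contDiffAt_rad h.mem).continuousAt
  filter_upwards [isOpen_hydrogenSpace.mem_nhds h.mem, h1.eventually_lt_const h.neg,
    (((h2.sub h4).pow 2).add (h3.pow 2)).eventually_lt (h2.pow 2) h.lt] with x hx1 hx2 hx3
  exact ⟨hx1, hx2, hx3⟩

theorem IsElliptic.contDiffAt_kepTime (hm : 0 < mₑ) (hk : 0 < k) (θ : ℝ) :
    ContDiffAt ℝ 1 (fun p : V 3 × ℝ => kepTime mₑ k p.1 p.2) (s, θ) := by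
  have ha : ContDiffAt ℝ 1 (fun p : V 3 × ℝ => sma mₑ k p.1) (s, θ) :=
    ContDiffAt.comp (g := sma mₑ k) (s, θ) h.contDiffAt_sma contDiffAt_fst
  have hκ : ContDiffAt ℝ 1 (fun p : V 3 × ℝ => kap mₑ k p.1) (s, θ) :=
    ContDiffAt.comp (g := kap mₑ k) (s, θ) (h.contDiffAt_kap hm hk) contDiffAt_fst
  have hρ : ContDiffAt ℝ 1 (fun p : V 3 × ℝ => rho mₑ k p.1) (s, θ) :=
    ContDiffAt.comp (g := rho mₑ k) (s, θ) (h.contDiffAt_rho hm hk) contDiffAt_fst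
  have hr : ContDiffAt ℝ 1 (fun p : V 3 × ℝ => rad p.1) (s, θ) :=
    ContDiffAt.comp (g := rad) (s, θ) (contDiffAt_rad h.mem) contDiffAt_fst
  have hκ0 : kap mₑ k (s, θ).1 ≠ 0 := (h.kap_pos hm hk).ne'
  unfold kepTime
  fun_prop (disch := assumption)

theorem IsElliptic.contDiffAt_kepPt (hm : 0 < mₑ) (hk : 0 < k) (θ : ℝ) :
    ContDiffAt ℝ 1 (fun p : V 3 × ℝ => kepPt mₑ k p.1 p.2) (s, θ) := by
  have ha : ContDiffAt ℝ 1 (fun p : V 3 × ℝ => sma mₑ k p.1) (s, θ) :=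
    ContDiffAt.comp (g := sma mₑ k) (s, θ) h.contDiffAt_sma contDiffAt_fst
  have hκ : ContDiffAt ℝ 1 (fun p : V 3 × ℝ => kap mₑ k p.1) (s, θ) :=
    ContDiffAt.comp (g := kap mₑ k) (s, θ) (h.contDiffAt_kap hm hk) contDiffAt_fst
  have hρ : ContDiffAt ℝ 1 (fun p : V 3 × ℝ => rho mₑ k p.1) (s, θ) :=
    ContDiffAt.comp (g := rho mₑ k) (s, θ) (h.contDiffAt_rho hm hk) contDiffAt_fst
  have hr : ContDiffAt ℝ 1 (fun p : V 3 × ℝ => rad p.1) (s, θ) :=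
    ContDiffAt.comp (g := rad) (s, θ) (contDiffAt_rad h.mem) contDiffAt_fst
  have hκ0 : kap mₑ k (s, θ).1 ≠ 0 := (h.kap_pos hm hk).ne'
  have hr0 : rad (s, θ).1 ≠ 0 := (rad_pos h.mem).ne'
  have hR : ContDiffAt ℝ 1 (fun p : V 3 × ℝ => kepRad mₑ k p.1 p.2) (s, θ) := by
    unfold kepRad
    fun_prop
  have hR0 : sma mₑ k (s, θ).1 * kepRad mₑ k (s, θ).1 (s, θ).2 ≠ 0 :=
    (mul_pos (h.sma_pos hk) (h.kepRad_pos hk θ)).ne'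
  refine contDiffAt_pi.2 ?_
  rintro (j | j)
  · simp only [kepPt, Sum.elim_inl]
    fun_prop (disch := assumption)
  · simp only [kepPt, Sum.elim_inr]
    fun_prop (disch := assumption)

/-- Near a state of an elliptic orbit the flow of the Kepler problem is differentiable: its value
is the state at the eccentric anomaly that solves Kepler's equation. -/
theorem IsElliptic.differentiableAt_flow (hm : 0 < mₑ) (hk : 0 < k) (t : ℝ) :
    DifferentiableAt ℝ (flow (hamVec (hydrogenH mₑ k)) hydrogenSpace t) s := by
  obtain ⟨Θ, -, hΘ, -, -⟩ := h.exists_orbit hm hk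
  have h2 := h.sma_pos hk
  have h3 := h.kap_pos hm hk
  have h4 := h.kepRad_pos hk (Θ t)
  refine differentiableAt_of_implicit (h.contDiffAt_kepTime hm hk (Θ t))
    ((h.contDiffAt_kepPt hm hk (Θ t)).differentiableAt one_ne_zero) (hasDerivAt_kepTime (Θ t))
    (by positivity) ?_
  filter_upwards [h.eventually hm hk] with x hx τ hτ
  change kepTime mₑ k x τ = kepTime mₑ k s (Θ t) at hτ
  rw [← hx.flow_kepTime hm hk, hτ, hΘ]

end Smooth

/-! ### The quantization condition -/

/-- The state with `q = (a, 0, 0)` and `p = (0, κ / a, 0)`; if `κ² = mₑ k a`, it is on a circular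
orbit of radius `a`. -/
def circPt (a κ : ℝ) : V 3 := Sum.elim ![a, 0, 0] ![0, κ / a, 0]

theorem rad_circPt {a : ℝ} (ha : 0 < a) (κ : ℝ) : rad (circPt a κ) = a := by
  simp [rad, circPt, Fin.sum_univ_three, Real.sqrt_sq ha.le]

theorem hydrogenH_circPt {mₑ k a κ : ℝ} (hm : 0 < mₑ) (ha : 0 < a) (hκ : κ ^ 2 = mₑ * k * a) :
    hydrogenH mₑ k (circPt a κ) = -k / (2 * a) := by
  change 1 / (2 * mₑ) * psq (circPt a κ) - k / rad (circPt a κ) = _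
  rw [rad_circPt ha, psq]
  simp [circPt, Fin.sum_univ_three, div_pow, hκ]
  field_simp
  ring

theorem isElliptic_circPt {mₑ k a κ : ℝ} (hm : 0 < mₑ) (hk : 0 < k) (ha : 0 < a)
    (hκ : κ ^ 2 = mₑ * k * a) : IsElliptic mₑ k (circPt a κ) := by
  have hr := rad_circPt ha κ
  have hH := hydrogenH_circPt hm ha hκ
  have hs : sma mₑ k (circPt a κ) = a := by rw [sma, hH]; field_simp
  have hd : dotqp (circPt a κ) = 0 := by simp [dotqp, circPt, Fin.sum_univ_three]
  refine ⟨mem_hydrogenSpace_of_rad (by rw [hr]; exact ha), ?_, ?_⟩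
  · rw [hH, neg_div]
    exact neg_neg_of_pos (by positivity)
  · rw [rho, hd, hs, hr]
    have : 0 < a ^ 2 := by positivity
    simpa using this

/-- If the holonomy over all closed orbits of frames of energy `-k / (2 a)` is trivial, then
`κ = √(mₑ k a)` is a multiple of `ħ`: over the circular orbit, the phase of the holonomy is
`exp (-2 π i κ / ħ)`. -/
theorem exists_eq_of_trivialHolonomy {mₑ k a κ ħ E : ℝ} (hm : 0 < mₑ) (hk : 0 < k) (ha : 0 < a)
    (hħ : 0 < ħ) (hκ0 : 0 < κ) (hκ : κ ^ 2 = mₑ * k * a) (hE : E = -k / (2 * a))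
    (hhol : ∀ (c : ℝ → RedFrame hydrogenSpace (hydrogenH mₑ k) E) (T : ℝ),
      IsClosedFrameOrbit c T → TrivialHolonomy ħ hydrogenβ c T) :
    ∃ n : ℕ, 1 ≤ n ∧ κ = n * ħ := by
  set s := circPt a κ with hs
  have hell : IsElliptic mₑ k s := isElliptic_circPt hm hk ha hκ
  have hH : hydrogenH mₑ k s = E := (hydrogenH_circPt hm ha hκ).trans hE.symm
  have hsma : sma mₑ k s = a := by rw [sma, hH, hE]; field_simp
  have hkap : kap mₑ k s = κ := by rw [kap, hsma, ← hκ, Real.sqrt_sq hκ0.le]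
  obtain ⟨θ, hmono, hθ, hm', hθd⟩ := hell.exists_orbit hm hk
  have hθe : ∀ τ, θ (kepTime mₑ k s τ) = τ := fun τ => hmono.injective (hθ _)
  have hθ0 : θ 0 = 0 := by
    have := hθe 0
    rwa [show kepTime mₑ k s 0 = 0 by simp [kepTime]] at this
  set m : ℝ → V 3 := fun t => kepPt mₑ k s (θ t) with hmdef
  have hm0 : m 0 = s := by simp only [m, hθ0]; exact hell.kepPt_zero hm hk
  set T := kepTime mₑ k s (2 * Real.pi) with hTdef
  have hT : 0 < T := by
    have := hmono (show (0 : ℝ) < 2 * Real.pi by positivity)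
    rwa [show kepTime mₑ k s 0 = 0 by simp [kepTime]] at this
  have hθT : θ T = 2 * Real.pi := hθe _
  have hper : m T = m 0 := by
    simp only [m, hθ0, hθT]
    simp [kepPt, kepRad]
  obtain ⟨b, F, hbpt, hbF, hbd, hb⟩ := hm'.exists_integralFrame hm hk ha hκ0 hκ
    (by rw [hm0, hH]) hE (hm'.exists_ang_ne_zero hk hT hper)
  have hflow : ∀ t, m t = flow (hamVec (hydrogenH mₑ k)) hydrogenSpace t s := fun t => by
    rw [← hm0]; exact hm'.eq_flow t
  have hb0 : (b 0).pt = s := (hbpt 0).trans hm0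
  have horb : IsFrameOrbit fun t => (b t).toFrame 1 := by
    refine hbF.isFrameOrbit isOpen_hydrogenSpace (fun t => ?_) (fun t => ?_)
      (fun t x _ => hydrogenH_flow t x)
      (fun t => (hasFDerivAt_hydrogenH mₑ k (b t).mem.1).differentiableAt) fun t => ?_
    · rw [hb0]
      exact ⟨m, IsIntegralFrom.of_hasDerivAt hm0 (fun t => by
        rw [hamVec_hydrogenH mₑ k (hm' t).1]; exact hm' t) t⟩
    · rw [hb0, hbpt, ← hflow]
    · rw [hb0]
      exact hell.differentiableAt_flow hm hk t
  have hclosed : IsClosedFrameOrbit (fun t => (b t).toFrame 1) T :=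
    ⟨hT, horb, by simp only [hb T 0 hper]⟩
  have hbe : (fun t => (b t).pt) = m := funext hbpt
  have hS : ∀ t, HasDerivAt (fun t => dotqp (m t) - κ * θ t)
      (hydrogenβ (b t).pt (deriv (fun τ => (b τ).pt) t)) t := by
    intro t
    rw [hbe, hbpt t]
    refine hm'.hasDerivAt_action hm ha hκ (fun t => ?_) t
    have := hθd t
    rwa [hsma, hkap] at this
  have hlift := isHorizontalLift_scalar hħ.ne' hbF.η_eq_one
    (by rw [hbe]; exact fun t => (hm' t).2.differentiableAt) hbd hS
  have hTr := hhol _ T hclosed _ hlift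
  simp only [hb T 0 hper] at hTr
  have hz := PDown.mk_scalar_inj hTr
  rw [hper, hθT, hθ0] at hz
  obtain ⟨j, hj⟩ := Circle.exp_eq_exp.1 hz
  have hj' : κ = -j * ħ := by
    have hpi := Real.pi_pos
    field_simp at hj
    have : 2 * Real.pi * (κ + j * ħ) = 0 := by linarith
    have := (mul_eq_zero.1 this).resolve_left (by positivity)
    linarith
  have hjneg : 0 < -j := by
    by_contra hneg
    have : ((-j : ℤ) : ℝ) ≤ 0 := by exact_mod_cast not_lt.1 hneg
    push_cast at this
    nlinarith
  refine ⟨(-j).toNat, by omega, ?_⟩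
  have : (((-j).toNat : ℤ) : ℝ) = ((-j : ℤ) : ℝ) := by rw [Int.toNat_of_nonneg hjneg.le]
  rw [hj']
  push_cast at this
  rw [this]

end MpcQuant

end

open MpcQuant in
theorem mainTheorem1 (mₑ k ħ : ℝ) (hm : 0 < mₑ) (hk : 0 < k) (hħ : 0 < ħ) :
    (∀ E : ℝ, 0 ≤ E →
      (∀ s ∈ level hydrogenSpace (hydrogenH mₑ k) E, ∀ T : ℝ, 0 < T →
        FlowDefined (hamVec (hydrogenH mₑ k)) hydrogenSpace T s →
        flow (hamVec (hydrogenH mₑ k)) hydrogenSpace T s ≠ s) ∧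
      (¬ ∃ (c : ℝ → RedFrame hydrogenSpace (hydrogenH mₑ k) E) (T : ℝ), IsClosedFrameOrbit c T) ∧
      IsQuantizedLevel ħ hydrogenβ hydrogenSpace (hydrogenH mₑ k) E) ∧
    (∀ E : ℝ, E < 0 →
      (IsQuantizedLevel ħ hydrogenβ hydrogenSpace (hydrogenH mₑ k) E ↔
        ∃ n : ℕ, 1 ≤ n ∧ E = -(mₑ * k ^ 2) / (2 * (n : ℝ) ^ 2 * ħ ^ 2))) := by
  refine ⟨fun E hE => ⟨fun s hs T hT h => flow_ne_self hm hk hE hs hT h,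
    fun ⟨c, T, hc⟩ => not_isClosedFrameOrbit hm hk hE c T hc,
    fun m h => fderiv_hydrogenH_ne_zero mₑ hk.ne' h.1,
    fun c T hc => (not_isClosedFrameOrbit hm hk hE c T hc).elim⟩, fun E hE => ?_⟩
  set a := k / (-2 * E) with ha'
  have ha : 0 < a := div_pos hk (by linarith)
  have hEa : E = -k / (2 * a) := by
    have := hE.ne
    rw [ha']; field_simp
  set κ := Real.sqrt (mₑ * k * a)
  have hκ : κ ^ 2 = mₑ * k * a := Real.sq_sqrt (by positivity)
  have hκ0 : 0 < κ := Real.sqrt_pos.2 (by positivity)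
  have key : ∀ n : ℕ, 1 ≤ n →
      (E = -(mₑ * k ^ 2) / (2 * (n : ℝ) ^ 2 * ħ ^ 2) ↔ κ = n * ħ) := by
    intro n hn
    have hn' : (0 : ℝ) < n := by exact_mod_cast hn
    rw [← pow_left_inj₀ hκ0.le (by positivity) two_ne_zero, hκ, hEa,
      div_eq_div_iff (by positivity) (by positivity)]
    constructor
    · intro h
      have : (2 * k) * (mₑ * k * a) = (2 * k) * ((n * ħ) ^ 2) := by linear_combination h
      exact mul_left_cancel₀ (by positivity) this
    · intro h
      linear_combination (2 * k) * h
  constructor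
  · rintro ⟨-, h⟩
    obtain ⟨n, hn, hκn⟩ := exists_eq_of_trivialHolonomy hm hk ha hħ hκ0 hκ hEa h
    exact ⟨n, hn, (key n hn).2 hκn⟩
  · rintro ⟨n, hn, hEn⟩
    exact ⟨fun m h => fderiv_hydrogenH_ne_zero mₑ hk.ne' h.1,
      fun c T hc => trivialHolonomy_of_eq hm hk ha hħ hκ0 hκ hEa ((key n hn).1 hEn) hc⟩
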